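/- Let $M^3$ be a smooth three-manifold, $J\subset\mathbb R$ and $U\subset M^3$ open sets, and let $\gamma=-N^2dt^2+g(t,x)$ be a smooth Lorentzian metric on $J\times U$ with lapse $N>0$ and $g(t,\cdot)$ Riemannian on the slices. Put $T=N^{-1}\partial_t$, $D_Tf=N^{-1}\partial_tf$ for functions $f$, $h_{ij}=-\frac1{2N}\partial_tg_{ij}$, $H=g^{ij}h_{ij}$, $\bar\gamma=N^2dt^2+g$, and let $R_{\alpha\beta\gamma\delta}$, $W_{\alpha\beta\gamma\delta}$ be the Riemann and Weyl tensors of $\gamma$, $R_{\alpha\beta}$ its Ricci tensor and $R$ its scalar curvature. Let $m,k,\alpha$ be real functions on $J\times U$, with $k$ differentiable and $\alpha$ twice continuously differentiable in $t$, such that: 1. ($k$-perfect fluid electric region) $R_{\alpha\beta}-\frac12R\,\gamma_{\alpha\beta}=\mathcal T_{\alpha\beta}$ with $\mathcal T_{TT}=m$, $\mathcal T_{Ti}=0$, $\mathcal T_{ij}=(k-1)\,m\,g_{ij}$, $k\in[0,\frac43]$, and $W_{Tijl}=0$; 2. ($\alpha$-expanding) $\alpha\in[0,\frac13]$ and $h\le\alpha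 Hg\le0$ as quadratic forms; 3. (evolution inequalities) $D_Tk=k'H$ and $D_T\alpha=\alpha'H$, where $k'=\alpha'=0$ where $H=0$ (so $D_Tk=D_T\alpha=0$ there), $\alpha'\ge0$, and $$0\le k',\qquad 3(4-3k)\,k'\le k(9k^2-12k+8)\min\Big\{\frac{9\alpha'}{4(1-3\alpha)},1\Big\},$$ the quotient being read as $+\infty$ where $\alpha=\frac13$. Let $$s_{\rm crit}=\sqrt{1-3\alpha}\Big(\frac{\sqrt2}4+2k\sqrt{\frac{1-3\alpha}{9k^2-12k+8}}\Big),\qquad S^{\rm pf}=(s+s_{\rm crit})\sqrt g,$$ where $s=|W_{\alpha\beta\gamma\delta}|_{\bar\gamma}/|R_{\alpha\beta\gamma\delta}|_{\bar\gamma}$ where the Riemann tensor is nonzero and $s=1$ where it vanishes, and $\sqrt g$ is the square root of the determinant of $(g_{ij})$ in an arbitrary smooth chart of $M^3$ (the statement holds in each of them). Then, for every $x\in U$ in the domain of the chart, $S^{\rm pf}(\cdot,x)$ is nondecreasing on every interval contained in $J$. At every point $(t,x)$ of the region with $x$ in the domain of the chart, $S^{\rm pf}$ has one-sided derivatives in $t$,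 both nonnegative; it is differentiable in $t$ except possibly where $W=0$ and the Riemann tensor is nonzero, and $$D_TS^{\rm pf}\ge0$$ wherever the derivative exists. The function $s_{\rm crit}$ is differentiable in $t$. Moreover, $D_TS^{\rm pf}$ exists and equals $0$ at a point if and only if there $D_Ts_{\rm crit}=0$ and either $h=0$, or $W=0$, the Riemann tensor is nonzero and $\alpha=\frac13$ (hence $s_{\rm crit}=0$). -/

import Mathlib

open scoped Manifold ContDiff Matrix

noncomputable section

namespace WeylEntropy

/-- The model space of the spatial slices. -/
abbrev E3 : Type := EuclideanSpace ℝ (Fin 3)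

/-! ### Curvature in coordinates `(t, x¹, x², x³)`

The index `0` is the time coordinate, the index `i + 1` the spatial coordinate `xⁱ`. -/

/-- The coordinate directions `∂_t, ∂_1, ∂_2, ∂_3`. -/
def coordDir : Fin 4 → ℝ × E3 :=
  Fin.cons ((1 : ℝ), (0 : E3)) (fun i : Fin 3 => ((0 : ℝ), EuclideanSpace.single i (1 : ℝ)))

/-- The partial derivative `∂_μ f` at `p`. -/
def pd (μ : Fin 4) (f : ℝ × E3 → ℝ) (p : ℝ × E3) : ℝ :=
  fderiv ℝ f p (coordDir μ)

/-- The `4 × 4` matrix with time-time entry `a`, vanishing mixed entries and spatial block `b`. -/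
def block (a : ℝ) (b : Matrix (Fin 3) (Fin 3) ℝ) : Matrix (Fin 4) (Fin 4) ℝ :=
  Matrix.of (Fin.cons (Fin.cons a (fun _ : Fin 3 => (0 : ℝ)))
    (fun i : Fin 3 => Fin.cons (0 : ℝ) (fun j : Fin 3 => b i j)))

section Curvature

variable (G : ℝ × E3 → Matrix (Fin 4) (Fin 4) ℝ)

/-- Christoffel symbols `Γ^c_{ab}` of the Levi-Civita connection of `G`. -/
def christoffel (c a b : Fin 4) (p : ℝ × E3) : ℝ :=
  (1 / 2) * ∑ d, (G p)⁻¹ c d *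
    (pd a (fun q => G q b d) p + pd b (fun q => G q a d) p - pd d (fun q => G q a b) p)

/-- `R^a_{bcd} = ∂_c Γ^a_{db} - ∂_d Γ^a_{cb} + Γ^a_{ce} Γ^e_{db} - Γ^a_{de} Γ^e_{cb}`. -/
def riemannUp (a b c d : Fin 4) (p : ℝ × E3) : ℝ :=
  pd c (christoffel G a d b) p - pd d (christoffel G a c b) p
    + ∑ e, (christoffel G a c e p * christoffel G e d b p
      - christoffel G a d e p * christoffel G e c b p)

/-- The Riemann tensor `R_{abcd}`; it equals `G_{ac} G_{bd} - G_{ad} G_{bc}` in curvature one. -/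
def riemann (p : ℝ × E3) (a b c d : Fin 4) : ℝ :=
  ∑ e, G p a e * riemannUp G e b c d p

/-- The Ricci tensor `R_{bd} = G^{ac} R_{abcd}`. -/
def ricci (p : ℝ × E3) (b d : Fin 4) : ℝ :=
  ∑ a, riemannUp G a b a d p

/-- The scalar curvature. -/
def scalar (p : ℝ × E3) : ℝ :=
  ∑ a, ∑ b, (G p)⁻¹ a b * ricci G p a b

/-- The Weyl tensor `W_{abcd}` in dimension four. -/
def weyl (p : ℝ × E3) (a b c d : Fin 4) : ℝ :=
  riemann G p a b c d
    - (1 / 2) * (ricci G p a c * G p b d - ricci G p a d * G p b c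
        + ricci G p b d * G p a c - ricci G p b c * G p a d)
    + (scalar G p / 6) * (G p a c * G p b d - G p a d * G p b c)

/-- The left-hand side `R_{ab} - R G_{ab} / 2` of the Einstein equation. -/
def einstein (p : ℝ × E3) (a b : Fin 4) : ℝ :=
  ricci G p a b - (1 / 2) * scalar G p * G p a b

end Curvature

/-- The norm of a `(0,4)`-tensor with respect to the Riemannian scalar product `B`. -/
def tensorNorm (B : Matrix (Fin 4) (Fin 4) ℝ) (S : Fin 4 → Fin 4 → Fin 4 → Fin 4 → ℝ) : ℝ :=
  Real.sqrt (∑ a, ∑ b, ∑ c, ∑ d, ∑ a', ∑ b', ∑ c', ∑ d',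
    B⁻¹ a a' * B⁻¹ b b' * B⁻¹ c c' * B⁻¹ d d' * S a b c d * S a' b' c' d')

/-! ### The foliated metric `-N² dt² + g` in coordinates -/

section Foliation

variable (N : ℝ × E3 → ℝ) (g : ℝ × E3 → Matrix (Fin 3) (Fin 3) ℝ)

/-- The Lorentzian metric `γ = -N² dt² + g`. -/
def lorentz (p : ℝ × E3) : Matrix (Fin 4) (Fin 4) ℝ := block (-(N p) ^ 2) (g p)

/-- The associated Riemannian metric `γ̄ = N² dt² + g`. -/
def riemannian (p : ℝ × E3) : Matrix (Fin 4) (Fin 4) ℝ := block ((N p) ^ 2) (g p)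

/-- The perfect fluid stress-energy tensor with density `m` and pressure `P`, in the coordinate
frame: `T_{tt} = N² T_{TT} = N² m` because `T = N⁻¹ ∂_t`, while `T_{ti} = 0`, `T_{ij} = P g_{ij}`. -/
def fluidStress (m P : ℝ) (p : ℝ × E3) : Matrix (Fin 4) (Fin 4) ℝ :=
  block ((N p) ^ 2 * m) (P • g p)

/-- The second fundamental form `h_{ij} = -(2N)⁻¹ ∂_t g_{ij}`. -/
def secondForm (p : ℝ × E3) : Matrix (Fin 3) (Fin 3) ℝ :=
  Matrix.of fun i j => -(1 / (2 * N p)) * pd 0 (fun q => g q i j) p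

/-- The mean curvature `H = g^{ij} h_{ij}`. -/
def meanCurv (p : ℝ × E3) : ℝ :=
  ∑ i, ∑ j, (g p)⁻¹ i j * secondForm N g p i j

open Classical in
/-- The Weyl entropy density: `|W| / |R|` (norms taken with `γ̄`) where the Riemann tensor does
not vanish, and `1` where it vanishes. -/
def entropyDensity (p : ℝ × E3) : ℝ :=
  if riemann (lorentz N g) p = 0 then 1
  else tensorNorm (riemannian N g p) (weyl (lorentz N g) p) /
    tensorNorm (riemannian N g p) (riemann (lorentz N g) p)

end Foliation

/-- The critical density
`s_crit = √(1 - 3α) (√2 / 4 + 2 k √((1 - 3α) / (9k² - 12k + 8)))`. -/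
def sCrit (k α : ℝ) : ℝ :=
  Real.sqrt (1 - 3 * α) * (Real.sqrt 2 / 4
    + 2 * k * Real.sqrt ((1 - 3 * α) / (9 * k ^ 2 - 12 * k + 8)))

/-! ### The spacetime `-N² dt² + g` over a three-manifold -/

section Manifold

variable {M : Type*} [TopologicalSpace M] [ChartedSpace E3 M]

/-- `φ` is a smooth chart of `M`. -/
abbrev IsChart (φ : OpenPartialHomeomorph M E3) : Prop :=
  φ ∈ IsManifold.maximalAtlas (𝓡 3) ∞ M

/-- The derivative `D_T f = N⁻¹ ∂_t f` of a function in the direction of the unit normal. -/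
def DT (N : ℝ → M → ℝ) (f : ℝ → M → ℝ) (t : ℝ) (x : M) : ℝ :=
  (N t x)⁻¹ * deriv (fun s => f s x) t

/-- A function on `ℝ × M` read in the chart `φ`. -/
def inChart (φ : OpenPartialHomeomorph M E3) (f : ℝ → M → ℝ) : ℝ × E3 → ℝ :=
  fun p => f p.1 (φ.symm p.2)

/-- The components `g_{ij} = g(∂_i, ∂_j)` of a time-dependent bilinear form in the chart `φ`. -/
def metricInChart (φ : OpenPartialHomeomorph M E3)
    (g : ℝ → (x : M) → TangentSpace (𝓡 3) x →L[ℝ] TangentSpace (𝓡 3) x →L[ℝ] ℝ) :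
    ℝ × E3 → Matrix (Fin 3) (Fin 3) ℝ :=
  fun p => Matrix.of fun i j =>
    g p.1 (φ.symm p.2)
      (mfderiv (𝓡 3) (𝓡 3) φ.symm p.2 (EuclideanSpace.single i (1 : ℝ) : E3))
      (mfderiv (𝓡 3) (𝓡 3) φ.symm p.2 (EuclideanSpace.single j (1 : ℝ) : E3))

variable (N : ℝ → M → ℝ)
  (g : ℝ → (x : M) → TangentSpace (𝓡 3) x →L[ℝ] TangentSpace (𝓡 3) x →L[ℝ] ℝ)

/-- The Weyl tensor of `-N² dt² + g` at `(t, x)`, in the coordinates `(t, φ)`. -/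
def weylAt (φ : OpenPartialHomeomorph M E3) (t : ℝ) (x : M) :
    Fin 4 → Fin 4 → Fin 4 → Fin 4 → ℝ :=
  weyl (lorentz (inChart φ N) (metricInChart φ g)) (t, φ x)

/-- The Riemann tensor of `-N² dt² + g` at `(t, x)`, in the coordinates `(t, φ)`. -/
def riemannAt (φ : OpenPartialHomeomorph M E3) (t : ℝ) (x : M) :
    Fin 4 → Fin 4 → Fin 4 → Fin 4 → ℝ :=
  riemann (lorentz (inChart φ N) (metricInChart φ g)) (t, φ x)

/-- The Einstein tensor of `-N² dt² + g` at `(t, x)`, in the coordinates `(t, φ)`. -/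
def einsteinAt (φ : OpenPartialHomeomorph M E3) (t : ℝ) (x : M) : Fin 4 → Fin 4 → ℝ :=
  einstein (lorentz (inChart φ N) (metricInChart φ g)) (t, φ x)

/-- The components of the second fundamental form at `(t, x)`, in the chart `φ`. -/
def secondFormAt (φ : OpenPartialHomeomorph M E3) (t : ℝ) (x : M) :
    Matrix (Fin 3) (Fin 3) ℝ :=
  secondForm (inChart φ N) (metricInChart φ g) (t, φ x)

/-- The mean curvature at `(t, x)`, computed in the chart `φ`. -/
def meanCurvAt (φ : OpenPartialHomeomorph M E3) (t : ℝ) (x : M) : ℝ :=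
  meanCurv (inChart φ N) (metricInChart φ g) (t, φ x)

/-- The entropy `S^pf = (s + s_crit) √g` at `(t, x)`; `√g` is the density of the spatial volume
in the chart `φ`. -/
def entropyPF (k α : ℝ → M → ℝ) (φ : OpenPartialHomeomorph M E3) (t : ℝ) (x : M) : ℝ :=
  (entropyDensity (inChart φ N) (metricInChart φ g) (t, φ x) + sCrit (k t x) (α t x))
    * Real.sqrt (metricInChart φ g (t, φ x)).det

/-- `-N² dt² + g` is a smooth Lorentzian metric on the open set `J × U ⊆ ℝ × M`, with strictly
positive lapse `N` and Riemannian slices. -/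
structure IsFoliatedSpacetime (J : Set ℝ) (U : Set M) : Prop where
  isOpen_time : IsOpen J
  isOpen_space : IsOpen U
  lapse_smooth : ∀ φ : OpenPartialHomeomorph M E3, IsChart φ →
    ContDiffOn ℝ ∞ (inChart φ N) (J ×ˢ (φ.target ∩ φ.symm ⁻¹' U))
  metric_smooth : ∀ φ : OpenPartialHomeomorph M E3, IsChart φ → ∀ i j,
    ContDiffOn ℝ ∞ (fun p => metricInChart φ g p i j) (J ×ˢ (φ.target ∩ φ.symm ⁻¹' U))
  lapse_pos : ∀ t ∈ J, ∀ x ∈ U, 0 < N t x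
  metric_symm : ∀ t ∈ J, ∀ x ∈ U, ∀ v w : TangentSpace (𝓡 3) x, g t x v w = g t x w v
  metric_pos : ∀ t ∈ J, ∀ x ∈ U, ∀ v : TangentSpace (𝓡 3) x, v ≠ 0 → 0 < g t x v v

/-- `J × U` is a `k`-perfect fluid electric region, with mass density `m`: the Einstein equation
holds with the stress-energy tensor of a perfect fluid of pressure `(k - 1) m`, and the
components `W_{Tijk}` of the Weyl tensor vanish. -/
structure IsPerfectFluidElectricRegion (m k : ℝ → M → ℝ) (J : Set ℝ) (U : Set M) : Prop
    extends IsFoliatedSpacetime N g J U where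
  k_mem : ∀ t ∈ J, ∀ x ∈ U, k t x ∈ Set.Icc (0 : ℝ) (4 / 3)
  einstein_eq : ∀ φ : OpenPartialHomeomorph M E3, IsChart φ →
    ∀ t ∈ J, ∀ x ∈ φ.source ∩ U, ∀ a b : Fin 4,
      einsteinAt N g φ t x a b =
        fluidStress (inChart φ N) (metricInChart φ g) (m t x) ((k t x - 1) * m t x) (t, φ x) a b
  electric : ∀ φ : OpenPartialHomeomorph M E3, IsChart φ →
    ∀ t ∈ J, ∀ x ∈ φ.source ∩ U, ∀ i j l : Fin 3,
      weylAt N g φ t x 0 i.succ j.succ l.succ = 0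

/-- `J × U` is an `α`-expanding region: `h ≤ α H g ≤ 0` as quadratic forms. -/
structure IsExpandingRegion (α : ℝ → M → ℝ) (J : Set ℝ) (U : Set M) : Prop where
  α_mem : ∀ t ∈ J, ∀ x ∈ U, α t x ∈ Set.Icc (0 : ℝ) (1 / 3)
  expanding : ∀ φ : OpenPartialHomeomorph M E3, IsChart φ →
    ∀ t ∈ J, ∀ x ∈ φ.source ∩ U, ∀ v : Fin 3 → ℝ,
      v ⬝ᵥ (secondFormAt N g φ t x *ᵥ v) ≤
          α t x * meanCurvAt N g φ t x * (v ⬝ᵥ (metricInChart φ g (t, φ x) *ᵥ v)) ∧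
        α t x * meanCurvAt N g φ t x * (v ⬝ᵥ (metricInChart φ g (t, φ x) *ᵥ v)) ≤ 0

/-- The rate `u'` with `D_T u = u' H`; it is `0` where `H = 0`, by the convention `y / 0 = 0`. -/
def rate (u : ℝ → M → ℝ) (φ : OpenPartialHomeomorph M E3) (t : ℝ) (x : M) : ℝ :=
  DT N u t x / meanCurvAt N g φ t x

/-- The evolution inequalities
`0 ≤ k' ≤ k (9k² - 12k + 8) / (3 (4 - 3k)) · min {9α' / (4 (1 - 3α)), 1}` and `0 ≤ α'`,
where `D_T k = k' H`, `D_T α = α' H` and `k' = α' = 0` where `H = 0`.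
The denominator `3 (4 - 3k)` is multiplied out, and the quotient inside the minimum counts as
`+∞` where `α = 1/3`. -/
structure EvolutionInequalities (k α : ℝ → M → ℝ) (J : Set ℝ) (U : Set M) : Prop where
  k_diff : ∀ x ∈ U, DifferentiableOn ℝ (fun t => k t x) J
  α_diff : ∀ x ∈ U, ContDiffOn ℝ 2 (fun t => α t x) J
  stationary : ∀ φ : OpenPartialHomeomorph M E3, IsChart φ →
    ∀ t ∈ J, ∀ x ∈ φ.source ∩ U, meanCurvAt N g φ t x = 0 → DT N k t x = 0 ∧ DT N α t x = 0
  α_rate : ∀ φ : OpenPartialHomeomorph M E3, IsChart φ →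
    ∀ t ∈ J, ∀ x ∈ φ.source ∩ U, 0 ≤ rate N g α φ t x
  k_rate : ∀ φ : OpenPartialHomeomorph M E3, IsChart φ →
    ∀ t ∈ J, ∀ x ∈ φ.source ∩ U, 0 ≤ rate N g k φ t x
  k_rate_le : ∀ φ : OpenPartialHomeomorph M E3, IsChart φ →
    ∀ t ∈ J, ∀ x ∈ φ.source ∩ U,
      3 * (4 - 3 * k t x) * rate N g k φ t x ≤
        k t x * (9 * k t x ^ 2 - 12 * k t x + 8) *
          (open Classical in if α t x = 1 / 3 then 1
           else min (9 * rate N g α φ t x / (4 * (1 - 3 * α t x))) 1)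

end Manifold

end WeylEntropy

end

noncomputable section

namespace WeylEntropy

/-! ### Partial derivatives of smooth functions on an open set -/

section PartialDerivatives

variable {Ω : Set (ℝ × E3)} {f f' : ℝ × E3 → ℝ} {p : ℝ × E3} {μ ν : Fin 4}

/-! The fluid has no momentum and `W_{Tijl} = 0`, so `R_{Tijl} = 0`, and the whole curvature is
encoded by the density `m` and the traceless, g-selfadjoint endomorphism `X = g⁻¹ W_{T·T·}`. With `q
= 9k² - 12k + 8` one finds `|W|² = 8 tr X²` and `|R|² = 8 tr X² + q m²/3` (`tensorNorm_weyl`,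
`tensorNorm_riemann`). In the second Bianchi identity with one time index, the spatial derivatives
fall only on components that vanish identically. Hence it is an ordinary differential equation along
each time line. With `K = g⁻¹ h` it reads `D_T X = tr(KX) 1 + 2H X - 2XK - KX + (km/2)(K - H/3)`,
accompanied by `D_T m = k m H` and `D_T √g = -H √g` (`pdM_electric`, `pd_density`,
`sqrt_det_deriv`).

The expansion condition says that `Q = αH - K` is positive semidefinite, with trace `(1 - 3α)(-H)`.
This gives `tr(KX²) ≤ αH tr X²` and bounds `|tr(KX)|` by `√(2/3) (1 - 3α)(-H) |X|`
(`expansion_bounds`). Put `θ = -H`, `b = 1 - 3α`. Where `m` and `X` are nonzero the ratio `s =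
|W|/|R|` then satisfies `D_T s ≥ -θ ((1 + b)(1 - s²) s + 2b (k/√q)(1 - s²)^{3/2})`, while the growth
of `√g` contributes `θ (s + s_crit)`. Since `s_crit = (√2/4) √b + 2b k/√q`, its second summand
absorbs the term with `k`, and what remains is bounded below by `θ` times `s (1 - (1 + b)(1 - s²)) +
(√2/4) √b`, which is positive (`critical_polynomial_pos`, `entropy_rate_pos`). The evolution
inequalities make `s_crit` itself nondecreasing (`sCrit_deriv`).

Two degenerate cases remain. If `m = 0` at some time, then the linear equation for `m` makes it
vanish nearby, and `s = 1` there. If `X = 0` and `m ≠ 0`, then `s` has one-sided derivatives `±σ`,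
where only the source term `(km/2)(K - H/3)` enters, and `σ ≤ 2θ b k/√q`: again the second summand
of `s_crit`. So both one-sided derivatives of the entropy are nonnegative everywhere, and the right
one gives monotonicity. If the derivative vanishes and `H < 0`, the strict inequalities exclude
everything but `X = 0`, `m ≠ 0`, where averaging the two one-sided derivatives forces `s_crit = 0`.
If `H = 0`, then `tr Q = 0`, so `Q = 0` and `h = 0`. -/

theorem _root_.ContDiffOn.differentiableAt_of_isOpen (hΩ : IsOpen Ω) (hf : ContDiffOn ℝ ∞ f Ω)
    (hp : p ∈ Ω) : DifferentiableAt ℝ f p :=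
  (hf.contDiffAt (hΩ.mem_nhds hp)).differentiableAt (by simp)

theorem pd_congr (hΩ : IsOpen Ω) (h : Set.EqOn f f' Ω) (hp : p ∈ Ω) : pd μ f p = pd μ f' p := by
  unfold pd
  rw [(h.eventuallyEq_of_mem (hΩ.mem_nhds hp)).fderiv_eq]

theorem pd_contDiffOn (hΩ : IsOpen Ω) (hf : ContDiffOn ℝ ∞ f Ω) : ContDiffOn ℝ ∞ (pd μ f) Ω :=
  (hf.fderiv_of_isOpen hΩ (m := ∞) (by simp)).clm_apply contDiffOn_const

theorem pd_zero_fun : pd μ (fun _ => 0) p = 0 := by simp [pd]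

theorem pd_add (hf : DifferentiableAt ℝ f p) (hf' : DifferentiableAt ℝ f' p) :
    pd μ (fun q => f q + f' q) p = pd μ f p + pd μ f' p := by
  simp [pd, fderiv_fun_add hf hf']

theorem pd_sub (hf : DifferentiableAt ℝ f p) (hf' : DifferentiableAt ℝ f' p) :
    pd μ (fun q => f q - f' q) p = pd μ f p - pd μ f' p := by
  simp [pd, fderiv_fun_sub hf hf']

theorem pd_mul (hf : DifferentiableAt ℝ f p) (hf' : DifferentiableAt ℝ f' p) :
    pd μ (fun q => f q * f' q) p = pd μ f p * f' p + f p * pd μ f' p := by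
  simp [pd, fderiv_fun_mul hf hf']; ring

theorem pd_sum {ι : Type*} {s : Finset ι} {F : ι → ℝ × E3 → ℝ}
    (hF : ∀ i ∈ s, DifferentiableAt ℝ (F i) p) :
    pd μ (fun q => ∑ i ∈ s, F i q) p = ∑ i ∈ s, pd μ (F i) p := by
  simp [pd, fderiv_fun_sum hF]

theorem pd_comm (hΩ : IsOpen Ω) (hf : ContDiffOn ℝ ∞ f Ω) (hp : p ∈ Ω) :
    pd μ (pd ν f) p = pd ν (pd μ f) p := by
  have hsymm : IsSymmSndFDerivAt ℝ f p :=
    (hf.contDiffAt (hΩ.mem_nhds hp)).isSymmSndFDerivAt (by simpa using WithTop.coe_le_coe.2 (le_top (a := (2 : ℕ∞))))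
  have hd : DifferentiableAt ℝ (fderiv ℝ f) p :=
    ((hf.fderiv_of_isOpen hΩ (m := ∞) (by simp)).contDiffAt
      (hΩ.mem_nhds hp)).differentiableAt (by simp)
  have key : ∀ a b : Fin 4, pd a (pd b f) p
      = fderiv ℝ (fderiv ℝ f) p (coordDir a) (coordDir b) := by
    intro a b
    unfold pd
    rw [fderiv_clm_apply hd (differentiableAt_const _)]
    simp
  rw [key, key, hsymm.eq]

/-- The partial derivative in the time direction is the derivative along the time line. -/
theorem hasDerivAt_time {t : ℝ} {y : E3} (hf : DifferentiableAt ℝ f (t, y)) :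
    HasDerivAt (fun s => f (s, y)) (pd 0 f (t, y)) t := by
  have h := hf.hasFDerivAt.comp_hasDerivAt t
    ((hasDerivAt_id t).prodMk (hasDerivAt_const t y))
  exact h

end PartialDerivatives

/-! ### Matrix-valued functions -/

section MatrixCalculus

variable {Ω : Set (ℝ × E3)} {ι κ l : Type*} {p : ℝ × E3} {μ ν : Fin 4}

/-- Smoothness of all entries of a matrix-valued function. -/
def MatSmooth (Ω : Set (ℝ × E3)) (F : ℝ × E3 → Matrix ι κ ℝ) : Prop :=
  ∀ i j, ContDiffOn ℝ ∞ (fun q => F q i j) Ω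

/-- Entrywise partial derivative. -/
def pdM (μ : Fin 4) (F : ℝ × E3 → Matrix ι κ ℝ) (p : ℝ × E3) : Matrix ι κ ℝ :=
  Matrix.of fun i j => pd μ (fun q => F q i j) p

theorem pdM_apply (F : ℝ × E3 → Matrix ι κ ℝ) (i : ι) (j : κ) :
    pdM μ F p i j = pd μ (fun q => F q i j) p := rfl

theorem MatSmooth.differentiableAt {F : ℝ × E3 → Matrix ι κ ℝ} (hF : MatSmooth Ω F)
    (hΩ : IsOpen Ω) (hp : p ∈ Ω) (i : ι) (j : κ) : DifferentiableAt ℝ (fun q => F q i j) p :=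
  (hF i j).differentiableAt_of_isOpen hΩ hp

theorem MatSmooth.add {F F' : ℝ × E3 → Matrix ι κ ℝ} (hF : MatSmooth Ω F)
    (hF' : MatSmooth Ω F') : MatSmooth Ω (fun q => F q + F' q) :=
  fun i j => (hF i j).add (hF' i j)

theorem MatSmooth.sub {F F' : ℝ × E3 → Matrix ι κ ℝ} (hF : MatSmooth Ω F)
    (hF' : MatSmooth Ω F') : MatSmooth Ω (fun q => F q - F' q) :=
  fun i j => (hF i j).sub (hF' i j)

theorem MatSmooth.mul {F : ℝ × E3 → Matrix ι κ ℝ} {F' : ℝ × E3 → Matrix κ l ℝ} [Fintype κ]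
    (hF : MatSmooth Ω F) (hF' : MatSmooth Ω F') : MatSmooth Ω (fun q => F q * F' q) := by
  intro i j
  simp only [Matrix.mul_apply]
  exact ContDiffOn.sum fun e _ => (hF i e).mul (hF' e j)

theorem MatSmooth.transpose {F : ℝ × E3 → Matrix ι κ ℝ} (hF : MatSmooth Ω F) :
    MatSmooth Ω (fun q => (F q)ᵀ) := fun i j => hF j i

theorem MatSmooth.pdM {F : ℝ × E3 → Matrix ι κ ℝ} (hΩ : IsOpen Ω) (hF : MatSmooth Ω F) :
    MatSmooth Ω (pdM μ F) := fun i j => pd_contDiffOn hΩ (hF i j)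

theorem MatSmooth.congr {F F' : ℝ × E3 → Matrix ι κ ℝ} (hF : MatSmooth Ω F)
    (h : Set.EqOn F' F Ω) : MatSmooth Ω F' :=
  fun i j => (hF i j).congr fun q hq => by rw [h hq]

theorem contDiffOn_det [Fintype κ] [DecidableEq κ] {F : ℝ × E3 → Matrix κ κ ℝ} (hF : MatSmooth Ω F) :
    ContDiffOn ℝ ∞ (fun q => (F q).det) Ω := by
  simp only [Matrix.det_apply']
  exact ContDiffOn.sum fun σ _ => contDiffOn_const.mul (contDiffOn_prod fun i _ => hF _ _)

theorem MatSmooth.inv [Fintype κ] [DecidableEq κ] {F : ℝ × E3 → Matrix κ κ ℝ} (hF : MatSmooth Ω F)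
    (hdet : ∀ q ∈ Ω, (F q).det ≠ 0) : MatSmooth Ω (fun q => (F q)⁻¹) := by
  intro i j
  have h1 : ContDiffOn ℝ ∞ (fun q => (F q).adjugate i j) Ω := by
    simp only [Matrix.adjugate_apply]
    refine contDiffOn_det (F := fun q => (F q).updateRow j (Pi.single i 1)) fun a b => ?_
    by_cases h : a = j
    · subst h; simpa using contDiffOn_const
    · simpa [Matrix.updateRow_ne h] using hF a b
  have h2 := ((contDiffOn_det hF).inv hdet).mul h1
  refine h2.congr fun q _ => ?_
  simp [Matrix.inv_def]

theorem pdM_congr {F F' : ℝ × E3 → Matrix ι κ ℝ} (hΩ : IsOpen Ω) (h : Set.EqOn F F' Ω)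
    (hp : p ∈ Ω) : pdM μ F p = pdM μ F' p := by
  ext i j
  exact pd_congr hΩ (fun q hq => by simp only [h hq]) hp

theorem pdM_add {F F' : ℝ × E3 → Matrix ι κ ℝ} (hΩ : IsOpen Ω) (hp : p ∈ Ω)
    (hF : MatSmooth Ω F) (hF' : MatSmooth Ω F') :
    pdM μ (fun q => F q + F' q) p = pdM μ F p + pdM μ F' p := by
  ext i j
  exact pd_add (hF.differentiableAt hΩ hp i j) (hF'.differentiableAt hΩ hp i j)

theorem pdM_sub {F F' : ℝ × E3 → Matrix ι κ ℝ} (hΩ : IsOpen Ω) (hp : p ∈ Ω)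
    (hF : MatSmooth Ω F) (hF' : MatSmooth Ω F') :
    pdM μ (fun q => F q - F' q) p = pdM μ F p - pdM μ F' p := by
  ext i j
  exact pd_sub (hF.differentiableAt hΩ hp i j) (hF'.differentiableAt hΩ hp i j)

theorem pdM_mul {F : ℝ × E3 → Matrix ι κ ℝ} {F' : ℝ × E3 → Matrix κ l ℝ} [Fintype κ]
    (hΩ : IsOpen Ω) (hp : p ∈ Ω) (hF : MatSmooth Ω F) (hF' : MatSmooth Ω F') :
    pdM μ (fun q => F q * F' q) p = pdM μ F p * F' p + F p * pdM μ F' p := by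
  ext i j
  simp only [pdM_apply, Matrix.mul_apply, Matrix.add_apply]
  rw [pd_sum (F := fun e q => F q i e * F' q e j)
    fun e _ => (hF.differentiableAt hΩ hp i e).mul (hF'.differentiableAt hΩ hp e j),
    ← Finset.sum_add_distrib]
  exact Finset.sum_congr rfl fun e _ =>
    pd_mul (hF.differentiableAt hΩ hp i e) (hF'.differentiableAt hΩ hp e j)

theorem pdM_transpose (F : ℝ × E3 → Matrix ι κ ℝ) :
    pdM μ (fun q => (F q)ᵀ) p = (pdM μ F p)ᵀ := rfl

theorem pdM_comm {F : ℝ × E3 → Matrix ι κ ℝ} (hΩ : IsOpen Ω) (hp : p ∈ Ω)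
    (hF : MatSmooth Ω F) : pdM μ (pdM ν F) p = pdM ν (pdM μ F) p := by
  ext i j
  exact pd_comm hΩ (hF i j) hp

theorem pdM_inv [Fintype κ] [DecidableEq κ] {F : ℝ × E3 → Matrix κ κ ℝ} (hΩ : IsOpen Ω) (hp : p ∈ Ω)
    (hF : MatSmooth Ω F) (hdet : ∀ q ∈ Ω, (F q).det ≠ 0) :
    pdM μ (fun q => (F q)⁻¹) p = -((F p)⁻¹ * pdM μ F p * (F p)⁻¹) := by
  have h0 : pdM μ (fun q => F q * (F q)⁻¹) p = 0 := by
    rw [pdM_congr (F' := fun _ => 1) hΩ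
      (fun q hq => Matrix.mul_nonsing_inv _ (hdet q hq).isUnit) hp]
    ext i j
    simp [pdM_apply, pd]
  rw [pdM_mul hΩ hp hF (hF.inv hdet)] at h0
  have h1 : (F p)⁻¹ * F p = 1 := Matrix.nonsing_inv_mul _ (hdet p hp).isUnit
  have h2 := congrArg (fun A => (F p)⁻¹ * A) h0
  simp only [Matrix.mul_add, ← Matrix.mul_assoc, h1, Matrix.one_mul, Matrix.mul_zero] at h2
  exact eq_neg_of_add_eq_zero_right h2

end MatrixCalculus

/-! ### Curvature identities in coordinates -/

section CurvatureIdentities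

variable {Ω : Set (ℝ × E3)} {G : ℝ × E3 → Matrix (Fin 4) (Fin 4) ℝ} {p : ℝ × E3}

/-- The connection matrices `(Γ_μ)^a_b = Γ^a_{μb}`. -/
def conn (G : ℝ × E3 → Matrix (Fin 4) (Fin 4) ℝ) (μ : Fin 4) (p : ℝ × E3) :
    Matrix (Fin 4) (Fin 4) ℝ := Matrix.of fun a b => christoffel G a μ b p

/-- The curvature matrices `(R_{cd})^a_b = R^a_{bcd}`. -/
def curv (G : ℝ × E3 → Matrix (Fin 4) (Fin 4) ℝ) (c d : Fin 4) (p : ℝ × E3) :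
    Matrix (Fin 4) (Fin 4) ℝ := Matrix.of fun a b => riemannUp G a b c d p

/-- The matrix form `R = dΓ + Γ ∧ Γ` turns the curvature symmetries into noncommutative polynomial
identities. -/
theorem curv_eq (c d : Fin 4) (p : ℝ × E3) :
    curv G c d p = pdM c (conn G d) p - pdM d (conn G c) p
      + conn G c p * conn G d p - conn G d p * conn G c p := by
  ext a b
  simp only [curv, Matrix.of_apply, riemannUp, Matrix.add_apply, Matrix.sub_apply,
    Matrix.mul_apply, pdM_apply, conn, Finset.sum_sub_distrib]
  ring

theorem curv_antisymm (c d : Fin 4) (p : ℝ × E3) : curv G c d p = -curv G d c p := by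
  rw [curv_eq, curv_eq]; abel

/-- A smooth symmetric nondegenerate matrix of metric coefficients on an open set. -/
structure IsMetric (Ω : Set (ℝ × E3)) (G : ℝ × E3 → Matrix (Fin 4) (Fin 4) ℝ) : Prop where
  isOpen : IsOpen Ω
  smooth : MatSmooth Ω G
  symm : ∀ q ∈ Ω, ∀ a b, G q a b = G q b a
  det_ne : ∀ q ∈ Ω, (G q).det ≠ 0

namespace IsMetric

theorem transpose (hG : IsMetric Ω G) (hp : p ∈ Ω) : (G p)ᵀ = G p := by
  ext a b; exact hG.symm p hp b a

theorem pd_symm (hG : IsMetric Ω G) (hp : p ∈ Ω) (μ a b : Fin 4) :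
    pd μ (fun q => G q a b) p = pd μ (fun q => G q b a) p :=
  pd_congr hG.isOpen (fun q hq => hG.symm q hq a b) hp

theorem conn_smooth (hG : IsMetric Ω G) (μ : Fin 4) : MatSmooth Ω (conn G μ) := by
  intro a b
  simp only [conn, Matrix.of_apply, christoffel]
  have h := fun (c i j : Fin 4) => pd_contDiffOn (μ := c) hG.isOpen (hG.smooth i j)
  refine contDiffOn_const.mul (ContDiffOn.sum fun d _ => ?_)
  exact (hG.smooth.inv hG.det_ne a d).mul (((h _ _ _).add (h _ _ _)).sub (h _ _ _))

theorem curv_smooth (hG : IsMetric Ω G) (c d : Fin 4) : MatSmooth Ω (curv G c d) := by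
  have h := hG.conn_smooth
  exact ((((h d).pdM hG.isOpen).sub ((h c).pdM hG.isOpen)).add ((h c).mul (h d))).sub
    ((h d).mul (h c)) |>.congr fun q _ => curv_eq c d q

theorem christoffel_symm (hG : IsMetric Ω G) (hp : p ∈ Ω) (c a b : Fin 4) :
    christoffel G c a b p = christoffel G c b a p := by
  simp only [christoffel]
  congr 1
  refine Finset.sum_congr rfl fun d _ => ?_
  rw [hG.pd_symm hp d a b]; ring

theorem lower_christoffel (hG : IsMetric Ω G) (hp : p ∈ Ω) (a μ b : Fin 4) :
    (G p * conn G μ p) a b = (1 / 2) * (pd μ (fun q => G q b a) p + pd b (fun q => G q μ a) p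
      - pd a (fun q => G q μ b) p) := by
  have h : G p * conn G μ p = G p * ((G p)⁻¹ * Matrix.of fun d b => (1 / 2) *
      (pd μ (fun q => G q b d) p + pd b (fun q => G q μ d) p - pd d (fun q => G q μ b) p)) := by
    congr 1
    ext c e
    simp only [conn, Matrix.of_apply, christoffel, Matrix.mul_apply, Finset.mul_sum]
    exact Finset.sum_congr rfl fun d _ => by ring
  rw [h, ← Matrix.mul_assoc, Matrix.mul_nonsing_inv _ (hG.det_ne p hp).isUnit, Matrix.one_mul,
    Matrix.of_apply]

/-- Metric compatibility of the Levi-Civita connection. -/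
theorem pdM_metric (hG : IsMetric Ω G) (hp : p ∈ Ω) (μ : Fin 4) :
    pdM μ G p = G p * conn G μ p + (conn G μ p)ᵀ * G p := by
  have h2 : (conn G μ p)ᵀ * G p = (G p * conn G μ p)ᵀ := by
    rw [Matrix.transpose_mul, hG.transpose hp]
  ext a b
  rw [h2, Matrix.add_apply, Matrix.transpose_apply, hG.lower_christoffel hp,
    hG.lower_christoffel hp, pdM_apply, hG.pd_symm hp μ b a]
  ring

/-- Differentiating metric compatibility once more, the commutator of `∂_c` and `∂_d` on `G` is
exactly this expression, and it vanishes because second derivatives commute. -/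
theorem metric_mul_curv_antisymm (hG : IsMetric Ω G) (hp : p ∈ Ω) (c d : Fin 4) :
    G p * curv G c d p + (curv G c d p)ᵀ * G p = 0 := by
  have hΩ := hG.isOpen
  have hc := hG.conn_smooth
  have key : ∀ c d : Fin 4, pdM c (pdM d G) p
      = (G p * conn G c p + (conn G c p)ᵀ * G p) * conn G d p + G p * pdM c (conn G d) p
        + ((pdM c (conn G d) p)ᵀ * G p
          + (conn G d p)ᵀ * (G p * conn G c p + (conn G c p)ᵀ * G p)) := by
    intro c d
    rw [pdM_congr hΩ (fun q hq => hG.pdM_metric hq d) hp,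
      pdM_add hΩ hp (hG.smooth.mul (hc d)) ((hc d).transpose.mul hG.smooth),
      pdM_mul hΩ hp hG.smooth (hc d), pdM_mul hΩ hp (hc d).transpose hG.smooth,
      pdM_transpose, hG.pdM_metric hp c]
  have h := pdM_comm (μ := c) (ν := d) hΩ hp hG.smooth
  rw [key, key, ← sub_eq_zero] at h
  rw [curv_eq, ← h]
  simp only [Matrix.transpose_add, Matrix.transpose_sub, Matrix.transpose_mul]
  noncomm_ring

/-- The connection is torsion-free: the symmetry of `Γ` in its lower indices cancels all terms of
the cyclic sum in pairs. -/
theorem first_bianchi_up (hG : IsMetric Ω G) (hp : p ∈ Ω) (a b c d : Fin 4) :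
    riemannUp G a b c d p + riemannUp G a c d b p + riemannUp G a d b c p = 0 := by
  have hs := fun {q : ℝ × E3} (hq : q ∈ Ω) => hG.christoffel_symm hq
  have hd : ∀ μ a b c, pd μ (christoffel G a b c) p = pd μ (christoffel G a c b) p :=
    fun μ a b c => pd_congr hG.isOpen (fun q hq => hs hq a b c) hp
  simp only [riemannUp, Finset.sum_sub_distrib]
  rw [hd c a d b, hd d a c b, hd b a d c]
  simp only [hs hp _ d b, hs hp _ c b, hs hp _ d c]
  ring

/-- Covariant differentiation here involves only the endomorphism indices, since the terms from the
two form indices cancel in the cyclic sum for a torsion-free connection. The identity is then `d² =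
0` for `Γ` together with associativity. -/
theorem second_bianchi (hG : IsMetric Ω G) (hp : p ∈ Ω) (c d e : Fin 4) :
    (pdM e (curv G c d) p + (conn G e p * curv G c d p - curv G c d p * conn G e p))
      + (pdM c (curv G d e) p + (conn G c p * curv G d e p - curv G d e p * conn G c p))
      + (pdM d (curv G e c) p + (conn G d p * curv G e c p - curv G e c p * conn G d p)) = 0 := by
  have hΩ := hG.isOpen
  have hc := hG.conn_smooth
  have key : ∀ c d e : Fin 4, pdM e (curv G c d) p
      = pdM e (pdM c (conn G d)) p - pdM e (pdM d (conn G c)) p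
        + (pdM e (conn G c) p * conn G d p + conn G c p * pdM e (conn G d) p)
        - (pdM e (conn G d) p * conn G c p + conn G d p * pdM e (conn G c) p) := by
    intro c d e
    have s1 := (hc d).pdM (μ := c) hΩ
    have s2 := (hc c).pdM (μ := d) hΩ
    have s3 := (hc c).mul (hc d)
    have s4 := (hc d).mul (hc c)
    rw [pdM_congr hΩ (fun q _ => curv_eq c d q) hp, pdM_sub hΩ hp ((s1.sub s2).add s3) s4,
      pdM_add hΩ hp (s1.sub s2) s3, pdM_sub hΩ hp s1 s2, pdM_mul hΩ hp (hc c) (hc d),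
      pdM_mul hΩ hp (hc d) (hc c)]
  rw [key, key, key, pdM_comm (μ := e) (ν := c) hΩ hp (hc d), pdM_comm (μ := e) (ν := d) hΩ hp (hc c),
    pdM_comm (μ := c) (ν := d) hΩ hp (hc e), curv_eq, curv_eq, curv_eq]
  noncomm_ring

theorem riemann_eq (a b c d : Fin 4) : riemann G p a b c d = (G p * curv G c d p) a b := by
  simp [riemann, curv, Matrix.mul_apply]

theorem riemann_antisymm_right (a b c d : Fin 4) :
    riemann G p a b c d = -riemann G p a b d c := by
  rw [riemann_eq, riemann_eq, curv_antisymm]; simp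

theorem riemann_antisymm_left (hG : IsMetric Ω G) (hp : p ∈ Ω) (a b c d : Fin 4) :
    riemann G p a b c d = -riemann G p b a c d := by
  have h := congrFun (congrFun (hG.metric_mul_curv_antisymm hp c d) a) b
  have h2 : (curv G c d p)ᵀ * G p = (G p * curv G c d p)ᵀ := by
    rw [Matrix.transpose_mul, hG.transpose hp]
  rw [h2, Matrix.add_apply, Matrix.transpose_apply, Matrix.zero_apply] at h
  rw [riemann_eq, riemann_eq]; linarith

theorem first_bianchi (hG : IsMetric Ω G) (hp : p ∈ Ω) (a b c d : Fin 4) :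
    riemann G p a b c d + riemann G p a c d b + riemann G p a d b c = 0 := by
  simp only [riemann, ← Finset.sum_add_distrib, ← mul_add, hG.first_bianchi_up hp, mul_zero,
    Finset.sum_const_zero]

/-- The octahedron argument: a combination of the four cyclic identities starting at each of the
indices, reduced by the two antisymmetries. -/
theorem riemann_pair_symm (hG : IsMetric Ω G) (hp : p ∈ Ω) (a b c d : Fin 4) :
    riemann G p a b c d = riemann G p c d a b := by
  have B := hG.first_bianchi hp
  have L := hG.riemann_antisymm_left hp
  have R := riemann_antisymm_right (G := G) (p := p)
  linarith [B a b c d, B b c d a, B c d a b, B d a b c, L a b c d, L a c d b, L a d b c,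
    R a b c d, R c d a b, L c d a b, L b c d a, R b c d a, L c a b d, R c a b d, L d b c a,
    R d b c a, R a c d b, R a d b c, L d a b c, R d a b c, L d c a b, R d c a b, L b d a c,
    R b d a c, L c b d a, R c b d a, L b a c d, R b a c d, L a b d c, L c d b a, L d b a c, L a c b d, L b d c a, L c a d b, L d a c b, L a d c b, L b c a d]

end IsMetric

end CurvatureIdentities

/-! ### Orthonormal frames and the pull-back of `(0,4)`-tensors -/

section Pull

variable {ι : Type*} [Fintype ι]

/-- The components of a `(0,4)`-tensor in the frame formed by the columns of `F`. -/
def pull (F : Matrix ι ι ℝ) (S : ι → ι → ι → ι → ℝ) (a b c d : ι) : ℝ :=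
  ∑ i, F i a * ∑ j, F j b * ∑ k, F k c * ∑ l, F l d * S i j k l

theorem sum_frame_sq (F B : Matrix ι ι ℝ) (hB : B = F * Fᵀ) (x y : ι → ℝ) :
    ∑ a, (∑ i, F i a * x i) * (∑ i, F i a * y i) = ∑ i, ∑ j, B i j * (x i * y j) := by
  subst hB
  simp only [Finset.sum_mul_sum]
  simp only [Matrix.mul_apply, Matrix.transpose_apply, Finset.sum_mul]
  rw [Finset.sum_comm]
  refine Finset.sum_congr rfl fun i _ => ?_
  rw [Finset.sum_comm]
  exact Finset.sum_congr rfl fun j _ => Finset.sum_congr rfl fun a _ => by ring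

theorem sum_comm_pairs (f : ι → ι → ι → ι → ℝ) :
    ∑ a, ∑ b, ∑ c, ∑ d, f a b c d = ∑ c, ∑ d, ∑ a, ∑ b, f a b c d := by
  have e := Finset.sum_comm (s := Finset.univ) (t := Finset.univ)
    (f := fun (x : ι × ι) (y : ι × ι) => f x.1 x.2 y.1 y.2)
  simpa only [Fintype.sum_prod_type] using e

theorem sum_frame_sq_two (F B : Matrix ι ι ℝ) (hB : B = F * Fᵀ) (x y : ι → ι → ℝ) :
    ∑ a, ∑ b, (∑ i, F i a * ∑ j, F j b * x i j) * (∑ i, F i a * ∑ j, F j b * y i j)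
      = ∑ i, ∑ j, ∑ i', ∑ j', B i i' * B j j' * (x i j * y i' j') := by
  rw [Finset.sum_comm]
  simp only [sum_frame_sq F B hB]
  rw [Finset.sum_comm]
  refine Finset.sum_congr rfl fun i _ => ?_
  rw [Finset.sum_comm, Finset.sum_comm (s := Finset.univ) (t := Finset.univ)
    (f := fun j i' => ∑ j', B i i' * B j j' * (x i j * y i' j'))]
  refine Finset.sum_congr rfl fun i' _ => ?_
  rw [← Finset.mul_sum, sum_frame_sq F B hB, Finset.mul_sum]
  refine Finset.sum_congr rfl fun j _ => ?_
  rw [Finset.mul_sum]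
  exact Finset.sum_congr rfl fun j' _ => by ring

/-- Replacing `B⁻¹` by `F Fᵀ` in each of the four contractions completes a square; this is done for
two indices at a time. -/
theorem tensorNorm_eq_sqrt_sum_pull (F B : Matrix (Fin 4) (Fin 4) ℝ) (hB : B⁻¹ = F * Fᵀ)
    (S : Fin 4 → Fin 4 → Fin 4 → Fin 4 → ℝ) :
    tensorNorm B S = Real.sqrt (∑ a, ∑ b, ∑ c, ∑ d, pull F S a b c d ^ 2) := by
  unfold tensorNorm
  congr 1
  have h2 : ∀ c d, ∑ a, ∑ b, pull F S a b c d * pull F S a b c d = _ := fun c d =>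
    sum_frame_sq_two F B⁻¹ hB (fun i j => ∑ k, F k c * ∑ l, F l d * S i j k l)
      (fun i j => ∑ k, F k c * ∑ l, F l d * S i j k l)
  simp only [sq]
  rw [sum_comm_pairs (fun a b c d => pull F S a b c d * pull F S a b c d)]
  simp only [h2]
  rw [sum_comm_pairs fun c d i j => ∑ i', ∑ j', B⁻¹ i i' * B⁻¹ j j' *
    ((∑ k, F k c * ∑ l, F l d * S i j k l) * ∑ k, F k c * ∑ l, F l d * S i' j' k l)]
  refine Finset.sum_congr rfl fun i _ => Finset.sum_congr rfl fun j _ => ?_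
  rw [sum_comm_pairs fun c d i' j' => B⁻¹ i i' * B⁻¹ j j' *
    ((∑ k, F k c * ∑ l, F l d * S i j k l) * ∑ k, F k c * ∑ l, F l d * S i' j' k l),
    sum_comm_pairs fun c d i' j' => ∑ k', ∑ l', B⁻¹ i i' * B⁻¹ j j' * B⁻¹ c k' * B⁻¹ d l' *
      S i j c d * S i' j' k' l']
  refine Finset.sum_congr rfl fun i' _ => Finset.sum_congr rfl fun j' _ => ?_
  simp only [← Finset.mul_sum]
  rw [sum_frame_sq_two F B⁻¹ hB]
  simp only [Finset.mul_sum]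
  refine Finset.sum_congr rfl fun k _ => Finset.sum_congr rfl fun l _ => ?_
  exact Finset.sum_congr rfl fun k' _ => Finset.sum_congr rfl fun l' _ => by ring

theorem eq_zero_of_frame [DecidableEq ι] (F M : Matrix ι ι ℝ) (h : F * M = 1) (x : ι → ℝ)
    (hx : ∀ a, ∑ i, F i a * x i = 0) : x = 0 := by
  have h1 : x ᵥ* F = 0 := by
    ext a
    simpa [Matrix.vecMul, dotProduct, mul_comm] using hx a
  have h2 : (x ᵥ* F) ᵥ* M = x := by rw [Matrix.vecMul_vecMul, h, Matrix.vecMul_one]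
  rw [← h2, h1, Matrix.zero_vecMul]

/-- Removing the frame from one slot at a time. It allows tensor identities to be checked in an
orthonormal frame. -/
theorem eq_zero_of_pull [DecidableEq ι] (F M : Matrix ι ι ℝ) (h : F * M = 1)
    (S : ι → ι → ι → ι → ℝ) (hS : ∀ a b c d, pull F S a b c d = 0) (i j k l : ι) :
    S i j k l = 0 := by
  have e := eq_zero_of_frame F M h
  have h1 := fun b c d => congrFun (e _ fun a => hS a b c d)
  have h2 := fun i c d => congrFun (e _ fun b => h1 b c d i)
  have h3 := fun i j d => congrFun (e _ fun c => h2 i c d j)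
  exact congrFun (e _ fun d => h3 i j d k) l

end Pull

/-! ### Algebra of curvature-type tensors in dimension three -/

section Decomposition

/-- The antisymmetries and the pair symmetry of curvature tensors. -/
structure IsCurvatureLike {ι : Type*} (S : ι → ι → ι → ι → ℝ) : Prop where
  left : ∀ a b c d, S a b c d = -S b a c d
  right : ∀ a b c d, S a b c d = -S a b d c
  pair : ∀ a b c d, S a b c d = S c d a b

theorem IsCurvatureLike.pull_frame {ι : Type*} [Fintype ι] {S : ι → ι → ι → ι → ℝ}
    (hS : IsCurvatureLike S) (F : Matrix ι ι ℝ) : IsCurvatureLike (pull F S) := by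
  have e : ∀ a b c d, pull F S a b c d
      = ∑ i, ∑ j, ∑ k, ∑ l, F i a * (F j b * (F k c * (F l d * S i j k l))) := fun a b c d => by
    simp only [pull, Finset.mul_sum]
  constructor
  · intro a b c d
    rw [e, e, Finset.sum_comm]
    simp only [← Finset.sum_neg_distrib]
    refine Finset.sum_congr rfl fun i _ => Finset.sum_congr rfl fun j _ =>
      Finset.sum_congr rfl fun k _ => Finset.sum_congr rfl fun l _ => ?_
    rw [hS.left]; ring
  · intro a b c d
    rw [e, e]
    simp only [← Finset.sum_neg_distrib]
    refine Finset.sum_congr rfl fun i _ => Finset.sum_congr rfl fun j _ => ?_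
    rw [Finset.sum_comm]
    refine Finset.sum_congr rfl fun k _ => Finset.sum_congr rfl fun l _ => ?_
    rw [hS.right]; ring
  · intro a b c d
    rw [e, e, sum_comm_pairs]
    refine Finset.sum_congr rfl fun i _ => Finset.sum_congr rfl fun j _ =>
      Finset.sum_congr rfl fun k _ => Finset.sum_congr rfl fun l _ => ?_
    rw [hS.pair]; ring

/-- In dimension three a curvature tensor is determined by its Ricci tensor. -/
theorem IsCurvatureLike.eq_of_orthonormal {S : Fin 3 → Fin 3 → Fin 3 → Fin 3 → ℝ}
    (hS : IsCurvatureLike S) (i j k l : Fin 3) :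
    S i j k l = (∑ a, S a i a k) * (1 : Matrix (Fin 3) (Fin 3) ℝ) j l
      + (∑ a, S a j a l) * (1 : Matrix (Fin 3) (Fin 3) ℝ) i k
      - (∑ a, S a i a l) * (1 : Matrix (Fin 3) (Fin 3) ℝ) j k
      - (∑ a, S a j a k) * (1 : Matrix (Fin 3) (Fin 3) ℝ) i l
      - (∑ b, ∑ a, S a b a b) / 2 * ((1 : Matrix (Fin 3) (Fin 3) ℝ) i k
        * (1 : Matrix (Fin 3) (Fin 3) ℝ) j l - (1 : Matrix (Fin 3) (Fin 3) ℝ) i l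
        * (1 : Matrix (Fin 3) (Fin 3) ℝ) j k) := by
  have d1 : ∀ i k l, S i i k l = 0 := fun i k l => by linarith [hS.left i i k l]
  have d2 : ∀ i k l, S k l i i = 0 := fun i k l => by linarith [hS.right k l i i]
  have l1 := hS.left 1 0
  have l2 := hS.left 2 0
  have l3 := hS.left 2 1
  have r1 := fun a b => hS.right a b 1 0
  have r2 := fun a b => hS.right a b 2 0
  have r3 := fun a b => hS.right a b 2 1
  have p1 := hS.pair 0 2 0 1
  have p2 := hS.pair 1 2 0 1
  have p3 := hS.pair 1 2 0 2
  fin_cases i <;> fin_cases j <;> fin_cases k <;> fin_cases l <;>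
    simp [Fin.sum_univ_three, d1, d2, l1, l2, l3, r1, r2, r3, p1, p2, p3] <;> ring

/-- In dimension three 2-planes are dual to vectors, so `S` is a symmetric 3 × 3 matrix `A` with
`|S|² = 4|A|²`. Its Ricci matrix is `(tr A) 1 - A`, of squared norm `|A|² + (tr A)²` and trace `2 tr
A`. -/
theorem IsCurvatureLike.sum_sq_of_orthonormal {S : Fin 3 → Fin 3 → Fin 3 → Fin 3 → ℝ}
    (hS : IsCurvatureLike S) :
    ∑ i, ∑ j, ∑ k, ∑ l, S i j k l ^ 2
      = 4 * ∑ j, ∑ l, (∑ a, S a j a l) ^ 2 - (∑ b, ∑ a, S a b a b) ^ 2 := by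
  have d1 : ∀ i k l, S i i k l = 0 := fun i k l => by linarith [hS.left i i k l]
  have d2 : ∀ i k l, S k l i i = 0 := fun i k l => by linarith [hS.right k l i i]
  have l1 := hS.left 1 0
  have l2 := hS.left 2 0
  have l3 := hS.left 2 1
  have r1 := fun a b => hS.right a b 1 0
  have r2 := fun a b => hS.right a b 2 0
  have r3 := fun a b => hS.right a b 2 1
  have p1 := hS.pair 0 2 0 1
  have p2 := hS.pair 1 2 0 1
  have p3 := hS.pair 1 2 0 2
  simp only [Fin.sum_univ_three, d1, d2, l1, l2, l3, r1, r2, r3, p1, p2, p3]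
  ring

/-- The contraction `c^{ik} S_{ijkl}`. -/
def contract {ι : Type*} [Fintype ι] (c : Matrix ι ι ℝ) (S : ι → ι → ι → ι → ℝ) :
    Matrix ι ι ℝ := Matrix.of fun j l => ∑ i, ∑ k, c i k * S i j k l

section

variable {ι : Type*} [Fintype ι] (F : Matrix ι ι ℝ)

theorem transpose_mul_mul_apply (A : Matrix ι ι ℝ) (a c : ι) :
    (Fᵀ * A * F) a c = ∑ i, ∑ k, F i a * A i k * F k c := by
  simp only [Matrix.mul_apply, Matrix.transpose_apply, Finset.sum_mul]
  exact Finset.sum_comm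

theorem pull_mul (A B : Matrix ι ι ℝ) (a b c d : ι) :
    pull F (fun i j k l => A i k * B j l) a b c d = (Fᵀ * A * F) a c * (Fᵀ * B * F) b d := by
  simp only [pull, transpose_mul_mul_apply, Finset.sum_mul]
  simp only [Finset.mul_sum]
  refine Finset.sum_congr rfl fun i _ => ?_
  rw [Finset.sum_comm]
  exact Finset.sum_congr rfl fun j _ => Finset.sum_congr rfl fun k _ =>
    Finset.sum_congr rfl fun l _ => by ring

theorem pull_swap_right (S : ι → ι → ι → ι → ℝ) (a b c d : ι) :
    pull F (fun i j k l => S i j l k) a b c d = pull F S a b d c := by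
  simp only [pull, Finset.mul_sum]
  refine Finset.sum_congr rfl fun i _ => Finset.sum_congr rfl fun j _ => ?_
  rw [Finset.sum_comm]
  exact Finset.sum_congr rfl fun k _ => Finset.sum_congr rfl fun l _ => by ring

theorem sum_pull (S : ι → ι → ι → ι → ℝ) (b d : ι) :
    ∑ a, pull F S a b a d = (Fᵀ * contract (F * Fᵀ) S * F) b d := by
  rw [transpose_mul_mul_apply]
  simp only [pull, contract, Matrix.of_apply, Matrix.mul_apply, Matrix.transpose_apply,
    Finset.mul_sum, Finset.sum_mul]
  rw [sum_comm_pairs]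
  refine Finset.sum_congr rfl fun j _ => ?_
  rw [sum_comm_pairs, Finset.sum_comm]
  exact Finset.sum_congr rfl fun l _ => Finset.sum_congr rfl fun i _ =>
    Finset.sum_congr rfl fun k _ => Finset.sum_congr rfl fun a _ => by ring

end

/-- In dimension three a curvature tensor is determined by its Ricci tensor. -/
theorem IsCurvatureLike.eq_ricci {S : Fin 3 → Fin 3 → Fin 3 → Fin 3 → ℝ}
    (hS : IsCurvatureLike S) {g F M P : Matrix (Fin 3) (Fin 3) ℝ} (hF : Fᵀ * g * F = 1)
    (hM : F * M = 1) (hP : P = contract (F * Fᵀ) S) (i j k l : Fin 3) :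
    S i j k l = P i k * g j l + g i k * P j l - P i l * g j k - g i l * P j k
      - (F * Fᵀ * P).trace / 2 * (g i k * g j l - g i l * g j k) := by
  have htr : (F * Fᵀ * P).trace = (Fᵀ * P * F).trace := by
    rw [Matrix.mul_assoc, Matrix.trace_mul_comm]
  -- The identity is tensorial, so it suffices to verify it in the orthonormal frame `F`, where `g`
  -- becomes the identity.
  rw [← sub_eq_zero]
  refine eq_zero_of_pull F M hM (fun i j k l => S i j k l - (P i k * g j l + g i k * P j l
      - P i l * g j k - g i l * P j k
      - (F * Fᵀ * P).trace / 2 * (g i k * g j l - g i l * g j k))) (fun a b c d => ?_) i j k l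
  set r := (F * Fᵀ * P).trace
  have h1 : pull F (fun i j k l => S i j k l - (P i k * g j l + g i k * P j l
      - P i l * g j k - g i l * P j k - r / 2 * (g i k * g j l - g i l * g j k))) a b c d
      = pull F S a b c d - (pull F (fun i j k l => P i k * g j l) a b c d
        + pull F (fun i j k l => g i k * P j l) a b c d
        - pull F (fun i j k l => P i l * g j k) a b c d
        - pull F (fun i j k l => g i l * P j k) a b c d
        - r / 2 * (pull F (fun i j k l => g i k * g j l) a b c d
          - pull F (fun i j k l => g i l * g j k) a b c d)) := by
    simp only [pull, mul_sub, mul_add, Finset.sum_sub_distrib, Finset.sum_add_distrib,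
      Finset.mul_sum]
    simp only [mul_left_comm (r / 2)]
  rw [h1, pull_mul, pull_mul, pull_mul, pull_swap_right F (fun i j k l => P i k * g j l),
    pull_swap_right F (fun i j k l => g i k * P j l),
    pull_swap_right F (fun i j k l => g i k * g j l), pull_mul, pull_mul, pull_mul, hF,
    (hS.pull_frame F).eq_of_orthonormal a b c d]
  have htr2 : ∑ b, ∑ a, pull F S a b a b = r := by
    simp only [sum_pull, ← hP]
    rw [htr]; rfl
  simp only [htr2]
  simp only [sum_pull, ← hP]
  ring

end Decomposition

/-! ### Block matrices for the splitting into time and space -/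

section Block

@[simp] theorem block_zero_zero (a : ℝ) (b : Matrix (Fin 3) (Fin 3) ℝ) : block a b 0 0 = a := rfl

@[simp] theorem block_zero_succ (a : ℝ) (b : Matrix (Fin 3) (Fin 3) ℝ) (j : Fin 3) :
    block a b 0 j.succ = 0 := rfl

@[simp] theorem block_succ_zero (a : ℝ) (b : Matrix (Fin 3) (Fin 3) ℝ) (i : Fin 3) :
    block a b i.succ 0 = 0 := rfl

@[simp] theorem block_succ_succ (a : ℝ) (b : Matrix (Fin 3) (Fin 3) ℝ) (i j : Fin 3) :
    block a b i.succ j.succ = b i j := rfl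

theorem block_mul (a a' : ℝ) (b b' : Matrix (Fin 3) (Fin 3) ℝ) :
    block a b * block a' b' = block (a * a') (b * b') := by
  ext i j
  rw [Matrix.mul_apply, Fin.sum_univ_succ]
  cases i using Fin.cases <;> cases j using Fin.cases <;> simp [Matrix.mul_apply]

theorem block_transpose (a : ℝ) (b : Matrix (Fin 3) (Fin 3) ℝ) :
    (block a b)ᵀ = block a bᵀ := by
  ext i j
  cases i using Fin.cases <;> cases j using Fin.cases <;> simp

theorem block_one : block 1 1 = 1 := by
  ext i j
  cases i using Fin.cases <;> cases j using Fin.cases <;>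
    simp [Matrix.one_apply, Fin.succ_ne_zero, (Fin.succ_ne_zero _).symm]

theorem block_inv {a : ℝ} {b : Matrix (Fin 3) (Fin 3) ℝ} (ha : a ≠ 0) (hb : b.det ≠ 0) :
    (block a b)⁻¹ = block a⁻¹ b⁻¹ := by
  refine Matrix.inv_eq_right_inv ?_
  rw [block_mul, mul_inv_cancel₀ ha, Matrix.mul_nonsing_inv _ hb.isUnit, block_one]

theorem block_det_ne {a : ℝ} {b : Matrix (Fin 3) (Fin 3) ℝ} (ha : a ≠ 0) (hb : b.det ≠ 0) :
    (block a b).det ≠ 0 := by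
  have h : block a b * block a⁻¹ b⁻¹ = 1 := by
    rw [block_mul, mul_inv_cancel₀ ha, Matrix.mul_nonsing_inv _ hb.isUnit, block_one]
  exact (Matrix.isUnit_det_of_right_inverse h).ne_zero

end Block

/-! ### Norms of curvature tensors without magnetic part -/

section Norm

theorem pull_block_spatial (a : ℝ) (L : Matrix (Fin 3) (Fin 3) ℝ)
    (S : Fin 4 → Fin 4 → Fin 4 → Fin 4 → ℝ) (i j k l : Fin 3) :
    pull (block a L) S i.succ j.succ k.succ l.succ
      = pull L (fun i j k l => S i.succ j.succ k.succ l.succ) i j k l := by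
  simp [pull, Fin.sum_univ_succ (n := 3)]

theorem pull_block_time (a : ℝ) (L : Matrix (Fin 3) (Fin 3) ℝ)
    (S : Fin 4 → Fin 4 → Fin 4 → Fin 4 → ℝ) (j l : Fin 3) :
    pull (block a L) S 0 j.succ 0 l.succ
      = a ^ 2 * (Lᵀ * Matrix.of (fun j l : Fin 3 => S 0 j.succ 0 l.succ) * L) j l := by
  simp only [pull, Fin.sum_univ_succ (n := 3), block_zero_zero, block_succ_zero,
    block_zero_succ, block_succ_succ, zero_mul, Finset.sum_const_zero, add_zero, zero_add,
    Matrix.mul_apply, Matrix.transpose_apply, Matrix.of_apply, Finset.sum_mul, Finset.mul_sum]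
  rw [Finset.sum_comm]
  exact Finset.sum_congr rfl fun i _ => Finset.sum_congr rfl fun k _ => by ring

theorem pull_block_mixed (a : ℝ) (L : Matrix (Fin 3) (Fin 3) ℝ)
    {S : Fin 4 → Fin 4 → Fin 4 → Fin 4 → ℝ}
    (h0 : ∀ i j l : Fin 3, S 0 i.succ j.succ l.succ = 0) (j k l : Fin 3) :
    pull (block a L) S 0 j.succ k.succ l.succ = 0 := by
  simp [pull, Fin.sum_univ_succ (n := 3), h0]

/-- The squared Euclidean norm of a curvature tensor without magnetic part. -/
theorem IsCurvatureLike.sum_sq_electric {S : Fin 4 → Fin 4 → Fin 4 → Fin 4 → ℝ}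
    (hS : IsCurvatureLike S) (h0 : ∀ i j l : Fin 3, S 0 i.succ j.succ l.succ = 0) :
    ∑ a, ∑ b, ∑ c, ∑ d, S a b c d ^ 2 = 4 * ∑ i : Fin 3, ∑ j : Fin 3, S 0 i.succ 0 j.succ ^ 2
      + ∑ i : Fin 3, ∑ j : Fin 3, ∑ k : Fin 3, ∑ l : Fin 3,
        S i.succ j.succ k.succ l.succ ^ 2 := by
  have d1 : ∀ i k l, S i i k l = 0 := fun i k l => by linarith [hS.left i i k l]
  have d2 : ∀ i k l, S k l i i = 0 := fun i k l => by linarith [hS.right k l i i]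
  have h1 : ∀ i j l : Fin 3, S i.succ 0 j.succ l.succ = 0 := fun i j l => by
    rw [hS.left, h0, neg_zero]
  have h2 : ∀ i j l : Fin 3, S j.succ l.succ 0 i.succ = 0 := fun i j l => by rw [hS.pair, h0]
  have h3 : ∀ i j l : Fin 3, S j.succ l.succ i.succ 0 = 0 := fun i j l => by rw [hS.pair, h1]
  have e1 : ∀ i j : Fin 3, S i.succ 0 0 j.succ ^ 2 = S 0 i.succ 0 j.succ ^ 2 := fun i j => by
    rw [hS.left]; ring
  have e2 : ∀ i j : Fin 3, S 0 i.succ j.succ 0 ^ 2 = S 0 i.succ 0 j.succ ^ 2 := fun i j => by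
    rw [hS.right]; ring
  have e3 : ∀ i j : Fin 3, S i.succ 0 j.succ 0 ^ 2 = S 0 i.succ 0 j.succ ^ 2 := fun i j => by
    rw [hS.right, hS.left]; ring
  simp only [Fin.sum_univ_succ (n := 3), d1, d2, h0, h1, h2, h3, e1, e2, e3, ne_eq,
    OfNat.ofNat_ne_zero, not_false_eq_true, zero_pow, Finset.sum_const_zero, add_zero, zero_add,
    Finset.sum_add_distrib]
  ring

theorem sum_sq_eq_trace {ι : Type*} [Fintype ι] {A : Matrix ι ι ℝ} (hA : Aᵀ = A) :
    ∑ i, ∑ j, A i j ^ 2 = (A * A).trace := by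
  simp only [Matrix.trace, Matrix.diag_apply, Matrix.mul_apply]
  refine Finset.sum_congr rfl fun i _ => Finset.sum_congr rfl fun j _ => ?_
  rw [sq]; congr 1
  exact congrFun (congrFun hA j) i

-- Writing `g = Bᵀ B` with `B` invertible, the columns of `L = B⁻¹` are g-orthonormal and `M = B` is
-- the dual coframe.
open scoped MatrixOrder in
theorem exists_frame {g : Matrix (Fin 3) (Fin 3) ℝ} (hg : g.PosDef) :
    ∃ L M : Matrix (Fin 3) (Fin 3) ℝ, Lᵀ * g * L = 1 ∧ L * M = 1 ∧ M * L = 1 ∧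
      g⁻¹ = L * Lᵀ := by
  obtain ⟨B, hB⟩ := CStarAlgebra.nonneg_iff_eq_star_mul_self.1 hg.posSemidef.nonneg
  have hB' : g = Bᵀ * B := by rw [hB, Matrix.star_eq_conjTranspose]; simp
  have hdet : IsUnit B.det := by
    have h := hg.det_pos.ne'
    rw [hB', Matrix.det_mul] at h
    exact (right_ne_zero_of_mul h).isUnit
  have h1 := Matrix.mul_nonsing_inv B hdet
  refine ⟨B⁻¹, B, ?_, Matrix.nonsing_inv_mul B hdet, h1, ?_⟩
  · have h2 : B⁻¹ᵀ * Bᵀ = 1 := by rw [← Matrix.transpose_mul, h1, Matrix.transpose_one]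
    rw [hB', ← Matrix.mul_assoc, h2, Matrix.one_mul, h1]
  · rw [hB', Matrix.mul_inv_rev, Matrix.transpose_nonsing_inv]

theorem IsCurvatureLike.spatial {S : Fin 4 → Fin 4 → Fin 4 → Fin 4 → ℝ}
    (hS : IsCurvatureLike S) :
    IsCurvatureLike fun i j k l : Fin 3 => S i.succ j.succ k.succ l.succ :=
  ⟨fun _ _ _ _ => hS.left _ _ _ _, fun _ _ _ _ => hS.right _ _ _ _,
    fun _ _ _ _ => hS.pair _ _ _ _⟩

/-- The components `S_{TiTj}` of a `(0,4)`-tensor in a frame with lapse `n`. -/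
def electricPart (n : ℝ) (S : Fin 4 → Fin 4 → Fin 4 → Fin 4 → ℝ) : Matrix (Fin 3) (Fin 3) ℝ :=
  Matrix.of fun j l => (n ^ 2)⁻¹ * S 0 j.succ 0 l.succ

/-- The contraction `g^{ik} S_{ijkl}` of the spatial part of a `(0,4)`-tensor. -/
def spatialRicci (g : Matrix (Fin 3) (Fin 3) ℝ) (S : Fin 4 → Fin 4 → Fin 4 → Fin 4 → ℝ) :
    Matrix (Fin 3) (Fin 3) ℝ :=
  contract g⁻¹ fun i j k l => S i.succ j.succ k.succ l.succ

theorem IsCurvatureLike.electricPart_transpose {S : Fin 4 → Fin 4 → Fin 4 → Fin 4 → ℝ}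
    (hS : IsCurvatureLike S) (n : ℝ) : (electricPart n S)ᵀ = electricPart n S := by
  ext j l
  simp only [electricPart, Matrix.transpose_apply, Matrix.of_apply]
  rw [hS.pair]

theorem IsCurvatureLike.spatialRicci_transpose {S : Fin 4 → Fin 4 → Fin 4 → Fin 4 → ℝ}
    (hS : IsCurvatureLike S) {g : Matrix (Fin 3) (Fin 3) ℝ} (hg : gᵀ = g) :
    (spatialRicci g S)ᵀ = spatialRicci g S := by
  ext j l
  simp only [spatialRicci, contract, Matrix.transpose_apply, Matrix.of_apply]
  rw [Finset.sum_comm]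
  refine Finset.sum_congr rfl fun i _ => Finset.sum_congr rfl fun k _ => ?_
  rw [hS.pair]
  congr 1
  rw [← Matrix.transpose_apply g⁻¹, Matrix.transpose_nonsing_inv, hg]

theorem IsCurvatureLike.spatial_eq {S : Fin 4 → Fin 4 → Fin 4 → Fin 4 → ℝ}
    (hS : IsCurvatureLike S) {g : Matrix (Fin 3) (Fin 3) ℝ} (hg : g.PosDef) (i j k l : Fin 3) :
    S i.succ j.succ k.succ l.succ
      = spatialRicci g S i k * g j l + g i k * spatialRicci g S j l
        - spatialRicci g S i l * g j k - g i l * spatialRicci g S j k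
        - (g⁻¹ * spatialRicci g S).trace / 2 * (g i k * g j l - g i l * g j k) := by
  obtain ⟨L, M, h1, h2, -, h4⟩ := exists_frame hg
  rw [h4]
  exact hS.spatial.eq_ricci h1 h2 (by rw [spatialRicci, h4]) i j k l

/-- The norm of a curvature tensor without magnetic part. -/
theorem IsCurvatureLike.tensorNorm_eq {S : Fin 4 → Fin 4 → Fin 4 → Fin 4 → ℝ}
    (hS : IsCurvatureLike S) (h0 : ∀ i j l : Fin 3, S 0 i.succ j.succ l.succ = 0)
    {n : ℝ} (hn : n ≠ 0) {g : Matrix (Fin 3) (Fin 3) ℝ} (hg : g.PosDef) :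
    tensorNorm (block (n ^ 2) g) S = Real.sqrt
      (4 * ((g⁻¹ * electricPart n S) * (g⁻¹ * electricPart n S)).trace
        + (4 * ((g⁻¹ * spatialRicci g S) * (g⁻¹ * spatialRicci g S)).trace
          - (g⁻¹ * spatialRicci g S).trace ^ 2)) := by
  obtain ⟨L, M, h1, h2, -, h4⟩ := exists_frame hg
  have hgt : gᵀ = g := hg.isHermitian
  have hB : (block (n ^ 2) g)⁻¹ = block n⁻¹ L * (block n⁻¹ L)ᵀ := by
    rw [block_inv (pow_ne_zero 2 hn) hg.det_pos.ne', block_transpose, block_mul, h4]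
    congr 1
    rw [sq, mul_inv]
  have htr : ∀ A : Matrix (Fin 3) (Fin 3) ℝ, Aᵀ = A →
      ((g⁻¹ * A) * (g⁻¹ * A)).trace = ∑ i, ∑ j, (Lᵀ * A * L) i j ^ 2 := by
    intro A hA
    rw [sum_sq_eq_trace (by simp [Matrix.transpose_mul, hA, Matrix.mul_assoc]), h4]
    simp only [Matrix.mul_assoc]
    rw [Matrix.trace_mul_comm L]
    simp only [Matrix.mul_assoc]
  rw [tensorNorm_eq_sqrt_sum_pull _ _ hB, (hS.pull_frame _).sum_sq_electric
    fun i j l => pull_block_mixed _ _ h0 i j l]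
  simp only [pull_block_spatial]
  rw [(hS.spatial.pull_frame L).sum_sq_of_orthonormal, htr _ (hS.electricPart_transpose n),
    htr _ (hS.spatialRicci_transpose hgt)]
  have h5 : (g⁻¹ * spatialRicci g S).trace = (Lᵀ * spatialRicci g S * L).trace := by
    rw [h4, Matrix.mul_assoc, Matrix.trace_mul_comm]
  have h6 : electricPart n S = (n⁻¹) ^ 2 • Matrix.of fun j l : Fin 3 => S 0 j.succ 0 l.succ := by
    ext j l; simp [electricPart]
  have h7 : spatialRicci g S = contract (L * Lᵀ) fun i j k l => S i.succ j.succ k.succ l.succ := by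
    rw [spatialRicci, h4]
  rw [h5, h6, h7]
  simp only [sum_pull, pull_block_time, Matrix.mul_smul, Matrix.smul_mul, Matrix.smul_apply,
    smul_eq_mul, Matrix.trace, Matrix.diag_apply]

/-- Without magnetic part the tensor consists of its electric part and its purely spatial part, and
the latter is determined by its contraction in dimension three. -/
theorem IsCurvatureLike.eq_zero_iff {S : Fin 4 → Fin 4 → Fin 4 → Fin 4 → ℝ}
    (hS : IsCurvatureLike S) (h0 : ∀ i j l : Fin 3, S 0 i.succ j.succ l.succ = 0)
    {n : ℝ} (hn : n ≠ 0) {g : Matrix (Fin 3) (Fin 3) ℝ} (hg : g.PosDef) :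
    S = 0 ↔ electricPart n S = 0 ∧ spatialRicci g S = 0 := by
  constructor
  · rintro rfl
    constructor <;> ext <;> simp [electricPart, spatialRicci, contract]
  · rintro ⟨hA, hP⟩
    have e1 : ∀ i j : Fin 3, S 0 i.succ 0 j.succ = 0 := fun i j => by
      have := congrFun (congrFun hA i) j
      simpa [electricPart, hn] using this
    have d1 : ∀ i k l, S i i k l = 0 := fun i k l => by linarith [hS.left i i k l]
    have d2 : ∀ i k l, S k l i i = 0 := fun i k l => by linarith [hS.right k l i i]
    have e2 : ∀ i j k l : Fin 3, S i.succ j.succ k.succ l.succ = 0 := fun i j k l => by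
      rw [hS.spatial_eq hg, hP]; simp
    have h1 : ∀ i j l : Fin 3, S i.succ 0 j.succ l.succ = 0 := fun i j l => by
      rw [hS.left, h0, neg_zero]
    ext a b c d
    cases a using Fin.cases <;> cases b using Fin.cases <;> cases c using Fin.cases <;>
      cases d using Fin.cases <;> simp only [d1, d2, e1, e2, h0, h1, Pi.zero_apply]
    · rw [hS.right, e1, neg_zero]
    · rw [hS.left, e1, neg_zero]
    · rw [hS.left, hS.right, e1, neg_zero, neg_zero]
    · rw [hS.pair, h0]
    · rw [hS.pair, h1]

end Norm

/-! ### Perfect fluid electric regions in coordinates -/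

theorem riemannUp_eq {G : ℝ × E3 → Matrix (Fin 4) (Fin 4) ℝ} {p : ℝ × E3} (h : (G p).det ≠ 0)
    (a b c d : Fin 4) : riemannUp G a b c d p = ∑ e, (G p)⁻¹ a e * riemann G p e b c d := by
  have h1 : curv G c d p = (G p)⁻¹ * (G p * curv G c d p) := by
    rw [← Matrix.mul_assoc, Matrix.nonsing_inv_mul _ h.isUnit, Matrix.one_mul]
  have h2 := congrFun (congrFun h1 a) b
  rw [Matrix.mul_apply] at h2
  simp only [IsMetric.riemann_eq]
  exact h2

/-- A `k`-perfect fluid electric region of density `m`, in coordinates on the open set `Ω`. -/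
structure FluidChart (Ω : Set (ℝ × E3)) (N : ℝ × E3 → ℝ)
    (g : ℝ × E3 → Matrix (Fin 3) (Fin 3) ℝ) (m k : ℝ × E3 → ℝ) : Prop where
  isOpen : IsOpen Ω
  lapse_smooth : ContDiffOn ℝ ∞ N Ω
  metric_smooth : MatSmooth Ω g
  lapse_pos : ∀ q ∈ Ω, 0 < N q
  metric_pos : ∀ q ∈ Ω, (g q).PosDef
  einstein_eq : ∀ q ∈ Ω, ∀ a b,
    einstein (lorentz N g) q a b = fluidStress N g (m q) ((k q - 1) * m q) q a b
  electric : ∀ q ∈ Ω, ∀ i j l : Fin 3, weyl (lorentz N g) q 0 i.succ j.succ l.succ = 0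

section

variable {Ω : Set (ℝ × E3)} {N : ℝ × E3 → ℝ} {g : ℝ × E3 → Matrix (Fin 3) (Fin 3) ℝ}
  {m k : ℝ × E3 → ℝ} {p : ℝ × E3}

theorem isCurvatureLike_riemann {G : ℝ × E3 → Matrix (Fin 4) (Fin 4) ℝ} (hG : IsMetric Ω G)
    (hp : p ∈ Ω) : IsCurvatureLike (riemann G p) :=
  ⟨hG.riemann_antisymm_left hp, IsMetric.riemann_antisymm_right, hG.riemann_pair_symm hp⟩

theorem isCurvatureLike_weyl {G : ℝ × E3 → Matrix (Fin 4) (Fin 4) ℝ} (hG : IsMetric Ω G)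
    (hp : p ∈ Ω) (hr : ∀ a b, ricci G p a b = ricci G p b a) : IsCurvatureLike (weyl G p) := by
  have hR := isCurvatureLike_riemann hG hp
  have hs := hG.symm p hp
  constructor
  · intro a b c d
    simp only [weyl]; rw [hR.left]; ring
  · intro a b c d
    simp only [weyl]; rw [hR.right]; ring
  · intro a b c d
    simp only [weyl]
    rw [hR.pair, hr a c, hr a d, hr b d, hr b c, hs a c, hs a d, hs b c, hs b d]; ring

namespace FluidChart

variable (h : FluidChart Ω N g m k) (hp : p ∈ Ω)
include h

theorem metric_symm {q : ℝ × E3} (hq : q ∈ Ω) : (g q)ᵀ = g q := (h.metric_pos q hq).isHermitian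

theorem metric_det_ne {q : ℝ × E3} (hq : q ∈ Ω) : (g q).det ≠ 0 := (h.metric_pos q hq).det_pos.ne'

theorem lapse_sq_ne {q : ℝ × E3} (hq : q ∈ Ω) : -(N q) ^ 2 ≠ 0 :=
  neg_ne_zero.2 (pow_ne_zero 2 (h.lapse_pos q hq).ne')

theorem isMetric : IsMetric Ω (lorentz N g) where
  isOpen := h.isOpen
  smooth := by
    intro a b
    cases a using Fin.cases <;> cases b using Fin.cases <;> simp only [lorentz, block_zero_zero,
      block_zero_succ, block_succ_zero, block_succ_succ]
    · exact (h.lapse_smooth.pow 2).neg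
    · exact contDiffOn_const
    · exact contDiffOn_const
    · exact h.metric_smooth _ _
  symm := by
    intro q hq a b
    have h1 : (lorentz N g q)ᵀ = lorentz N g q := by
      rw [lorentz, block_transpose, h.metric_symm hq]
    exact congrFun (congrFun h1 b) a
  det_ne q hq := block_det_ne (h.lapse_sq_ne hq) (h.metric_det_ne hq)

theorem lorentz_inv {q : ℝ × E3} (hq : q ∈ Ω) :
    (lorentz N g q)⁻¹ = block (-(N q) ^ 2)⁻¹ (g q)⁻¹ :=
  block_inv (h.lapse_sq_ne hq) (h.metric_det_ne hq)

include hp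

/-- Tracing the Einstein equation in dimension four gives `-R = -m + 3(k - 1)m`. -/
theorem scalar_eq : scalar (lorentz N g) p = (4 - 3 * k p) * m p := by
  have hG := h.isMetric
  have hN := (h.lapse_pos p hp).ne'
  have htr : ∀ {n : ℕ} (B C : Matrix (Fin n) (Fin n) ℝ), Cᵀ = C →
      ∑ a, ∑ b, B a b * C a b = (B * C).trace := by
    intro n B C hC
    simp only [Matrix.trace, Matrix.diag_apply, Matrix.mul_apply]
    refine Finset.sum_congr rfl fun a _ => Finset.sum_congr rfl fun b _ => ?_
    rw [← congrFun (congrFun hC a) b, Matrix.transpose_apply]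
  have h1 : ∑ a, ∑ b, (lorentz N g p)⁻¹ a b * lorentz N g p a b = 4 := by
    rw [htr _ _ (hG.transpose hp), Matrix.nonsing_inv_mul _ (hG.det_ne p hp).isUnit]
    simp
  have h2 : ∑ a, ∑ b, (lorentz N g p)⁻¹ a b * einstein (lorentz N g) p a b
      = scalar (lorentz N g) p - (1 / 2) * scalar (lorentz N g) p * 4 := by
    rw [← h1]
    simp only [einstein, mul_sub, Finset.sum_sub_distrib, scalar, Finset.mul_sum]
    congr 1
    exact Finset.sum_congr rfl fun a _ => Finset.sum_congr rfl fun b _ => by ring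
  have h3 : ∑ a, ∑ b, (lorentz N g p)⁻¹ a b * einstein (lorentz N g) p a b
      = (3 * k p - 4) * m p := by
    have h4 : ((g p)⁻¹ * g p).trace = 3 := by
      rw [Matrix.nonsing_inv_mul _ (h.metric_det_ne hp).isUnit]; simp
    rw [← htr _ _ (h.metric_symm hp)] at h4
    simp only [h.einstein_eq p hp, h.lorentz_inv hp, fluidStress]
    simp only [Fin.sum_univ_succ (n := 3), block_zero_zero, block_zero_succ, block_succ_zero,
      block_succ_succ, zero_mul, Finset.sum_const_zero, add_zero, zero_add, Matrix.smul_apply,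
      smul_eq_mul]
    simp only [mul_left_comm _ ((k p - 1) * m p), ← Finset.mul_sum]
    rw [h4]
    field_simp
    ring
  linarith

theorem ricci_eq (a b : Fin 4) : ricci (lorentz N g) p a b
    = block ((N p) ^ 2 * ((3 * k p - 2) / 2 * m p)) (((2 - k p) / 2 * m p) • g p) a b := by
  have h1 := h.einstein_eq p hp a b
  simp only [einstein, h.scalar_eq hp] at h1
  rw [sub_eq_iff_eq_add.1 h1]
  cases a using Fin.cases <;> cases b using Fin.cases <;>
    simp [fluidStress, lorentz] <;> ring

theorem riemann_curvatureLike : IsCurvatureLike (riemann (lorentz N g) p) :=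
  isCurvatureLike_riemann h.isMetric hp

theorem weyl_curvatureLike : IsCurvatureLike (weyl (lorentz N g) p) := by
  refine isCurvatureLike_weyl h.isMetric hp fun a b => ?_
  rw [h.ricci_eq hp, h.ricci_eq hp, ← Matrix.transpose_apply (block _ _), block_transpose,
    Matrix.transpose_smul, h.metric_symm hp]

/-- The Ricci tensor and the metric have no mixed components, so the Ricci corrections to the Weyl
tensor vanish at these indices. -/
theorem riemann_electric (i j l : Fin 3) :
    riemann (lorentz N g) p 0 i.succ j.succ l.succ = 0 := by
  have h1 := h.electric p hp i j l
  simpa [weyl, h.ricci_eq hp, lorentz] using h1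

theorem electricPart_riemann : electricPart (N p) (riemann (lorentz N g) p)
    = electricPart (N p) (weyl (lorentz N g) p) + ((3 * k p - 2) / 6 * m p) • g p := by
  have hN := (h.lapse_pos p hp).ne'
  ext i j
  simp only [electricPart, Matrix.add_apply, Matrix.smul_apply, Matrix.of_apply, weyl,
    h.ricci_eq hp, h.scalar_eq hp, lorentz, block_zero_zero, block_zero_succ, block_succ_zero,
    block_succ_succ, smul_eq_mul]
  field_simp
  ring

theorem spatialRicci_weyl : spatialRicci (g p) (weyl (lorentz N g) p)
    = spatialRicci (g p) (riemann (lorentz N g) p) - (2 / 3 * m p) • g p := by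
  have h4 : ∑ i, ∑ k, (g p)⁻¹ i k * g p i k = 3 := by
    have : ((g p)⁻¹ * (g p)ᵀ).trace = 3 := by
      rw [h.metric_symm hp, Matrix.nonsing_inv_mul _ (h.metric_det_ne hp).isUnit]; simp
    simpa [Matrix.trace, Matrix.mul_apply] using this
  have h5 : ∀ j l, ∑ i, ∑ k, (g p)⁻¹ i k * (g p i l * g p j k) = g p j l := by
    intro j l
    have h6 : (g p * (g p)⁻¹ᵀ * g p) j l = g p j l := by
      rw [Matrix.transpose_nonsing_inv, h.metric_symm hp,
        Matrix.mul_nonsing_inv _ (h.metric_det_ne hp).isUnit, Matrix.one_mul]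
    rw [← h6]
    simp only [Matrix.mul_apply, Matrix.transpose_apply, Finset.sum_mul]
    exact Finset.sum_congr rfl fun i _ => Finset.sum_congr rfl fun k _ => by ring
  ext j l
  simp only [spatialRicci, contract, Matrix.of_apply, Matrix.sub_apply, Matrix.smul_apply,
    smul_eq_mul]
  have h7 : ∀ i k' : Fin 3, (g p)⁻¹ i k' * weyl (lorentz N g) p i.succ j.succ k'.succ l.succ
      = (g p)⁻¹ i k' * riemann (lorentz N g) p i.succ j.succ k'.succ l.succ
        - (m p / 3) * ((g p)⁻¹ i k' * g p i k' * g p j l)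
        + (m p / 3) * ((g p)⁻¹ i k' * (g p i l * g p j k')) := by
    intro i k'
    simp only [weyl, h.ricci_eq hp, h.scalar_eq hp, lorentz, block_succ_succ, Matrix.smul_apply,
      smul_eq_mul]
    ring
  simp only [h7, Finset.sum_add_distrib, Finset.sum_sub_distrib, ← Finset.mul_sum, h5,
    ← Finset.sum_mul, h4]
  ring

theorem riemannUp_time (b c d : Fin 4) : riemannUp (lorentz N g) 0 b c d p
    = -((N p) ^ 2)⁻¹ * riemann (lorentz N g) p 0 b c d := by
  rw [riemannUp_eq (h.isMetric.det_ne p hp), h.lorentz_inv hp, Fin.sum_univ_succ]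
  simp [inv_neg]

theorem riemannUp_space (i : Fin 3) (b c d : Fin 4) : riemannUp (lorentz N g) i.succ b c d p
    = ∑ e : Fin 3, (g p)⁻¹ i e * riemann (lorentz N g) p e.succ b c d := by
  rw [riemannUp_eq (h.isMetric.det_ne p hp), h.lorentz_inv hp, Fin.sum_univ_succ]
  simp

/-- Contracting through the raised index gives the evolution of the contraction without
differentiating `g⁻¹`. -/
theorem spatialRicci_riemann_apply (j l : Fin 3) :
    spatialRicci (g p) (riemann (lorentz N g) p) j l
      = ∑ i : Fin 3, riemannUp (lorentz N g) i.succ j.succ i.succ l.succ p := by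
  simp only [h.riemannUp_space hp, spatialRicci, contract, Matrix.of_apply]
  rw [Finset.sum_comm]
  refine Finset.sum_congr rfl fun i _ => Finset.sum_congr rfl fun e _ => ?_
  congr 1
  rw [← Matrix.transpose_apply (g p)⁻¹, Matrix.transpose_nonsing_inv, h.metric_symm hp]

theorem riemannUp_time_time (j l : Fin 3) : riemannUp (lorentz N g) 0 j.succ 0 l.succ p
    = -electricPart (N p) (riemann (lorentz N g) p) j l := by
  rw [h.riemannUp_time hp]; simp [electricPart]

theorem riemannUp_space_time (i l : Fin 3) : riemannUp (lorentz N g) i.succ 0 l.succ 0 p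
    = (N p) ^ 2 * ((g p)⁻¹ * electricPart (N p) (riemann (lorentz N g) p)) i l := by
  have hN := (h.lapse_pos p hp).ne'
  have hS := h.riemann_curvatureLike hp
  rw [h.riemannUp_space hp, Matrix.mul_apply, Finset.mul_sum]
  refine Finset.sum_congr rfl fun e _ => ?_
  rw [hS.left, hS.right]
  simp only [electricPart, Matrix.of_apply]
  field_simp

/-- The spatial Ricci components are `g^{ik} R_{ijkl} - R_{TjTl}`. The field equation gives their
value, so the spatial contraction is the electric part plus a multiple of `g`. -/
theorem spatialRicci_riemann : spatialRicci (g p) (riemann (lorentz N g) p)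
    = electricPart (N p) (weyl (lorentz N g) p) + (2 / 3 * m p) • g p := by
  have h1 : spatialRicci (g p) (riemann (lorentz N g) p)
      = electricPart (N p) (riemann (lorentz N g) p) + ((2 - k p) / 2 * m p) • g p := by
    ext j l
    have h2 := h.ricci_eq hp j.succ l.succ
    simp only [ricci] at h2
    rw [Fin.sum_univ_succ, ← h.spatialRicci_riemann_apply hp, h.riemannUp_time_time hp,
      block_succ_succ] at h2
    rw [Matrix.add_apply]
    linarith
  rw [h1, h.electricPart_riemann hp, add_assoc, ← add_smul]
  congr 2
  ring

theorem spatialRicci_weyl_eq : spatialRicci (g p) (weyl (lorentz N g) p)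
    = electricPart (N p) (weyl (lorentz N g) p) := by
  rw [h.spatialRicci_weyl hp, h.spatialRicci_riemann hp, add_sub_cancel_right]

theorem trace_inv_mul : ((g p)⁻¹ * g p).trace = 3 := by
  rw [Matrix.nonsing_inv_mul _ (h.metric_det_ne hp).isUnit]; simp

/-- The trace of `R_{TiTj}` is `R_{TT} = (3k - 2)m/2`, which is already the trace of the pure fluid
part of `R_{TiTj}`. -/
theorem trace_electricWeyl : ((g p)⁻¹ * electricPart (N p) (weyl (lorentz N g) p)).trace = 0 := by
  have hN := (h.lapse_pos p hp).ne'
  have h2 := h.ricci_eq hp 0 0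
  simp only [ricci] at h2
  rw [Fin.sum_univ_succ, h.riemannUp_time hp, (h.riemann_curvatureLike hp).left] at h2
  have h3 : riemann (lorentz N g) p 0 0 0 0 = 0 := by
    linarith [(h.riemann_curvatureLike hp).left 0 0 0 0]
  have h4 : ∀ i : Fin 3, riemannUp (lorentz N g) i.succ 0 i.succ 0 p
      = (N p) ^ 2 * ((g p)⁻¹ * electricPart (N p) (riemann (lorentz N g) p)) i i :=
    fun i => h.riemannUp_space_time hp i i
  simp only [h3, neg_zero, mul_zero, zero_add, h4, ← Finset.mul_sum, block_zero_zero] at h2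
  have h5 := mul_left_cancel₀ (pow_ne_zero 2 hN) h2
  rw [h.electricPart_riemann hp, Matrix.mul_add] at h5
  change (_ + _ : Matrix _ _ ℝ).trace = _ at h5
  rw [Matrix.trace_add, Matrix.mul_smul, Matrix.trace_smul, h.trace_inv_mul hp, smul_eq_mul] at h5
  linarith

/-! Christoffel symbols of the foliated metric. -/

theorem pd_time_metric (i j : Fin 3) :
    pd 0 (fun q => g q i j) p = -(2 * N p) * secondForm N g p i j := by
  have hN := (h.lapse_pos p hp).ne'
  simp only [secondForm, Matrix.of_apply]
  field_simp

theorem conn_time (i e : Fin 3) : conn (lorentz N g) 0 p i.succ e.succ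
    = -N p * ((g p)⁻¹ * secondForm N g p) i e := by
  simp only [conn, Matrix.of_apply, christoffel, h.lorentz_inv hp]
  rw [Fin.sum_univ_succ]
  simp only [block_succ_zero, zero_mul, zero_add, block_succ_succ,
    block_zero_succ, pd_zero_fun, add_zero, sub_zero, lorentz]
  rw [Matrix.mul_apply, Finset.mul_sum, Finset.mul_sum]
  refine Finset.sum_congr rfl fun d _ => ?_
  have hsym : pd 0 (fun q => g q e d) p = pd 0 (fun q => g q d e) p :=
    pd_congr h.isOpen (fun q hq => congrFun (congrFun (h.metric_symm hq) d) e) hp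
  rw [hsym, h.pd_time_metric hp]
  ring

theorem conn_space_time (i k' : Fin 3) : conn (lorentz N g) k'.succ p i.succ 0
    = -N p * ((g p)⁻¹ * secondForm N g p) i k' := by
  rw [← h.conn_time hp]
  exact h.isMetric.christoffel_symm hp _ _ _

theorem conn_space_space (k' j : Fin 3) : conn (lorentz N g) k'.succ p 0 j.succ
    = -(N p)⁻¹ * secondForm N g p k' j := by
  have hN := (h.lapse_pos p hp).ne'
  simp only [conn, Matrix.of_apply, christoffel, h.lorentz_inv hp]
  rw [Fin.sum_univ_succ]
  simp only [block_zero_succ, zero_mul, Finset.sum_const_zero, add_zero, block_zero_zero,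
    block_succ_zero, pd_zero_fun, zero_sub, lorentz, block_succ_succ]
  rw [h.pd_time_metric hp]
  field_simp

/-! Evolution of the curvature. -/

/-- The second Bianchi identity for the directions `k', l, 0`. The curvatures with one time index in
the form slots have vanishing spatial entries on all of `Ω`, so their spatial derivatives vanish
too. The spatial Christoffel symbols and the derivatives of the lapse multiply only vanishing
components, leaving an equation without spatial derivatives of the curvature. -/
theorem pd_riemannUp_spatial (i j k' l : Fin 3) :
    pd 0 (riemannUp (lorentz N g) i.succ j.succ k'.succ l.succ) p = N p *
      (∑ e : Fin 3, ((g p)⁻¹ * secondForm N g p) i e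
          * riemannUp (lorentz N g) e.succ j.succ k'.succ l.succ p
        - ∑ e : Fin 3, riemannUp (lorentz N g) i.succ e.succ k'.succ l.succ p
          * ((g p)⁻¹ * secondForm N g p) e j
        + ((g p)⁻¹ * secondForm N g p) i k'
          * electricPart (N p) (riemann (lorentz N g) p) j l
        - ((g p)⁻¹ * electricPart (N p) (riemann (lorentz N g) p)) i l * secondForm N g p k' j
        - ((g p)⁻¹ * secondForm N g p) i l
          * electricPart (N p) (riemann (lorentz N g) p) j k'
        + ((g p)⁻¹ * electricPart (N p) (riemann (lorentz N g) p)) i k'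
          * secondForm N g p l j) := by
  have hN := (h.lapse_pos p hp).ne'
  have hS := fun {q : ℝ × E3} (hq : q ∈ Ω) => h.riemann_curvatureLike hq
  have hB := congrFun (congrFun (h.isMetric.second_bianchi hp k'.succ l.succ 0) i.succ) j.succ
  have e1 : curv (lorentz N g) k'.succ l.succ p 0 j.succ = 0 := by
    simp [curv, h.riemannUp_time hp, h.riemann_electric hp]
  have e2 : curv (lorentz N g) k'.succ l.succ p i.succ 0 = 0 := by
    simp only [curv, Matrix.of_apply, h.riemannUp_space hp]
    refine Finset.sum_eq_zero fun e _ => ?_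
    rw [(hS hp).left, h.riemann_electric hp]; ring
  have e3 : ∀ l i j : Fin 3, ∀ q ∈ Ω, curv (lorentz N g) l.succ 0 q i.succ j.succ = 0 := by
    intro l i j q hq
    simp only [curv, Matrix.of_apply, h.riemannUp_space hq]
    refine Finset.sum_eq_zero fun e _ => ?_
    rw [(hS hq).pair, (hS hq).left, h.riemann_electric hq]; ring
  have e4 : ∀ l i j : Fin 3, ∀ q ∈ Ω, curv (lorentz N g) 0 l.succ q i.succ j.succ = 0 := by
    intro l i j q hq
    rw [curv_antisymm, Matrix.neg_apply, e3 l i j q hq, neg_zero]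
  have e5 : ∀ l j : Fin 3, curv (lorentz N g) 0 l.succ p 0 j.succ
      = -electricPart (N p) (riemann (lorentz N g) p) j l := fun l j =>
    h.riemannUp_time_time hp j l
  have e6 : ∀ l j : Fin 3, curv (lorentz N g) l.succ 0 p 0 j.succ
      = electricPart (N p) (riemann (lorentz N g) p) j l := fun l j => by
    rw [curv_antisymm, Matrix.neg_apply, e5, neg_neg]
  have e7 : ∀ l i : Fin 3, curv (lorentz N g) l.succ 0 p i.succ 0
      = (N p) ^ 2 * ((g p)⁻¹ * electricPart (N p) (riemann (lorentz N g) p)) i l := fun l i =>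
    h.riemannUp_space_time hp i l
  have e8 : ∀ l i : Fin 3, curv (lorentz N g) 0 l.succ p i.succ 0
      = -((N p) ^ 2 * ((g p)⁻¹ * electricPart (N p) (riemann (lorentz N g) p)) i l) :=
    fun l i => by rw [curv_antisymm, Matrix.neg_apply, e7]
  have e9 : pd k'.succ (fun q => curv (lorentz N g) l.succ 0 q i.succ j.succ) p = 0 := by
    rw [pd_congr (f' := fun _ => 0) h.isOpen (e3 l i j) hp, pd_zero_fun]
  have e10 : pd l.succ (fun q => curv (lorentz N g) 0 k'.succ q i.succ j.succ) p = 0 := by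
    rw [pd_congr (f' := fun _ => 0) h.isOpen (e4 k' i j) hp, pd_zero_fun]
  simp only [Matrix.add_apply, Matrix.sub_apply, Matrix.mul_apply, pdM_apply, e9, e10,
    Matrix.zero_apply, Fin.sum_univ_succ (n := 3), e1, e2, e3 l _ _ p hp, e4 k' _ _ p hp, e5, e6,
    e7, e8, mul_zero, zero_mul, Finset.sum_const_zero, h.conn_time hp, h.conn_space_time hp,
    h.conn_space_space hp] at hB
  have e11 : pd 0 (riemannUp (lorentz N g) i.succ j.succ k'.succ l.succ) p
    = pd 0 (fun q => curv (lorentz N g) k'.succ l.succ q i.succ j.succ) p := rfl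
  have e12 : ∀ e j : Fin 3, riemannUp (lorentz N g) e.succ j.succ k'.succ l.succ p
    = curv (lorentz N g) k'.succ l.succ p e.succ j.succ := fun _ _ => rfl
  rw [e11]
  simp only [e12]
  simp only [mul_assoc, mul_left_comm _ (-N p), ← Finset.mul_sum] at hB
  rw [← sub_eq_zero]
  rw [← hB]
  simp only [Matrix.mul_apply]
  field_simp
  ring

theorem secondForm_transpose : (secondForm N g p)ᵀ = secondForm N g p := by
  ext i j
  simp only [secondForm, Matrix.transpose_apply, Matrix.of_apply]
  congr 1
  exact pd_congr h.isOpen (fun q hq => congrFun (congrFun (h.metric_symm hq) i) j) hp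

theorem metric_mul_shape : g p * ((g p)⁻¹ * secondForm N g p) = secondForm N g p := by
  rw [← Matrix.mul_assoc, Matrix.mul_nonsing_inv _ (h.metric_det_ne hp).isUnit, Matrix.one_mul]

theorem shape_transpose :
    ((g p)⁻¹ * secondForm N g p)ᵀ = secondForm N g p * (g p)⁻¹ := by
  rw [Matrix.transpose_mul, h.secondForm_transpose hp, Matrix.transpose_nonsing_inv,
    h.metric_symm hp]

theorem riemannUp_spatial_eq (e j i l : Fin 3) :
    riemannUp (lorentz N g) e.succ j.succ i.succ l.succ p
      = (let P := spatialRicci (g p) (riemann (lorentz N g) p)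
        ((g p)⁻¹ * P) e i * g p j l + (1 : Matrix (Fin 3) (Fin 3) ℝ) e i * P j l
        - ((g p)⁻¹ * P) e l * g p j i - (1 : Matrix (Fin 3) (Fin 3) ℝ) e l * P j i
        - ((g p)⁻¹ * P).trace / 2 * ((1 : Matrix (Fin 3) (Fin 3) ℝ) e i * g p j l
          - (1 : Matrix (Fin 3) (Fin 3) ℝ) e l * g p j i)) := by
  extract_lets P
  rw [h.riemannUp_space hp, ← Matrix.nonsing_inv_mul _ (h.metric_det_ne hp).isUnit]
  simp only [(h.riemann_curvatureLike hp).spatial_eq (h.metric_pos p hp), Matrix.mul_apply,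
    Finset.sum_mul, Finset.mul_sum, ← Finset.sum_sub_distrib, ← Finset.sum_add_distrib]
  exact Finset.sum_congr rfl fun f _ => by ring

/-- Closes the evolution equation: the full spatial curvature is eliminated in favour of its
contraction through the three-dimensional decomposition. -/
theorem curvature_contraction (j l : Fin 3) :
    ∑ i : Fin 3, ∑ e : Fin 3, ((g p)⁻¹ * secondForm N g p) i e
        * riemannUp (lorentz N g) e.succ j.succ i.succ l.succ p
      = (let P := spatialRicci (g p) (riemann (lorentz N g) p)
        let K := (g p)⁻¹ * secondForm N g p
        (K * ((g p)⁻¹ * P)).trace • g p + K.trace • P - secondForm N g p * ((g p)⁻¹ * P)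
        - P * K - (((g p)⁻¹ * P).trace / 2) • (K.trace • g p - secondForm N g p)) j l := by
  extract_lets P K
  have hK : secondForm N g p = g p * K := (h.metric_mul_shape hp).symm
  simp only [h.riemannUp_spatial_eq hp, Matrix.sub_apply, Matrix.add_apply, Matrix.smul_apply,
    smul_eq_mul]
  change ∑ i, ∑ e, K i e * (((g p)⁻¹ * P) e i * g p j l + (1 : Matrix (Fin 3) (Fin 3) ℝ) e i * P j l
        - ((g p)⁻¹ * P) e l * g p j i - (1 : Matrix (Fin 3) (Fin 3) ℝ) e l * P j i
        - ((g p)⁻¹ * P).trace / 2 * ((1 : Matrix (Fin 3) (Fin 3) ℝ) e i * g p j l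
          - (1 : Matrix (Fin 3) (Fin 3) ℝ) e l * g p j i))
    = (K * ((g p)⁻¹ * P)).trace * g p j l + K.trace * P j l - (secondForm N g p * ((g p)⁻¹ * P)) j l
        - (P * K) j l - ((g p)⁻¹ * P).trace / 2 * (K.trace * g p j l - secondForm N g p j l)
  rw [hK]
  generalize (g p)⁻¹ * P = Q
  generalize Q.trace = r
  simp only [Matrix.trace, Matrix.diag_apply, Matrix.mul_apply, Matrix.one_apply,
    Fin.sum_univ_three]
  fin_cases l <;> simp <;> ring

/-- The evolution of the spatial contraction of the Riemann tensor. -/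
theorem pdM_spatialRicci :
    pdM 0 (fun q => spatialRicci (g q) (riemann (lorentz N g) q)) p
      = (let P := spatialRicci (g p) (riemann (lorentz N g) p)
        let A := electricPart (N p) (riemann (lorentz N g) p)
        let K := (g p)⁻¹ * secondForm N g p
        N p • ((K * ((g p)⁻¹ * P)).trace • g p + K.trace • P - secondForm N g p * ((g p)⁻¹ * P)
        - P * K - (((g p)⁻¹ * P).trace / 2) • (K.trace • g p - secondForm N g p)
        - secondForm N g p * (g p)⁻¹ * P + K.trace • A - secondForm N g p * ((g p)⁻¹ * A)
        - A * K + ((g p)⁻¹ * A).trace • secondForm N g p)) := by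
  extract_lets P A K
  ext j l
  have hd : ∀ i : Fin 3, DifferentiableAt ℝ
      (riemannUp (lorentz N g) i.succ j.succ i.succ l.succ) p := fun i =>
    (h.isMetric.curv_smooth i.succ l.succ).differentiableAt h.isOpen hp i.succ j.succ
  have h1 : pdM 0 (fun q => spatialRicci (g q) (riemann (lorentz N g) q)) p j l
      = ∑ i : Fin 3, pd 0 (riemannUp (lorentz N g) i.succ j.succ i.succ l.succ) p := by
    rw [pdM_apply, ← pd_sum fun i _ => hd i]
    exact pd_congr h.isOpen (fun q hq => h.spatialRicci_riemann_apply hq j l) hp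
  rw [h1]
  simp only [h.pd_riemannUp_spatial hp, ← Finset.mul_sum, Finset.sum_add_distrib,
    Finset.sum_sub_distrib]
  rw [h.curvature_contraction hp]
  simp only [Matrix.smul_apply, Matrix.add_apply, Matrix.sub_apply, smul_eq_mul]
  have h2 : ∑ i : Fin 3, ∑ e : Fin 3, riemannUp (lorentz N g) i.succ e.succ i.succ l.succ p
      * K e j = (secondForm N g p * (g p)⁻¹ * P) j l := by
    rw [← h.shape_transpose hp, Finset.sum_comm, Matrix.mul_apply]
    refine Finset.sum_congr rfl fun e _ => ?_
    rw [← Finset.sum_mul, ← h.spatialRicci_riemann_apply hp, mul_comm]; rfl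
  have h3 : ∑ i, ((g p)⁻¹ * A) i l * secondForm N g p i j
      = (secondForm N g p * ((g p)⁻¹ * A)) j l := by
    rw [Matrix.mul_apply]
    refine Finset.sum_congr rfl fun i _ => ?_
    rw [mul_comm]; congr 1
    exact congrFun (congrFun (h.secondForm_transpose hp) j) i
  have h4 : ∑ i, K i l * A j i = (A * K) j l := by
    rw [Matrix.mul_apply]
    exact Finset.sum_congr rfl fun i _ => mul_comm _ _
  have h5 : secondForm N g p l j = secondForm N g p j l :=
    congrFun (congrFun (h.secondForm_transpose hp) j) l
  rw [h2, h3, h4, h5, ← Finset.sum_mul, ← Finset.sum_mul]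
  rfl

omit hp in
/-- The smoothness of the spatial contraction of the Riemann tensor. -/
theorem spatialRicci_smooth : MatSmooth Ω fun q => spatialRicci (g q) (riemann (lorentz N g) q) := by
  intro j l
  have h1 : ContDiffOn ℝ ∞ (fun q => ∑ i : Fin 3,
      riemannUp (lorentz N g) i.succ j.succ i.succ l.succ q) Ω :=
    ContDiffOn.sum fun i _ => h.isMetric.curv_smooth i.succ l.succ i.succ j.succ
  exact h1.congr fun q hq => h.spatialRicci_riemann_apply hq j l

/-- The mixed electric part `X^i_j = W_T^i_Tj` of the Weyl tensor. -/
theorem mixedRicci_eq : (g p)⁻¹ * spatialRicci (g p) (riemann (lorentz N g) p)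
    = (g p)⁻¹ * electricPart (N p) (weyl (lorentz N g) p) + (2 / 3 * m p) • 1 := by
  rw [h.spatialRicci_riemann hp, Matrix.mul_add, Matrix.mul_smul,
    Matrix.nonsing_inv_mul _ (h.metric_det_ne hp).isUnit]

/-- Raising an index adds `2N K` times the mixed contraction, from `∂_t g = -2N h`. In mixed
components the metric disappears, and `tr X = 0` turns the remaining curvature traces into multiples
of `m`. -/
theorem pdM_mixedRicci :
    pdM 0 (fun q => (g q)⁻¹ * spatialRicci (g q) (riemann (lorentz N g) q)) p
      = (let X := (g p)⁻¹ * electricPart (N p) (weyl (lorentz N g) p)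
        let K := (g p)⁻¹ * secondForm N g p
        N p • ((K * X).trace • 1 + (2 * K.trace) • X - (2 : ℝ) • (X * K) - K * X
          + (k p * m p / 2) • (K + K.trace • 1))) := by
  extract_lets X K
  have hu := (h.metric_det_ne hp).isUnit
  have hdet := fun q (hq : q ∈ Ω) => h.metric_det_ne hq
  have hg : pdM 0 g p = -((2 * N p) • secondForm N g p) := by
    ext i j
    rw [pdM_apply, h.pd_time_metric hp]; simp
  rw [pdM_mul h.isOpen hp (h.metric_smooth.inv hdet) (h.spatialRicci_smooth),
    pdM_inv h.isOpen hp h.metric_smooth hdet, hg, h.pdM_spatialRicci hp]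
  have hP : spatialRicci (g p) (riemann (lorentz N g) p) = g p * (X + (2 / 3 * m p) • 1) := by
    rw [← h.mixedRicci_eq hp, ← Matrix.mul_assoc, Matrix.mul_nonsing_inv _ hu, Matrix.one_mul]
  have hA : electricPart (N p) (riemann (lorentz N g) p)
      = g p * (X + ((3 * k p - 2) / 6 * m p) • 1) := by
    rw [h.electricPart_riemann hp, Matrix.mul_add, ← Matrix.mul_assoc,
      Matrix.mul_nonsing_inv _ hu, Matrix.one_mul, Matrix.mul_smul, Matrix.mul_one]
  have hK : secondForm N g p = g p * K := (h.metric_mul_shape hp).symm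
  have hX : X.trace = 0 := h.trace_electricWeyl hp
  have hc : ∀ B : Matrix (Fin 3) (Fin 3) ℝ, (g p)⁻¹ * (g p * B) = B := fun B => by
    rw [← Matrix.mul_assoc, Matrix.nonsing_inv_mul _ hu, Matrix.one_mul]
  simp only [hP, hA]
  rw [show (g p)⁻¹ * secondForm N g p = K from rfl, hK]
  simp only [Matrix.mul_assoc, hc, Matrix.mul_add, Matrix.add_mul, Matrix.mul_sub, Matrix.mul_smul,
    Matrix.smul_mul, Matrix.mul_neg, Matrix.neg_mul, neg_neg, Matrix.mul_one,
    Matrix.nonsing_inv_mul _ hu, Matrix.trace_add, Matrix.trace_smul, Matrix.trace_one, hX,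
    smul_eq_mul, Fintype.card_fin]
  ext i j
  simp only [Matrix.add_apply, Matrix.sub_apply, Matrix.smul_apply, smul_eq_mul]
  push_cast
  ring

/-- The density, given only as a real function, inherits smoothness from the curvature by this
formula. -/
theorem density_eq : m p
    = 1 / 2 * ((g p)⁻¹ * spatialRicci (g p) (riemann (lorentz N g) p)).trace := by
  rw [h.mixedRicci_eq hp, Matrix.trace_add, h.trace_electricWeyl hp]
  simp
  ring

omit hp in
theorem mixedRicci_smooth :
    MatSmooth Ω fun q => (g q)⁻¹ * spatialRicci (g q) (riemann (lorentz N g) q) :=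
  (h.metric_smooth.inv fun _ hq => h.metric_det_ne hq).mul h.spatialRicci_smooth

omit hp in
theorem density_smooth : ContDiffOn ℝ ∞ m Ω := by
  have h1 : ContDiffOn ℝ ∞ (fun q => 1 / 2 *
      ((g q)⁻¹ * spatialRicci (g q) (riemann (lorentz N g) q)).trace) Ω :=
    contDiffOn_const.mul (ContDiffOn.sum fun i _ => h.mixedRicci_smooth i i)
  exact h1.congr fun _ hq => h.density_eq hq

/-- Conservation of energy. -/
theorem pd_density : pd 0 m p = N p * (k p * m p * ((g p)⁻¹ * secondForm N g p).trace) := by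
  have hd : ∀ i, DifferentiableAt ℝ (fun q => ((g q)⁻¹ *
      spatialRicci (g q) (riemann (lorentz N g) q)) i i) p := fun i =>
    h.mixedRicci_smooth.differentiableAt h.isOpen hp i i
  have h1 : pd 0 m p = 1 / 2 *
      (pdM 0 (fun q => (g q)⁻¹ * spatialRicci (g q) (riemann (lorentz N g) q)) p).trace := by
    rw [pd_congr h.isOpen (fun q hq => h.density_eq hq) hp]
    simp only [Matrix.trace, Matrix.diag_apply, pdM_apply]
    rw [← pd_sum fun i _ => hd i, pd_mul (differentiableAt_const _)
      (DifferentiableAt.fun_sum fun i _ => hd i)]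
    simp [pd]
  rw [h1, h.pdM_mixedRicci hp]
  have hX : ((g p)⁻¹ * electricPart (N p) (weyl (lorentz N g) p)).trace = 0 :=
    h.trace_electricWeyl hp
  set X := (g p)⁻¹ * electricPart (N p) (weyl (lorentz N g) p)
  set K := (g p)⁻¹ * secondForm N g p
  -- The multiples of `tr(KX)` add up to `3 - 2 - 1 = 0`, and the fluid term has trace `(km/2) ·
  -- 4H`.
  simp only [Matrix.trace_smul, Matrix.trace_add, Matrix.trace_sub, Matrix.trace_one, hX,
    Matrix.trace_mul_comm X K, smul_eq_mul, Fintype.card_fin]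
  push_cast
  ring

/-- The evolution of the electric part of the Weyl tensor. -/
theorem pdM_electric :
    pdM 0 (fun q => (g q)⁻¹ * electricPart (N q) (weyl (lorentz N g) q)) p
      = (let X := (g p)⁻¹ * electricPart (N p) (weyl (lorentz N g) p)
        let K := (g p)⁻¹ * secondForm N g p
        N p • ((K * X).trace • 1 + (2 * K.trace) • X - (2 : ℝ) • (X * K) - K * X
          + (k p * m p / 2) • (K - (K.trace / 3) • 1))) := by
  extract_lets X K
  have hs : MatSmooth Ω fun q => (2 / 3 * m q) • (1 : Matrix (Fin 3) (Fin 3) ℝ) := fun i j =>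
    (contDiffOn_const.mul h.density_smooth).mul contDiffOn_const
  have h1 : pdM 0 (fun q => (2 / 3 * m q) • (1 : Matrix (Fin 3) (Fin 3) ℝ)) p
      = (2 / 3 * pd 0 m p) • 1 := by
    have hd := h.density_smooth.differentiableAt_of_isOpen h.isOpen hp
    ext i j
    rw [pdM_apply]
    simp only [Matrix.smul_apply, smul_eq_mul]
    rw [pd_mul (hd.const_mul _) (differentiableAt_const _),
      pd_mul (differentiableAt_const _) hd]
    simp [pd]
  rw [pdM_congr (F' := fun q => (g q)⁻¹ * spatialRicci (g q) (riemann (lorentz N g) q)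
      - (2 / 3 * m q) • 1) h.isOpen (fun q hq => by simp only [h.mixedRicci_eq hq]; simp) hp,
    pdM_sub h.isOpen hp h.mixedRicci_smooth hs, h.pdM_mixedRicci hp, h1, h.pd_density hp]
  ext i j
  simp only [Matrix.add_apply, Matrix.sub_apply, Matrix.smul_apply, smul_eq_mul]
  ring

end FluidChart

end

/-! ### The entropy along a time line -/

section Calculus

variable {f : ℝ → ℝ} {a b t : ℝ}

theorem hasDerivAt_of_one_sided (h₁ : HasDerivWithinAt f a (Set.Ici t) t)
    (h₂ : HasDerivWithinAt f a (Set.Iic t) t) : HasDerivAt f a t := by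
  rw [← hasDerivWithinAt_univ, ← Set.Iic_union_Ici (a := t)]
  exact h₂.union h₁

theorem one_sided_derivs_eq (h₁ : HasDerivWithinAt f a (Set.Ici t) t)
    (h₂ : HasDerivWithinAt f b (Set.Iic t) t) (hf : DifferentiableAt ℝ f t) :
    a = deriv f t ∧ b = deriv f t :=
  ⟨(uniqueDiffWithinAt_Ici t).eq_deriv _ h₁ hf.hasDerivAt.hasDerivWithinAt,
    (uniqueDiffWithinAt_Iic t).eq_deriv _ h₂ hf.hasDerivAt.hasDerivWithinAt⟩

/-- The entropy may have corners, so monotonicity must come from the right derivative; the left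
derivative serves only for continuity. -/
theorem le_of_right_deriv_nonneg (hab : a ≤ b)
    (h : ∀ t ∈ Set.Icc a b, ∃ r l : ℝ, HasDerivWithinAt f r (Set.Ici t) t ∧
      HasDerivWithinAt f l (Set.Iic t) t ∧ 0 ≤ r) : f a ≤ f b := by
  choose! r l hr hl h0 using h
  have hc : ContinuousOn f (Set.Icc a b) := fun t ht => by
    have h1 := (hl t ht).continuousWithinAt.union (hr t ht).continuousWithinAt
    rw [Set.Iic_union_Ici] at h1
    exact h1.mono (Set.subset_univ _)
  exact image_le_of_deriv_right_le_deriv_boundary (f := fun _ => f a) (f' := fun _ => 0)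
    continuousOn_const (fun x _ => hasDerivWithinAt_const _ _ _) le_rfl hc
    (fun x hx => hr x (Set.Ico_subset_Icc_self hx))
    (fun x hx => h0 x (Set.Ico_subset_Icc_self hx)) (Set.right_mem_Icc.2 hab)

/-- A solution of a homogeneous linear equation that vanishes once vanishes nearby. -/
theorem eventually_eq_zero_of_linear {c : ℝ → ℝ} (hc : ContinuousAt c t)
    (hf : ∀ᶠ s in nhds t, HasDerivAt f (c s * f s) s) (h0 : f t = 0) :
    ∀ᶠ s in nhds t, f s = 0 := by
  have hb : ∀ᶠ s in nhds t, |c s| < |c t| + 1 :=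
    hc.abs.eventually_lt_const (lt_add_one _)
  refine ODE_solution_unique_of_eventually (v := fun s x => c s * x) (s := fun _ => Set.univ)
    (g := fun _ => 0) (K := Real.toNNReal (|c t| + 1)) ?_ ?_ ?_ h0
  · filter_upwards [hb] with s hs
    refine LipschitzOnWith.of_dist_le_mul fun x _ y _ => ?_
    rw [Real.dist_eq, Real.dist_eq, ← mul_sub, abs_mul,
      Real.coe_toNNReal _ (by positivity)]
    gcongr
  · filter_upwards [hf] with s hs using ⟨hs, trivial⟩
  · exact Filter.Eventually.of_forall fun s => ⟨by simpa using hasDerivAt_const s (0 : ℝ), trivial⟩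

/-- The square root of a nonnegative nondecreasing `C²` function is differentiable at a zero. -/
theorem hasDerivAt_sqrt_of_monotone {J : Set ℝ} (hJ : IsOpen J) (hf : ContDiffOn ℝ 2 f J)
    (hd : ∀ s ∈ J, 0 ≤ deriv f s) (hn : ∀ s ∈ J, 0 ≤ f s) (ht : t ∈ J) (h0 : f t = 0) :
    HasDerivAt (fun s => Real.sqrt (f s)) 0 t := by
  obtain ⟨ε, hε, hball⟩ := Metric.isOpen_iff.1 hJ t ht
  have hdiff : ∀ s ∈ J, DifferentiableAt ℝ f s := fun s hs =>
    (hf.contDiffAt (hJ.mem_nhds hs)).differentiableAt (by simp)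
  have hmono : MonotoneOn f (Metric.ball t ε) := by
    refine monotoneOn_of_deriv_nonneg (convex_ball t ε)
      (fun s hs => (hdiff s (hball hs)).continuousAt.continuousWithinAt)
      (fun s hs => (hdiff s (hball (interior_subset hs))).differentiableWithinAt)
      fun s hs => hd s (hball (interior_subset hs))
  -- Being nonnegative and nondecreasing, `f` vanishes to the left of its zero `t`. Hence the first
  -- and second derivatives at `t`, computed from the left, are zero, so `f` is `o((s - t)²)` and
  -- its root is `o(s - t)`.
  have hleft : ∀ s ∈ Metric.ball t ε, s ≤ t → f s = 0 := fun s hs hst =>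
    le_antisymm (h0 ▸ hmono hs (Metric.mem_ball_self hε) hst) (hn s (hball hs))
  have hdt : deriv f t = 0 := by
    have h1 : HasDerivWithinAt f 0 (Set.Iic t) t := by
      refine (hasDerivWithinAt_const t (Set.Iic t) (0 : ℝ)).congr_of_eventuallyEq ?_ h0
      filter_upwards [self_mem_nhdsWithin,
        mem_nhdsWithin_of_mem_nhds (Metric.ball_mem_nhds t hε)] with s hs hs'
      exact hleft s hs' hs
    exact (uniqueDiffWithinAt_Iic t).eq_deriv _ (hdiff t ht).hasDerivAt.hasDerivWithinAt h1
  have hdleft : ∀ s ∈ Metric.ball t ε, s ≤ t → deriv f s = 0 := by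
    intro s hs hst
    rcases hst.eq_or_lt with rfl | hlt
    · exact hdt
    · have h1 : f =ᶠ[nhds s] fun _ => 0 := by
        filter_upwards [Metric.isOpen_ball.mem_nhds hs, Iio_mem_nhds hlt] with r hr hr'
        exact hleft r hr hr'.le
      rw [h1.deriv_eq]; simp
  have hd2 : HasDerivAt (deriv f) 0 t := by
    have h1 : DifferentiableAt ℝ (deriv f) t :=
      ((hf.deriv_of_isOpen (m := 1) hJ (by norm_num)).contDiffAt
        (hJ.mem_nhds ht)).differentiableAt (by simp)
    have h2 : HasDerivWithinAt (deriv f) 0 (Set.Iic t) t := by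
      refine (hasDerivWithinAt_const t (Set.Iic t) (0 : ℝ)).congr_of_eventuallyEq ?_ hdt
      filter_upwards [self_mem_nhdsWithin,
        mem_nhdsWithin_of_mem_nhds (Metric.ball_mem_nhds t hε)] with s hs hs'
      exact hdleft s hs' hs
    have h3 := (uniqueDiffWithinAt_Iic t).eq_deriv _ h1.hasDerivAt.hasDerivWithinAt h2
    exact h3 ▸ h1.hasDerivAt
  rw [hasDerivAt_iff_isLittleO] at hd2 ⊢
  simp only [hdt, h0, Real.sqrt_zero, sub_zero, smul_zero] at hd2 ⊢
  rw [Asymptotics.isLittleO_iff] at hd2 ⊢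
  intro c hc
  obtain ⟨δ, hδ, hsmall⟩ := Metric.eventually_nhds_iff_ball.1 (hd2 (pow_pos hc 2))
  filter_upwards [Metric.ball_mem_nhds t (lt_min hε hδ)] with s hs
  have hsε := Metric.ball_subset_ball (min_le_left ε δ) hs
  rw [Real.norm_eq_abs, abs_of_nonneg (Real.sqrt_nonneg _), Real.norm_eq_abs]
  rcases le_or_gt s t with hst | hst
  · rw [hleft s hsε hst, Real.sqrt_zero]; positivity
  · refine Real.sqrt_le_iff.2 ⟨by positivity, ?_⟩
    have hsub : Set.Icc t s ⊆ Metric.ball t (min ε δ) := by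
      intro r hr
      rw [Metric.mem_ball, Real.dist_eq] at hs ⊢
      rw [abs_of_pos (sub_pos.2 hst)] at hs
      rw [abs_of_nonneg (sub_nonneg.2 hr.1)]
      linarith [hr.2]
    have hJ' : ∀ r ∈ Set.Icc t s, r ∈ J := fun r hr =>
      hball (Metric.ball_subset_ball (min_le_left _ _) (hsub hr))
    -- The mean value theorem and `f'(r) ≤ c² (r - t)` give `f(s) ≤ c² (s - t)²`.
    obtain ⟨r, hr, hslope⟩ := exists_deriv_eq_slope f hst
      (fun r hr => (hdiff r (hJ' r hr)).continuousAt.continuousWithinAt)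
      fun r hr => (hdiff r (hJ' r (Set.Ioo_subset_Icc_self hr))).differentiableWithinAt
    have hr' := Set.Ioo_subset_Icc_self hr
    have hb := hsmall r (Metric.ball_subset_ball (min_le_right _ _) (hsub hr'))
    rw [Real.norm_eq_abs, Real.norm_eq_abs, abs_of_nonneg (sub_nonneg.2 hr'.1)] at hb
    rw [h0, sub_zero, eq_div_iff (sub_pos.2 hst).ne'] at hslope
    rw [← hslope, mul_pow, sq_abs]
    have h5 : deriv f r ≤ c ^ 2 * (s - t) :=
      (le_abs_self _).trans (hb.trans (by gcongr; exact hr'.2))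
    nlinarith [sub_pos.2 hst]

end Calculus

/-! ### Pointwise inequalities behind the critical density -/

/-- The discriminant `9k² - 12k + 8` is positive. -/
theorem discr_pos (k : ℝ) : 0 < 9 * k ^ 2 - 12 * k + 8 := by nlinarith [sq_nonneg (3 * k - 2)]

/-- In this form `√(1 - 3α)` occurs only in the first summand, so only that one is delicate to
differentiate at `α = 1/3`. The first summand compensates the decay of the ratio `s`, the second the
fluid source term. -/
theorem sCrit_eq {k α : ℝ} (hα : α ≤ 1 / 3) : sCrit k α = Real.sqrt 2 / 4 * Real.sqrt (1 - 3 * α)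
    + 2 * (1 - 3 * α) * (k / Real.sqrt (9 * k ^ 2 - 12 * k + 8)) := by
  have hb : 0 ≤ 1 - 3 * α := by linarith
  rw [sCrit, Real.sqrt_div hb]
  have h := Real.mul_self_sqrt hb
  generalize Real.sqrt (1 - 3 * α) = x at *
  rw [← h]
  ring

theorem sqrt_two_div_four_gt : (0.35 : ℝ) < Real.sqrt 2 / 4 := by
  have : (1.4 : ℝ) < Real.sqrt 2 := Real.lt_sqrt_of_sq_lt (by norm_num)
  linarith

/-- Here `β = √(1 - 3α)`. As `β² ≤ β`, the first term is at least `s³(1 - β) - β(s - 2s³)`. The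
maximum of `s - 2s³` is about `0.272`, below `√2/4 ≈ 0.354`; the constants `0.28` and `0.35`
separate the two. -/
theorem critical_polynomial_pos {s β : ℝ} (hs : 0 < s) (hs1 : s ≤ 1) (hβ : 0 ≤ β) (hβ1 : β ≤ 1) :
    0 < s * (1 - (1 + β ^ 2) * (1 - s ^ 2)) + Real.sqrt 2 / 4 * β := by
  have h1 : s - 2 * s ^ 3 ≤ 0.28 := by 
    -- `0.41` approximates the maximum point `1/√6`, and `1.64 = 4 · 0.41` cancels the quadratic
    -- term of the product.
    nlinarith [mul_nonneg (by positivity : 0 ≤ 2 * s + 1.64) (sq_nonneg (s - 0.41))]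
  have h2 : 0 ≤ s - s ^ 3 := by nlinarith [mul_nonneg hs.le (sub_nonneg.2 hs1)]
  have h3 : β ^ 2 * (s - s ^ 3) ≤ β * (s - s ^ 3) := by
    apply mul_le_mul_of_nonneg_right _ h2; nlinarith
  have h4 : 0.35 * β ≤ Real.sqrt 2 / 4 * β :=
    mul_le_mul_of_nonneg_right sqrt_two_div_four_gt.le hβ
  have h5 : 0 < s ^ 3 := by positivity
  have h6 : β * (s - 2 * s ^ 3) ≤ β * 0.28 := mul_le_mul_of_nonneg_left h1 hβ
  have h7 : 0 < s ^ 3 * (1 - β) + 0.07 * β := by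
    rcases hβ1.eq_or_lt with rfl | h
    · norm_num
    · have := mul_pos h5 (sub_pos.2 h); positivity
  nlinarith

/-- The ratio `|W| / |R|` in terms of the density `m` and the squared norm `v` of the electric part
of the Weyl tensor. -/
def weylRatio (k m v : ℝ) : ℝ :=
  if m = 0 then 1 else Real.sqrt (8 * v) /
    Real.sqrt (8 * v + (9 * k ^ 2 - 12 * k + 8) * m ^ 2 / 3)

/-- For `y = |W|`, `z = |R|` and `r² = q m²/3`, this rewrites the bound of `ratio_numerator_bound`
in terms of `s = y/z` and `r/z = √(1 - s²)`. -/
theorem ratio_deriv_lower_bound_eq {x b k p r y z : ℝ} (hp : p ≠ 0) (hy : y ≠ 0) (hz : z ≠ 0)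
    (hr : r ^ 2 = z ^ 2 - y ^ 2) :
    x * (-(1 + b) * (1 - (y / z) ^ 2) * (y / z) - 2 * b * (k / p) * (r / z) ^ 3)
      = (y / z) / (2 * (y ^ 2 / 8) * z ^ 2) *
        (x * (r ^ 2 * (-(2 + 2 * b) * (y ^ 2 / 8) - k * (r * b * y / (2 * p))))) := by
  have h1 : 1 - (y / z) ^ 2 = r ^ 2 / z ^ 2 := by rw [hr]; field_simp
  rw [h1]
  field_simp
  ring

/-- The right-hand side is `v'Q - vQ'`, the numerator of the derivative of `|W|/|R|`, where `Q = q
m²/3`. The bound `hκ` makes `-vQ'` nonnegative; the trace bounds `hτ₂` and `hτ₁` control the two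
parts of `v'`. -/
theorem ratio_numerator_bound {n H k m v α κ τ₁ τ₂ q Q p r y : ℝ} (hn : 0 < n) (hH : H < 0)
    (hk : 0 ≤ k) (hv : 0 < v) (hα : α ≤ 1 / 3)
    (hτ₁ : τ₁ ^ 2 ≤ 2 / 3 * ((1 - 3 * α) * H) ^ 2 * v) (hτ₂ : τ₂ ≤ α * H * v)
    (hκ : 0 ≤ (18 * k - 12) * κ + 2 * k * q) (hQ : Q = q * m ^ 2 / 3)
    (hp : 0 < p) (hp2 : p ^ 2 = q) (hr : 0 < r) (hr2 : r ^ 2 = Q) (hy : 0 < y)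
    (hy2 : y ^ 2 = 8 * v) :
    n * (-H) * (r ^ 2 * (-(2 + 2 * (1 - 3 * α)) * (y ^ 2 / 8)
        - k * (r * (1 - 3 * α) * y / (2 * p))))
      ≤ n * (4 * H * v - 6 * τ₂ + k * m * τ₁) * Q
        - v * (n * H * ((18 * k - 12) * κ * m ^ 2 / 3 + 2 * k * Q)) := by
  have hb : 0 ≤ 1 - 3 * α := by linarith
  have hθ : 0 < -H := by linarith
  -- The square of the comparison quantity is exactly `m²` times the bound in `hτ₁`, because `r²/p²
  -- = m²/3` and `y² = 8v`.
  have hτ : -(r * (1 - 3 * α) * (-H) * y / (2 * p)) ≤ m * τ₁ := by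
    refine (abs_le.1 (abs_le_of_sq_le_sq ?_ (by positivity))).1
    have h1 := mul_le_mul_of_nonneg_left hτ₁ (sq_nonneg m)
    have h2 : (r * (1 - 3 * α) * (-H) * y / (2 * p)) ^ 2
        = m ^ 2 * (2 / 3 * ((1 - 3 * α) * H) ^ 2 * v) := by
      have hq : q ≠ 0 := by rw [← hp2]; positivity
      rw [div_pow, mul_pow, mul_pow, mul_pow, mul_pow, hr2, hy2, hp2, hQ]
      field_simp; ring
    rw [mul_pow, h2]; exact h1
  have hy2' : y ^ 2 / 8 = v := by linarith
  have hQ0 : 0 < Q := by rw [← hr2]; positivity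
  have h2 : -(k * (r * (1 - 3 * α) * (-H) * y / (2 * p))) ≤ k * (m * τ₁) := by
    have := mul_le_mul_of_nonneg_left hτ hk; linarith
  have h3 : 0 ≤ (-H) * (v * (m ^ 2 / 3 * ((18 * k - 12) * κ + 2 * k * q))) := by positivity
  have h4 : Q * ((-H) * (-(2 + 2 * (1 - 3 * α)) * v - k * (r * (1 - 3 * α) * y / (2 * p))))
      ≤ Q * (-4 * (-H) * v - 6 * τ₂ + k * (m * τ₁)) := by
    refine mul_le_mul_of_nonneg_left ?_ hQ0.le
    have : (-H) * (k * (r * (1 - 3 * α) * y / (2 * p)))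
      = k * (r * (1 - 3 * α) * (-H) * y / (2 * p)) := by ring
    linarith
  have h5 := mul_le_mul_of_nonneg_left (add_le_add h3 h4) hn.le
  have e : n * (4 * H * v - 6 * τ₂ + k * m * τ₁) * Q
        - v * (n * H * ((18 * k - 12) * κ * m ^ 2 / 3 + 2 * k * Q))
      = n * ((-H) * (v * (m ^ 2 / 3 * ((18 * k - 12) * κ + 2 * k * q)))
        + Q * (-4 * (-H) * v - 6 * τ₂ + k * (m * τ₁))) := by
    rw [hQ]; ring
  rw [e, hr2, hy2']
  linarith

/-- The logarithmic growth `-nH` of `√g` multiplies `s + s_crit`. After the lower bound for the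
derivative of `s`, the term with `k` is absorbed by the second summand of `s_crit`, and the rest is
`critical_polynomial_pos`. -/
theorem entropy_rate_pos {n H k m v α κ τ₁ τ₂ q Q Z : ℝ} (hn : 0 < n) (hH : H < 0) (hk : 0 ≤ k)
    (hm : m ≠ 0) (hv : 0 < v) (hα : α ∈ Set.Icc (0 : ℝ) (1 / 3))
    (hτ₁ : τ₁ ^ 2 ≤ 2 / 3 * ((1 - 3 * α) * H) ^ 2 * v) (hτ₂ : τ₂ ≤ α * H * v)
    (hκ : 0 ≤ (18 * k - 12) * κ + 2 * k * q) (hq : q = 9 * k ^ 2 - 12 * k + 8)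
    (hQ : Q = q * m ^ 2 / 3) (hZ : Z = 8 * v + Q) :
    0 < Real.sqrt (8 * v) / Real.sqrt Z / (2 * v * Z) *
        (n * (4 * H * v - 6 * τ₂ + k * m * τ₁) * Q
          - v * (n * H * ((18 * k - 12) * κ * m ^ 2 / 3 + 2 * k * Q)))
      - n * H * (Real.sqrt (8 * v) / Real.sqrt Z + sCrit k α) := by
  have hq0 : 0 < q := hq ▸ discr_pos k
  have hm2 : 0 < m ^ 2 := by positivity
  have hQ0 : 0 < Q := by rw [hQ]; positivity
  have hZ0 : 0 < Z := by rw [hZ]; positivity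
  have hy0 : 0 < Real.sqrt (8 * v) := Real.sqrt_pos.2 (by positivity)
  have hy2 : Real.sqrt (8 * v) ^ 2 = 8 * v := Real.sq_sqrt (by positivity)
  have hz0 := Real.sqrt_pos.2 hZ0
  have hz2 := Real.sq_sqrt hZ0.le
  have hp0 := Real.sqrt_pos.2 hq0
  have hp2 := Real.sq_sqrt hq0.le
  have hr0 := Real.sqrt_pos.2 hQ0
  have hr2 := Real.sq_sqrt hQ0.le
  rw [sCrit_eq hα.2, ← hq]
  generalize Real.sqrt (8 * v) = y at *
  generalize Real.sqrt Z = z at *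
  generalize Real.sqrt q = p at *
  generalize Real.sqrt Q = r at *
  have hlow := ratio_numerator_bound hn hH hk hv hα.2 hτ₁ hτ₂ hκ hQ hp0 hp2 hr0 hr2 hy0 hy2
  have hb0 : 0 ≤ 1 - 3 * α := by linarith [hα.2]
  have hb1 : 1 - 3 * α ≤ 1 := by linarith [hα.1]
  generalize 1 - 3 * α = b at *
  have hθ : 0 < -H := by linarith
  have hrz : r ^ 2 = z ^ 2 - y ^ 2 := by linarith
  have hrz1 : r / z ≤ 1 := by
    rw [div_le_one hz0]
    exact (sq_le_sq₀ hr0.le hz0.le).1 (by nlinarith)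
  have hs1 : y / z ≤ 1 := by
    rw [div_le_one hz0]
    exact (sq_le_sq₀ hy0.le hz0.le).1 (by nlinarith)
  have hcoef : 0 ≤ y / z / (2 * v * Z) := by positivity
  have hσ := mul_le_mul_of_nonneg_left hlow hcoef
  have e := ratio_deriv_lower_bound_eq (x := n * (-H)) (b := b) (k := k) hp0.ne' hy0.ne' hz0.ne' hrz
  rw [show y ^ 2 / 8 = v by linarith, hz2] at e
  rw [show y ^ 2 / 8 = v by linarith, ← e] at hσ
  have hpoly := critical_polynomial_pos (div_pos hy0 hz0) hs1 (Real.sqrt_nonneg b)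
    (Real.sqrt_le_one.2 hb1)
  rw [Real.sq_sqrt hb0] at hpoly
  have hcube : 2 * b * (k / p) * (r / z) ^ 3 ≤ 2 * b * (k / p) :=
    mul_le_of_le_one_right (by positivity) (pow_le_one₀ (by positivity) hrz1)
  have hfin : 0 < n * (-H) * ((-(1 + b) * (1 - (y / z) ^ 2) * (y / z)
      - 2 * b * (k / p) * (r / z) ^ 3)
      + (y / z + (Real.sqrt 2 / 4 * Real.sqrt b + 2 * b * (k / p)))) :=
    mul_pos (mul_pos hn hθ) (by linarith)
  linarith

/-- The scalar quantities of a perfect fluid electric region along a time line: lapse `n`, density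
`m`, parameters `k`, `α` with rates `κ`, `β`, mean curvature `H`, `v = tr X²`, `τ₁ = tr (h X)` and
`τ₂ = tr (h X²)` for the electric part `X` of the Weyl tensor, and volume density `D`. -/
structure EntropyData (J : Set ℝ) (n m k α κ β H v τ₁ τ₂ D : ℝ → ℝ) : Prop where
  isOpen : IsOpen J
  n_pos : ∀ t ∈ J, 0 < n t
  D_pos : ∀ t ∈ J, 0 < D t
  D_deriv : ∀ t ∈ J, HasDerivAt D (-(n t * H t) * D t) t
  m_deriv : ∀ t ∈ J, HasDerivAt m (n t * (k t * m t * H t)) t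
  v_deriv : ∀ t ∈ J, HasDerivAt v (n t * (4 * H t * v t - 6 * τ₂ t + k t * m t * τ₁ t)) t
  v_nonneg : ∀ t ∈ J, 0 ≤ v t
  v_zero : ∀ t ∈ J, v t = 0 → ∃ w : ℝ, 0 ≤ w ∧
    w ^ 2 ≤ (n t * k t * m t / 2) ^ 2 * (2 / 3 * ((1 - 3 * α t) * H t) ^ 2) ∧
    HasDerivWithinAt (fun s => Real.sqrt (v s)) w (Set.Ici t) t ∧
    HasDerivWithinAt (fun s => Real.sqrt (v s)) (-w) (Set.Iic t) t
  τ₂_le : ∀ t ∈ J, τ₂ t ≤ α t * H t * v t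
  τ₁_le : ∀ t ∈ J, τ₁ t ^ 2 ≤ 2 / 3 * ((1 - 3 * α t) * H t) ^ 2 * v t
  τ₂_zero : ∀ t ∈ J, H t = 0 → τ₂ t = 0
  H_nonpos : ∀ t ∈ J, H t ≤ 0
  nH_cont : ContinuousOn (fun t => n t * H t) J
  k_mem : ∀ t ∈ J, k t ∈ Set.Icc (0 : ℝ) (4 / 3)
  α_mem : ∀ t ∈ J, α t ∈ Set.Icc (0 : ℝ) (1 / 3)
  α_contDiff : ContDiffOn ℝ 2 α J
  k_deriv : ∀ t ∈ J, HasDerivAt k (n t * (κ t * H t)) t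
  α_deriv : ∀ t ∈ J, HasDerivAt α (n t * (β t * H t)) t
  κ_nonneg : ∀ t ∈ J, 0 ≤ κ t
  β_nonneg : ∀ t ∈ J, 0 ≤ β t
  κ_le : ∀ t ∈ J, 3 * (4 - 3 * k t) * κ t ≤ k t * (9 * k t ^ 2 - 12 * k t + 8)
  κ_le_rate : ∀ t ∈ J, α t ≠ 1 / 3 → 3 * (4 - 3 * k t) * κ t ≤
    k t * (9 * k t ^ 2 - 12 * k t + 8) * (9 * β t / (4 * (1 - 3 * α t)))

/-! ### Derivatives of the critical density and of the ratio along a time line -/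

namespace EntropyData

variable {J : Set ℝ} {n m k α κ β H v τ₁ τ₂ D : ℝ → ℝ}
  (h : EntropyData J n m k α κ β H v τ₁ τ₂ D) {t : ℝ} (ht : t ∈ J)
include h ht

/-- `1 - 3α` grows in time because `β ≥ 0 ≥ H`, while `k/√q`, with derivative `(8 - 6k)/q^{3/2}` in
`k`, decreases. The rate condition on `κ` makes the product `(1 - 3α) k/√q` nondecreasing all the
same. -/
theorem sCrit_deriv : ∃ c, 0 ≤ c ∧ HasDerivAt (fun s => sCrit (k s) (α s)) c t := by
  set q := 9 * k t ^ 2 - 12 * k t + 8 with hq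
  have hq0 : 0 < q := discr_pos _
  have hk := h.k_mem t ht
  have hα := h.α_mem t ht
  have hn := h.n_pos t ht
  have hH := h.H_nonpos t ht
  have hb0 : 0 ≤ 1 - 3 * α t := by linarith [hα.2]
  have hfd : HasDerivAt (fun s => 1 - 3 * α s) (-3 * (n t * (β t * H t))) t := by
    exact (((h.α_deriv t ht).const_mul 3).const_sub 1).congr_deriv (by ring)
  have hqd : HasDerivAt (fun s => Real.sqrt (9 * k s ^ 2 - 12 * k s + 8))
      ((18 * k t - 12) * (n t * (κ t * H t)) / (2 * Real.sqrt q)) t := by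
    have h1 := ((((h.k_deriv t ht).fun_pow 2).const_mul 9).fun_sub
      ((h.k_deriv t ht).const_mul 12)).add_const 8
    refine (h1.sqrt hq0.ne').congr_deriv ?_
    push_cast; ring
  have hsq := Real.sqrt_pos.2 hq0
  have hGd := (h.k_deriv t ht).fun_div hqd hsq.ne'
  have hGd' : HasDerivAt (fun s => k s / Real.sqrt (9 * k s ^ 2 - 12 * k s + 8))
      (n t * (κ t * H t) * (8 - 6 * k t) / (q * Real.sqrt q)) t := by
    refine hGd.congr_deriv ?_
    rw [← hq]
    have : Real.sqrt q ^ 2 = q := Real.sq_sqrt hq0.le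
    rw [div_eq_div_iff (by positivity) (by positivity)]
    field_simp
    rw [this, hq]; ring
  have hprod := (hfd.const_mul 2).fun_mul hGd'
  have hev : ∀ c, HasDerivAt (fun s => Real.sqrt (1 - 3 * α s)) c t →
      HasDerivAt (fun s => sCrit (k s) (α s)) (Real.sqrt 2 / 4 * c
        + (2 * (-3 * (n t * (β t * H t))) * (k t / Real.sqrt q)
        + 2 * (1 - 3 * α t) * (n t * (κ t * H t) * (8 - 6 * k t) / (q * Real.sqrt q)))) t := by
    intro c hc
    refine ((hc.const_mul _).add hprod).congr_of_eventuallyEq ?_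
    filter_upwards [h.isOpen.mem_nhds ht] with s hs
    exact sCrit_eq (h.α_mem s hs).2
  have hβ := h.β_nonneg t ht
  have hrate : 0 ≤ 2 * (-3 * (n t * (β t * H t))) * (k t / Real.sqrt q)
        + 2 * (1 - 3 * α t) * (n t * (κ t * H t) * (8 - 6 * k t) / (q * Real.sqrt q)) := by
    -- The rate condition yields this even with `3/2` in place of `3`.
    have key : (1 - 3 * α t) * κ t * (8 - 6 * k t) ≤ 3 * β t * k t * q := by
      rcases eq_or_ne (α t) (1 / 3) with h1 | h1
      · rw [h1]; norm_num; have := hk.1; positivity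
      · have hb : 0 < 1 - 3 * α t := lt_of_le_of_ne hb0 fun h2 => h1 (by linarith)
        have h2 := h.κ_le_rate t ht h1
        rw [← hq, mul_div_assoc', le_div_iff₀ (by positivity)] at h2
        have h3 : 0 ≤ k t * q * β t := by have := hk.1; positivity
        nlinarith
    have e : 2 * (-3 * (n t * (β t * H t))) * (k t / Real.sqrt q)
        + 2 * (1 - 3 * α t) * (n t * (κ t * H t) * (8 - 6 * k t) / (q * Real.sqrt q))
        = 2 * (n t * (-H t)) * (3 * β t * k t * q - (1 - 3 * α t) * κ t * (8 - 6 * k t))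
          / (q * Real.sqrt q) := by
      field_simp; ring
    rw [e]
    have : 0 ≤ -H t := by linarith
    have := sub_nonneg.2 key
    positivity
  have hbd : 0 ≤ -3 * (n t * (β t * H t)) := by
    have := mul_nonneg hn.le (mul_nonneg hβ (neg_nonneg.2 hH)); linarith
  -- Where `α = 1/3` the chain rule for the square root fails; monotonicity and the `C²` regularity
  -- of `α` give derivative zero there.
  rcases hb0.eq_or_lt with hb | hb
  · refine ⟨_, ?_, hev 0 ?_⟩
    · linarith
    · refine hasDerivAt_sqrt_of_monotone h.isOpen
        (contDiffOn_const.sub (contDiffOn_const.mul h.α_contDiff)) (fun s hs => ?_)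
        (fun s hs => by linarith [(h.α_mem s hs).2]) ht hb.symm
      have h1 := ((h.α_deriv s hs).const_mul 3).const_sub 1
      rw [h1.deriv]
      have := mul_nonneg (h.n_pos s hs).le
        (mul_nonneg (h.β_nonneg s hs) (neg_nonneg.2 (h.H_nonpos s hs)))
      linarith
  · refine ⟨_, ?_, hev _ (hfd.sqrt hb.ne')⟩
    have : 0 ≤ Real.sqrt 2 / 4 *
      (-3 * (n t * (β t * H t)) / (2 * Real.sqrt (1 - 3 * α t))) := by positivity
    linarith

-- Energy conservation is linear in `m`, so a zero of `m` persists for nearby times and the ratio is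
-- locally the constant `1`.
omit ht in
theorem weylRatio_of_zero (ht : t ∈ J) (hm : m t = 0) :
    HasDerivAt (fun s => weylRatio (k s) (m s) (v s)) 0 t := by
  have hc : ContinuousAt (fun s => n s * H s * k s) t :=
    ((h.nH_cont.continuousAt (h.isOpen.mem_nhds ht))).mul (h.k_deriv t ht).continuousAt
  have h1 : ∀ᶠ s in nhds t, m s = 0 := by
    refine eventually_eq_zero_of_linear hc ?_ hm
    filter_upwards [h.isOpen.mem_nhds ht] with s hs
    exact (h.m_deriv s hs).congr_deriv (by ring)
  refine (hasDerivAt_const t (1 : ℝ)).congr_of_eventuallyEq ?_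
  filter_upwards [h1] with s hs
  simp [weylRatio, hs]

theorem sCrit_lower : Real.sqrt 2 / 4 * Real.sqrt (1 - 3 * α t)
    + 2 * (1 - 3 * α t) * (k t / Real.sqrt (9 * k t ^ 2 - 12 * k t + 8)) = sCrit (k t) (α t) ∧
    0 ≤ 2 * (1 - 3 * α t) * (k t / Real.sqrt (9 * k t ^ 2 - 12 * k t + 8)) := by
  refine ⟨(sCrit_eq (h.α_mem t ht).2).symm, ?_⟩
  have := (h.k_mem t ht).1
  have : 0 ≤ 1 - 3 * α t := by linarith [(h.α_mem t ht).2]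
  positivity

theorem sCrit_nonneg : 0 ≤ sCrit (k t) (α t) := by
  have h1 := h.sCrit_lower ht
  rw [← h1.1]
  have : 0 ≤ Real.sqrt 2 / 4 * Real.sqrt (1 - 3 * α t) := by positivity
  linarith [h1.2]

theorem sCrit_eq_zero (h0 : sCrit (k t) (α t) = 0) : α t = 1 / 3 := by
  have h1 := h.sCrit_lower ht
  have h2 : Real.sqrt 2 / 4 * Real.sqrt (1 - 3 * α t) ≤ 0 := by linarith [h1.2]
  have h3 : Real.sqrt (1 - 3 * α t) ≤ 0 := by
    by_contra! h4
    have : 0 < Real.sqrt 2 / 4 * Real.sqrt (1 - 3 * α t) := by positivity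
    linarith
  have h4 := Real.sqrt_eq_zero'.1 (le_antisymm h3 (Real.sqrt_nonneg _))
  linarith [(h.α_mem t ht).2]

/-- Where neither the density nor the Weyl tensor vanishes, the ratio is differentiable and the
decrease of `√g` times the ratio is dominated by the critical density. -/
theorem weylRatio_of_pos (hm : m t ≠ 0) (hv : 0 < v t) : ∃ σ : ℝ,
    HasDerivAt (fun s => weylRatio (k s) (m s) (v s)) σ t ∧ (H t = 0 → σ = 0) ∧
    (H t < 0 → 0 < σ - n t * H t * (weylRatio (k t) (m t) (v t) + sCrit (k t) (α t))) := by
  set q := 9 * k t ^ 2 - 12 * k t + 8 with hq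
  have hq0 : 0 < q := discr_pos _
  set Q := q * m t ^ 2 / 3 with hQ
  have hm2 : 0 < m t ^ 2 := by positivity
  have hQ0 : 0 < Q := by positivity
  set Z := 8 * v t + Q with hZ
  have hZ0 : 0 < Z := by positivity
  set y := Real.sqrt (8 * v t) with hy
  have hy0 : 0 < y := Real.sqrt_pos.2 (by positivity)
  have hy2 : y ^ 2 = 8 * v t := Real.sq_sqrt (by positivity)
  set z := Real.sqrt Z with hz
  have hz0 : 0 < z := Real.sqrt_pos.2 hZ0
  have hz2 : z ^ 2 = Z := Real.sq_sqrt hZ0.le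
  have hk := h.k_mem t ht
  have hn := h.n_pos t ht
  have hkd := h.k_deriv t ht
  have hvd := h.v_deriv t ht
  have hmd := h.m_deriv t ht
  set v' := n t * (4 * H t * v t - 6 * τ₂ t + k t * m t * τ₁ t) with hv'
  set Q' := n t * H t * ((18 * k t - 12) * κ t * m t ^ 2 / 3 + 2 * k t * Q) with hQ'
  have hQd : HasDerivAt (fun s => (9 * k s ^ 2 - 12 * k s + 8) * m s ^ 2 / 3) Q' t := by
    have h1 := ((((hkd.fun_pow 2).const_mul 9).fun_sub (hkd.const_mul 12)).add_const 8).fun_mul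
      (hmd.fun_pow 2)
    refine (h1.div_const 3).congr_deriv ?_
    rw [hQ', hQ, hq]; push_cast; ring
  have hZd : HasDerivAt (fun s => 8 * v s + (9 * k s ^ 2 - 12 * k s + 8) * m s ^ 2 / 3)
      (8 * v' + Q') t := (hvd.const_mul 8).fun_add hQd
  have hrd := ((hvd.const_mul 8).sqrt (by positivity)).fun_div (hZd.sqrt hZ0.ne') hz0.ne'
  set s := y / z with hs
  have hs0 : 0 < s := by positivity
  have hval : weylRatio (k t) (m t) (v t) = s := by rw [weylRatio, if_neg hm]
  have hσ : HasDerivAt (fun s => weylRatio (k s) (m s) (v s))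
      (s / (2 * v t * Z) * (v' * Q - v t * Q')) t := by
    have h1 : ∀ᶠ r in nhds t, m r ≠ 0 := hmd.continuousAt.eventually_ne hm
    refine (hrd.congr_of_eventuallyEq ?_).congr_deriv ?_
    · filter_upwards [h1] with r hr
      rw [weylRatio, if_neg hr]
    · change (8 * v' / (2 * y) * z - y * ((8 * v' + Q') / (2 * z))) / z ^ 2 = _
      rw [hs, ← hz2]
      have : v t = y ^ 2 / 8 := by linarith
      have hQz : Q = z ^ 2 - y ^ 2 := by linarith
      rw [hQz, this]
      field_simp
      ring
  refine ⟨_, hσ, fun hH => ?_, fun hH => ?_⟩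
  · have h1 : τ₁ t = 0 := by
      have := h.τ₁_le t ht; rw [hH] at this; nlinarith
    simp [hv', hQ', hH, h1, h.τ₂_zero t ht hH]
  · rw [hval]
    refine entropy_rate_pos hn hH hk.1 hm hv (h.α_mem t ht) (h.τ₁_le t ht) (h.τ₂_le t ht) ?_ hq
      hQ hZ
    -- It gives `2kq ≥ (24 - 18k)κ`, so the quantity in question is at least `12κ`.
    have := h.κ_le t ht
    rw [← hq] at this
    nlinarith [h.κ_nonneg t ht]

/-- At a zero of the Weyl tensor the ratio has opposite one-sided derivatives, whose size is
controlled by the critical density. -/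
theorem weylRatio_of_weyl_zero (hm : m t ≠ 0) (hv : v t = 0) : ∃ σ : ℝ, 0 ≤ σ ∧
    HasDerivWithinAt (fun s => weylRatio (k s) (m s) (v s)) σ (Set.Ici t) t ∧
    HasDerivWithinAt (fun s => weylRatio (k s) (m s) (v s)) (-σ) (Set.Iic t) t ∧
    ((1 - 3 * α t) * H t = 0 → σ = 0) ∧ weylRatio (k t) (m t) (v t) = 0 ∧
    σ ≤ -(n t * H t * sCrit (k t) (α t)) := by
  set q := 9 * k t ^ 2 - 12 * k t + 8 with hq
  have hq0 : 0 < q := discr_pos _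
  set p := Real.sqrt q with hp
  have hp0 : 0 < p := Real.sqrt_pos.2 hq0
  have hp2 : p ^ 2 = q := Real.sq_sqrt hq0.le
  obtain ⟨w, hw0, hw2, hwr, hwl⟩ := h.v_zero t ht hv
  have hm2 : 0 < m t ^ 2 := by positivity
  have hn := h.n_pos t ht
  have hk0 := (h.k_mem t ht).1
  have hH := h.H_nonpos t ht
  have hb0 : 0 ≤ 1 - 3 * α t := by linarith [(h.α_mem t ht).2]
  set Z := 8 * v t + q * m t ^ 2 / 3 with hZ
  have hZ' : Z = q * m t ^ 2 / 3 := by rw [hZ, hv]; ring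
  have hZ0 : 0 < Z := by rw [hZ']; positivity
  set z := Real.sqrt Z with hz
  have hz0 : 0 < z := Real.sqrt_pos.2 hZ0
  have hz2 : z ^ 2 = Z := Real.sq_sqrt hZ0.le
  have hkd := h.k_deriv t ht
  have hmd := h.m_deriv t ht
  have hZd : DifferentiableAt ℝ (fun s => Real.sqrt
      (8 * v s + (9 * k s ^ 2 - 12 * k s + 8) * m s ^ 2 / 3)) t := by
    have h1 := ((((hkd.fun_pow 2).const_mul 9).fun_sub (hkd.const_mul 12)).add_const 8).fun_mul
      (hmd.fun_pow 2)
    exact ((((h.v_deriv t ht).const_mul 8).fun_add (h1.div_const 3)).sqrt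
      hZ0.ne').differentiableAt
  have hone : ∀ (u : ℝ) (S : Set ℝ), HasDerivWithinAt (fun s => Real.sqrt (v s)) u S t →
      HasDerivWithinAt (fun s => weylRatio (k s) (m s) (v s)) (Real.sqrt 8 * u / z) S t := by
    intro u S hu
    have h1 := (hu.const_mul (Real.sqrt 8)).fun_div hZd.hasDerivAt.hasDerivWithinAt hz0.ne'
    have h2 : ∀ᶠ r in nhds t, m r ≠ 0 := hmd.continuousAt.eventually_ne hm
    refine (h1.congr_of_eventuallyEq ?_ ?_).congr_deriv ?_
    · filter_upwards [mem_nhdsWithin_of_mem_nhds h2] with r hr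
      rw [weylRatio, if_neg hr, Real.sqrt_mul (by norm_num)]
    · rw [weylRatio, if_neg hm, Real.sqrt_mul (by norm_num)]
    · rw [show Real.sqrt (v t) = 0 by rw [hv, Real.sqrt_zero]]
      change (Real.sqrt 8 * u * z - _) / z ^ 2 = _
      field_simp
      ring
  have hbound : Real.sqrt 8 * w / z ≤
      n t * (-((1 - 3 * α t) * H t)) * (2 * (k t / p)) := by
    have hb : 0 ≤ -((1 - 3 * α t) * H t) := by
      rw [← mul_neg]; exact mul_nonneg hb0 (neg_nonneg.2 hH)
    refine (sq_le_sq₀ (by positivity) (by positivity)).1 ?_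
    have e1 : (Real.sqrt 8 * w / z) ^ 2 = 8 * w ^ 2 / (q * m t ^ 2 / 3) := by
      rw [div_pow, mul_pow, Real.sq_sqrt (by norm_num), hz2, hZ']
    rw [e1, div_le_iff₀ (by positivity)]
    -- An equality: the constant `2` in the second summand of `s_crit` is exactly the bound for the
    -- slope at a zero of the Weyl tensor.
    have e2 : (n t * (-((1 - 3 * α t) * H t)) * (2 * (k t / p))) ^ 2 * (q * m t ^ 2 / 3)
        = 8 * ((n t * k t * m t / 2) ^ 2 * (2 / 3 * ((1 - 3 * α t) * H t) ^ 2)) := by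
      rw [← hp2]; field_simp; ring
    rw [e2]; linarith
  refine ⟨Real.sqrt 8 * w / z, by positivity, hone w _ hwr, ?_, fun h0 => ?_, ?_, ?_⟩
  · exact (hone (-w) _ hwl).congr_deriv (by ring)
  · rw [h0] at hbound
    exact le_antisymm (by simpa using hbound) (by positivity)
  · rw [weylRatio, if_neg hm, hv]; simp
  · refine hbound.trans ?_
    have hc := h.sCrit_lower ht
    have h1 : 2 * (1 - 3 * α t) * (k t / p) ≤ sCrit (k t) (α t) := by
      rw [← hc.1]
      have : 0 ≤ Real.sqrt 2 / 4 * Real.sqrt (1 - 3 * α t) := by positivity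
      linarith
    have h2 := mul_le_mul_of_nonneg_left h1 (mul_nonneg hn.le (neg_nonneg.2 hH))
    linarith

/-- The entropy along the time line. -/
abbrev entropy (k m α v D : ℝ → ℝ) (s : ℝ) : ℝ :=
  (weylRatio (k s) (m s) (v s) + sCrit (k s) (α s)) * D s

/-- `σ₁` and `σ₂` are the right and left derivatives of the ratio, and `c` is the derivative of
`s_crit`. The cases `m = 0`, `m ≠ 0 = v` and `m ≠ 0 < v` are gathered in one statement, whose last
four clauses serve differentiability and the equality case. -/
theorem entropy_deriv : ∃ c σ₁ σ₂ : ℝ, 0 ≤ c ∧ HasDerivAt (fun s => sCrit (k s) (α s)) c t ∧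
    HasDerivWithinAt (entropy k m α v D) (D t * (c + (σ₁ - n t * H t *
      (weylRatio (k t) (m t) (v t) + sCrit (k t) (α t))))) (Set.Ici t) t ∧
    HasDerivWithinAt (entropy k m α v D) (D t * (c + (σ₂ - n t * H t *
      (weylRatio (k t) (m t) (v t) + sCrit (k t) (α t))))) (Set.Iic t) t ∧
    0 ≤ σ₁ - n t * H t * (weylRatio (k t) (m t) (v t) + sCrit (k t) (α t)) ∧
    0 ≤ σ₂ - n t * H t * (weylRatio (k t) (m t) (v t) + sCrit (k t) (α t)) ∧
    (m t = 0 ∨ v t ≠ 0 → σ₁ = σ₂ ∧ (H t < 0 →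
      0 < σ₁ - n t * H t * (weylRatio (k t) (m t) (v t) + sCrit (k t) (α t)))) ∧
    (m t ≠ 0 → v t = 0 → σ₂ = -σ₁ ∧ weylRatio (k t) (m t) (v t) = 0) ∧
    (H t = 0 → σ₁ = 0 ∧ σ₂ = 0) ∧
    (m t ≠ 0 → v t = 0 → α t = 1 / 3 → σ₁ = 0 ∧ σ₂ = 0) := by
  obtain ⟨c, hc0, hc⟩ := h.sCrit_deriv ht
  have hn := h.n_pos t ht
  have hH := h.H_nonpos t ht
  have hs := h.sCrit_nonneg ht
  have hD : ∀ (σ : ℝ) (S : Set ℝ), HasDerivWithinAt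
      (fun s => weylRatio (k s) (m s) (v s)) σ S t →
      HasDerivWithinAt (entropy k m α v D) (D t * (c + (σ - n t * H t *
      (weylRatio (k t) (m t) (v t) + sCrit (k t) (α t))))) S t := fun σ S hσ =>
    ((hσ.add hc.hasDerivWithinAt).fun_mul (h.D_deriv t ht).hasDerivWithinAt).congr_deriv (by
      simp only [Pi.add_apply]; ring)
  by_cases hm : m t = 0
  · have h1 := h.weylRatio_of_zero ht hm
    have h2 : weylRatio (k t) (m t) (v t) = 1 := by rw [weylRatio, if_pos hm]
    have h3 : 0 ≤ 0 - n t * H t * (1 + sCrit (k t) (α t)) := by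
      have := mul_nonneg (mul_nonneg hn.le (neg_nonneg.2 hH)) (add_nonneg zero_le_one hs)
      linarith
    refine ⟨c, 0, 0, hc0, hc, hD _ _ h1.hasDerivWithinAt, hD _ _ h1.hasDerivWithinAt, ?_, ?_,
      fun _ => ⟨rfl, fun hH' => ?_⟩, fun h4 => absurd hm h4, fun _ => ⟨rfl, rfl⟩,
      fun h4 => absurd hm h4⟩
    · rwa [h2]
    · rwa [h2]
    · rw [h2]
      have := mul_pos (mul_pos hn (neg_pos.2 hH')) (add_pos_of_pos_of_nonneg zero_lt_one hs)
      linarith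
  by_cases hv : v t = 0
  · obtain ⟨σ, hσ0, hr, hl, hz, hs0, hle⟩ := h.weylRatio_of_weyl_zero ht hm hv
    have h1 : 0 ≤ -σ - n t * H t * (weylRatio (k t) (m t) (v t) + sCrit (k t) (α t)) := by
      rw [hs0, zero_add]; linarith
    refine ⟨c, σ, -σ, hc0, hc, hD _ _ hr, hD _ _ hl, by linarith, h1, fun h4 => ?_,
      fun _ _ => ⟨rfl, hs0⟩, fun h4 => ?_, fun _ _ h4 => ?_⟩
    · exact absurd h4 (by tauto)
    · have := hz (by rw [h4, mul_zero]); simp [this]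
    · have := hz (by rw [h4]; norm_num); simp [this]
  · obtain ⟨σ, hσ, hz, hpos⟩ := h.weylRatio_of_pos ht hm
      (lt_of_le_of_ne (h.v_nonneg t ht) (Ne.symm hv))
    have h1 : 0 ≤ σ - n t * H t * (weylRatio (k t) (m t) (v t) + sCrit (k t) (α t)) := by
      rcases hH.eq_or_lt with h2 | h2
      · rw [hz h2, h2]; simp
      · exact (hpos h2).le
    exact ⟨c, σ, σ, hc0, hc, hD _ _ hσ.hasDerivWithinAt, hD _ _ hσ.hasDerivWithinAt, h1, h1,
      fun _ => ⟨rfl, hpos⟩, fun _ h4 => absurd h4 hv, fun h4 => ⟨hz h4, hz h4⟩,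
      fun _ h4 => absurd h4 hv⟩

end EntropyData

/-! ### Linear algebra of the expansion condition -/

section PositiveMatrices

variable {Q X : Matrix (Fin 3) (Fin 3) ℝ}

/-- The 2 × 2 principal minors give `Q_ij Q_ji ≤ Q_ii Q_jj`; sum over `i` and `j`. -/
theorem trace_mul_self_le (hQ : Q.PosSemidef) : (Q * Q).trace ≤ Q.trace ^ 2 := by
  have hm : ∀ i j, Q i j * Q j i ≤ Q i i * Q j j := by
    intro i j
    have h := (hQ.submatrix ![i, j]).det_nonneg
    rw [Matrix.det_fin_two] at h
    simpa using h
  simp only [Matrix.trace, Matrix.diag_apply, Matrix.mul_apply, sq, Finset.sum_mul_sum]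
  exact Finset.sum_le_sum fun i _ => Finset.sum_le_sum fun j _ => hm i j

theorem trace_traceless_sq (A : Matrix (Fin 3) (Fin 3) ℝ) :
    ((A - (A.trace / 3) • 1) * (A - (A.trace / 3) • 1)).trace
      = (A * A).trace - A.trace ^ 2 / 3 := by
  simp only [Matrix.sub_mul, Matrix.mul_sub, Matrix.smul_mul, Matrix.mul_smul, Matrix.one_mul,
    Matrix.mul_one, Matrix.trace_sub, Matrix.trace_smul, Matrix.trace_one, smul_eq_mul,
    Fintype.card_fin]
  push_cast; ring

theorem trace_mul_sq_le {A B : Matrix (Fin 3) (Fin 3) ℝ} (hA : Aᵀ = A) (hB : Bᵀ = B) :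
    (A * B).trace ^ 2 ≤ (A * A).trace * (B * B).trace := by
  have h1 : (A * B).trace = ∑ p : Fin 3 × Fin 3, A p.1 p.2 * B p.1 p.2 := by
    rw [Fintype.sum_prod_type]
    simp only [Matrix.trace, Matrix.diag_apply, Matrix.mul_apply]
    refine Finset.sum_congr rfl fun i _ => Finset.sum_congr rfl fun j _ => ?_
    rw [← congrFun (congrFun hB i) j, Matrix.transpose_apply]
  rw [h1, ← sum_sq_eq_trace hA, ← sum_sq_eq_trace hB, ← Fintype.sum_prod_type',
    ← Fintype.sum_prod_type']
  exact Finset.sum_mul_sq_le_sq_mul_sq _ _ _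

/-- Only the traceless part of `Q` pairs with `X`, and its squared norm is `tr Q² - (tr Q)²/3 ≤
(2/3)(tr Q)²`. Then apply Cauchy–Schwarz. -/
theorem trace_mul_traceless_sq_le (hQ : Q.PosSemidef) (hX : Xᵀ = X) (h0 : X.trace = 0) :
    (Q * X).trace ^ 2 ≤ 2 / 3 * Q.trace ^ 2 * (X * X).trace := by
  have hQt : Qᵀ = Q := hQ.isHermitian
  have h1 : (Q * X).trace = ((Q - (Q.trace / 3) • 1) * X).trace := by
    simp [Matrix.sub_mul, h0]
  have h2 := trace_mul_sq_le (A := Q - (Q.trace / 3) • 1) (B := X) (by simp [hQt]) hX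
  rw [h1]
  refine h2.trans (mul_le_mul_of_nonneg_right ?_ ?_)
  · rw [trace_traceless_sq]; linarith [trace_mul_self_le hQ]
  · rw [← sum_sq_eq_trace hX]; positivity

theorem trace_mul_mul_self_nonneg (hQ : Q.PosSemidef) (hX : Xᵀ = X) :
    0 ≤ (Q * (X * X)).trace := by
  have h := (hQ.conjTranspose_mul_mul_same X).trace_nonneg
  rw [Matrix.conjTranspose_eq_transpose_of_trivial, hX, Matrix.mul_assoc,
    Matrix.trace_mul_comm, Matrix.mul_assoc] at h
  exact h

/-- The consequences of `h ≤ α H g ≤ 0` for `K = g⁻¹ h` and a traceless symmetric `X = g⁻¹ E`. -/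
theorem expansion_bounds {g h E : Matrix (Fin 3) (Fin 3) ℝ} (hg : g.PosDef) (hh : hᵀ = h)
    (hE : Eᵀ = E) (hE0 : (g⁻¹ * E).trace = 0) {α : ℝ}
    (hexp : ∀ w : Fin 3 → ℝ, w ⬝ᵥ (h *ᵥ w) ≤ α * (g⁻¹ * h).trace * (w ⬝ᵥ (g *ᵥ w)) ∧
      α * (g⁻¹ * h).trace * (w ⬝ᵥ (g *ᵥ w)) ≤ 0) :
    (g⁻¹ * h).trace ≤ 0 ∧
    ((g⁻¹ * h) * ((g⁻¹ * E) * (g⁻¹ * E))).trace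
      ≤ α * (g⁻¹ * h).trace * ((g⁻¹ * E) * (g⁻¹ * E)).trace ∧
    ((g⁻¹ * h) * (g⁻¹ * E)).trace ^ 2
      ≤ 2 / 3 * ((1 - 3 * α) * (g⁻¹ * h).trace) ^ 2 * ((g⁻¹ * E) * (g⁻¹ * E)).trace ∧
    ((g⁻¹ * h - ((g⁻¹ * h).trace / 3) • 1) * (g⁻¹ * h - ((g⁻¹ * h).trace / 3) • 1)).trace
      ≤ 2 / 3 * ((1 - 3 * α) * (g⁻¹ * h).trace) ^ 2 ∧
    ((g⁻¹ * h).trace = 0 → h = 0) ∧ 0 ≤ ((g⁻¹ * E) * (g⁻¹ * E)).trace ∧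
    (((g⁻¹ * E) * (g⁻¹ * E)).trace = 0 → E = 0) := by
  obtain ⟨L, M, h1, h2, h3, h4⟩ := exists_frame hg
  have hMt : Mᵀ * Lᵀ = 1 := by rw [← Matrix.transpose_mul, h2, Matrix.transpose_one]
  have hLt : Lᵀ * Mᵀ = 1 := by rw [← Matrix.transpose_mul, h3, Matrix.transpose_one]
  set H := (g⁻¹ * h).trace with hH
  set Y := Lᵀ * E * L with hY
  -- In an orthonormal frame the expansion condition says that this matrix is positive semidefinite.
  -- All the bounds follow from that and from its trace.
  set Q := (α * H) • (1 : Matrix (Fin 3) (Fin 3) ℝ) - Lᵀ * h * L with hQ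
  have hYt : Yᵀ = Y := by simp [hY, Matrix.transpose_mul, hE, Matrix.mul_assoc]
  have conj : ∀ A : Matrix (Fin 3) (Fin 3) ℝ, g⁻¹ * A = L * (Lᵀ * A * L) * M := fun A => by
    simp only [h4, Matrix.mul_assoc, h2, Matrix.mul_one]
  have cancel : ∀ A : Matrix (Fin 3) (Fin 3) ℝ, M * (L * A) = A := fun A => by
    rw [← Matrix.mul_assoc, h3, Matrix.one_mul]
  have trc : ∀ A : Matrix (Fin 3) (Fin 3) ℝ, (L * A * M).trace = A.trace := fun A => by
    rw [Matrix.trace_mul_comm, cancel]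
  have zero_of : ∀ A : Matrix (Fin 3) (Fin 3) ℝ, Lᵀ * A * L = 0 → A = 0 := fun A hA => by
    have : Mᵀ * (Lᵀ * A * L) * M = A := by
      rw [Matrix.mul_assoc, Matrix.mul_assoc, h2, Matrix.mul_one, ← Matrix.mul_assoc, hMt,
        Matrix.one_mul]
    rw [← this, hA]; simp
  have hK : Lᵀ * h * L = (α * H) • 1 - Q := by rw [hQ]; simp
  have hHt : (Lᵀ * h * L).trace = H := by rw [hH, conj, trc]
  have hQtr : Q.trace = -((1 - 3 * α) * H) := by
    rw [hQ, Matrix.trace_sub, hHt, Matrix.trace_smul, Matrix.trace_one]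
    simp; ring
  have hQp : Q.PosSemidef := by
    refine Matrix.PosSemidef.of_dotProduct_mulVec_nonneg ?_ fun w => ?_
    · change Qᴴ = Q
      rw [Matrix.conjTranspose_eq_transpose_of_trivial, hQ]
      simp [Matrix.transpose_mul, hh, Matrix.mul_assoc]
    · have e : ∀ A : Matrix (Fin 3) (Fin 3) ℝ,
          w ⬝ᵥ ((Lᵀ * A * L) *ᵥ w) = (L *ᵥ w) ⬝ᵥ (A *ᵥ (L *ᵥ w)) := fun A => by
        rw [← Matrix.mulVec_mulVec, ← Matrix.mulVec_mulVec, Matrix.dotProduct_mulVec,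
          Matrix.vecMul_transpose]
      have h5 := (hexp (L *ᵥ w)).1
      rw [← e, ← e, h1, Matrix.one_mulVec] at h5
      rw [star_trivial, hQ, Matrix.sub_mulVec, dotProduct_sub, Matrix.smul_mulVec,
        Matrix.one_mulVec, dotProduct_smul, smul_eq_mul]
      linarith
  have hvv : ((g⁻¹ * E) * (g⁻¹ * E)).trace = (Y * Y).trace := by
    rw [conj, ← hY, show L * Y * M * (L * Y * M) = L * (Y * Y) * M by
      simp only [Matrix.mul_assoc, cancel], trc]
  have hY0 : Y.trace = 0 := by rw [← hE0, conj, trc]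
  have hKX : ((g⁻¹ * h) * (g⁻¹ * E)).trace = -(Q * Y).trace := by
    rw [conj, conj E, ← hY, show L * (Lᵀ * h * L) * M * (L * Y * M) = L * ((Lᵀ * h * L) * Y) * M by
      simp only [Matrix.mul_assoc, cancel], trc, hK, Matrix.sub_mul, Matrix.trace_sub]
    simp [hY0]
  have hKXX : ((g⁻¹ * h) * ((g⁻¹ * E) * (g⁻¹ * E))).trace
      = α * H * (Y * Y).trace - (Q * (Y * Y)).trace := by
    rw [conj, conj E, ← hY, show L * (Lᵀ * h * L) * M * (L * Y * M * (L * Y * M))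
      = L * ((Lᵀ * h * L) * (Y * Y)) * M by
      simp only [Matrix.mul_assoc, cancel], trc, hK, Matrix.sub_mul, Matrix.trace_sub]
    simp
  -- Both `αH ≤ 0`, tested on a unit vector, and `(1 - 3α)H = -tr Q ≤ 0` hold, and `H = (1 - 3α)H +
  -- 3αH`.
  have hHle : H ≤ 0 := by
    have h5 := (hexp (L *ᵥ ![1, 0, 0])).2
    have h6 : (L *ᵥ ![1, 0, 0]) ⬝ᵥ (g *ᵥ (L *ᵥ ![1, 0, 0])) = (1 : ℝ) := by
      rw [Matrix.mulVec_mulVec, Matrix.dotProduct_mulVec, ← Matrix.vecMul_transpose,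
        Matrix.vecMul_vecMul, ← Matrix.mul_assoc, h1, Matrix.vecMul_one]
      simp
    rw [h6, mul_one] at h5
    have h7 := hQp.trace_nonneg
    rw [hQtr] at h7
    nlinarith
  refine ⟨hHle, ?_, ?_, ?_, fun h0 => ?_, ?_, fun h0 => ?_⟩
  · rw [hKXX, hvv]; linarith [trace_mul_mul_self_nonneg hQp hYt]
  · rw [hKX, hvv, neg_sq, ← neg_sq ((1 - 3 * α) * H), ← hQtr]
    exact trace_mul_traceless_sq_le hQp hYt hY0
  · rw [hH, trace_traceless_sq, ← hH]
    have e : ((g⁻¹ * h) * (g⁻¹ * h)).trace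
        = (((α * H) • (1 : Matrix (Fin 3) (Fin 3) ℝ) - Q)
          * ((α * H) • (1 : Matrix (Fin 3) (Fin 3) ℝ) - Q)).trace := by
      rw [conj, ← hK, show L * (Lᵀ * h * L) * M * (L * (Lᵀ * h * L) * M)
        = L * ((Lᵀ * h * L) * (Lᵀ * h * L)) * M by simp only [Matrix.mul_assoc, cancel], trc]
    rw [e]
    simp only [Matrix.sub_mul, Matrix.mul_sub, Matrix.smul_mul, Matrix.mul_smul, Matrix.one_mul,
      Matrix.mul_one, Matrix.trace_sub, Matrix.trace_smul, Matrix.trace_one, smul_eq_mul,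
      Fintype.card_fin, hQtr]
    have h5 := trace_mul_self_le hQp
    rw [hQtr] at h5
    push_cast
    nlinarith
  · have h5 : Q = 0 := hQp.trace_eq_zero_iff.1 (by rw [hQtr, h0]; simp)
    refine zero_of h ?_
    rw [hK, h5, h0]; simp
  · rw [hvv, ← sum_sq_eq_trace hYt]; positivity
  · rw [hvv, ← sum_sq_eq_trace hYt] at h0
    refine zero_of E ?_
    ext i j
    have h5 := (Finset.sum_eq_zero_iff_of_nonneg fun i _ => by positivity).1 h0 i
      (Finset.mem_univ i)
    have h6 := (Finset.sum_eq_zero_iff_of_nonneg fun j _ => by positivity).1 h5 j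
      (Finset.mem_univ j)
    simpa using h6

end PositiveMatrices

/-! ### Differentiation of matrix curves and of their norms -/

section TimeDerivatives

variable {t : ℝ}

/-- The difference quotient at `t` is `W` itself, so continuity of `W` suffices. -/
theorem hasDerivAt_sub_mul {W : ℝ → ℝ} (hW : ContinuousAt W t) :
    HasDerivAt (fun s => (s - t) * W s) (W t) t := by
  rw [hasDerivAt_iff_tendsto_slope]
  refine (hW.tendsto.mono_left nhdsWithin_le_nhds).congr' ?_
  filter_upwards [self_mem_nhdsWithin] with s hs
  have : s - t ≠ 0 := sub_ne_zero.2 hs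
  simp [slope_def_field, this]

/-- The norm of a matrix-valued function has opposite one-sided derivatives at a zero. -/
theorem sqrt_trace_sq_one_sided {X : ℝ → Matrix (Fin 3) (Fin 3) ℝ} {X' : Matrix (Fin 3) (Fin 3) ℝ}
    (hX : ∀ i j, HasDerivAt (fun s => X s i j) (X' i j) t) (h0 : X t = 0) :
    HasDerivWithinAt (fun s => Real.sqrt (X s * X s).trace) (Real.sqrt (X' * X').trace)
      (Set.Ici t) t ∧
    HasDerivWithinAt (fun s => Real.sqrt (X s * X s).trace) (-Real.sqrt (X' * X').trace)
      (Set.Iic t) t := by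
  -- The divided difference factors `X(s) = (s - t) Y(s)` with `Y` continuous at `t`, hence the norm
  -- of `X` is `|s - t|` times that of `Y`.
  set Y : ℝ → Matrix (Fin 3) (Fin 3) ℝ := fun s => Matrix.of fun i j =>
    dslope (fun r => X r i j) t s with hY
  have hYc : ∀ i j, ContinuousAt (fun s => Y s i j) t := fun i j =>
    continuousAt_dslope_same.2 (hX i j).differentiableAt
  have hYt : Y t = X' := by
    ext i j; simp [hY, dslope_same, (hX i j).deriv]
  have hXY : ∀ s, X s = (s - t) • Y s := fun s => by
    ext i j
    have := sub_smul_dslope (fun r => X r i j) t s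
    simp only [h0, Matrix.zero_apply, sub_zero] at this
    simp only [Matrix.smul_apply, hY, Matrix.of_apply, this]
  have hW : ContinuousAt (fun s => Real.sqrt (Y s * Y s).trace) t := by
    refine ContinuousAt.sqrt ?_
    simp only [Matrix.trace, Matrix.diag_apply, Matrix.mul_apply]
    exact tendsto_finsetSum _ fun i _ => tendsto_finsetSum _ fun j _ => (hYc i j).mul (hYc j i)
  have hval : ∀ s, Real.sqrt (X s * X s).trace = |s - t| * Real.sqrt (Y s * Y s).trace := by
    intro s
    rw [hXY s, Matrix.smul_mul, Matrix.mul_smul, smul_smul, Matrix.trace_smul, smul_eq_mul,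
      Real.sqrt_mul (mul_self_nonneg _), Real.sqrt_mul_self_eq_abs]
  have hd := hasDerivAt_sub_mul hW
  rw [hYt] at hd
  refine ⟨hd.hasDerivWithinAt.congr (fun s hs => ?_) ?_,
    hd.neg.hasDerivWithinAt.congr (fun s hs => ?_) ?_⟩
  · rw [hval, abs_of_nonneg (sub_nonneg.2 hs)]
  · simp [hval]
  · rw [hval, abs_of_nonpos (sub_nonpos.2 hs)]; simp; ring
  · simp [hval]

theorem hasDerivAt_det {g : ℝ → Matrix (Fin 3) (Fin 3) ℝ} {g' : Matrix (Fin 3) (Fin 3) ℝ}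
    (hg : ∀ i j, HasDerivAt (fun s => g s i j) (g' i j) t) :
    HasDerivAt (fun s => (g s).det) ((g t).adjugate * g').trace t := by
  simp only [Matrix.det_fin_three]
  have h := ((((((hg 0 0).fun_mul (hg 1 1)).fun_mul (hg 2 2)).fun_sub
    (((hg 0 0).fun_mul (hg 1 2)).fun_mul (hg 2 1))).fun_sub
    (((hg 0 1).fun_mul (hg 1 0)).fun_mul (hg 2 2))).fun_add
    (((hg 0 1).fun_mul (hg 1 2)).fun_mul (hg 2 0))).fun_add
    (((hg 0 2).fun_mul (hg 1 0)).fun_mul (hg 2 1)) |>.fun_sub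
    (((hg 0 2).fun_mul (hg 1 1)).fun_mul (hg 2 0))
  refine h.congr_deriv ?_
  simp only [Matrix.trace, Matrix.diag_apply, Matrix.mul_apply, Fin.sum_univ_three,
    Matrix.adjugate_fin_three]
  simp
  ring

theorem hasDerivAt_trace_sq {X : ℝ → Matrix (Fin 3) (Fin 3) ℝ} {X' : Matrix (Fin 3) (Fin 3) ℝ}
    (hX : ∀ i j, HasDerivAt (fun s => X s i j) (X' i j) t) :
    HasDerivAt (fun s => (X s * X s).trace) (2 * (X t * X').trace) t := by
  simp only [Matrix.trace, Matrix.diag_apply, Matrix.mul_apply]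
  refine (HasDerivAt.fun_sum fun i _ => HasDerivAt.fun_sum fun j _ =>
    (hX i j).fun_mul (hX j i)).congr_deriv ?_
  simp only [Finset.sum_add_distrib, two_mul]
  congr 1
  rw [Finset.sum_comm]
  exact Finset.sum_congr rfl fun i _ => Finset.sum_congr rfl fun j _ => mul_comm _ _

end TimeDerivatives

/-! ### Perfect fluid regions along a time line -/

section

variable {Ω : Set (ℝ × E3)} {N : ℝ × E3 → ℝ} {g : ℝ × E3 → Matrix (Fin 3) (Fin 3) ℝ}
  {m k : ℝ × E3 → ℝ} {p : ℝ × E3}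

/-- The mixed components of the second fundamental form. -/
def shape (N : ℝ × E3 → ℝ) (g : ℝ × E3 → Matrix (Fin 3) (Fin 3) ℝ) (p : ℝ × E3) :
    Matrix (Fin 3) (Fin 3) ℝ := (g p)⁻¹ * secondForm N g p

/-- The mixed components of the electric part of the Weyl tensor. -/
def mixedWeyl (N : ℝ × E3 → ℝ) (g : ℝ × E3 → Matrix (Fin 3) (Fin 3) ℝ) (p : ℝ × E3) :
    Matrix (Fin 3) (Fin 3) ℝ := (g p)⁻¹ * electricPart (N p) (weyl (lorentz N g) p)

namespace FluidChart

variable (h : FluidChart Ω N g m k) (hp : p ∈ Ω)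
include h hp

theorem meanCurv_eq : meanCurv N g p = (shape N g p).trace := by
  simp only [meanCurv, shape, Matrix.trace, Matrix.diag_apply, Matrix.mul_apply]
  refine Finset.sum_congr rfl fun i _ => Finset.sum_congr rfl fun j _ => ?_
  rw [← congrFun (congrFun (h.secondForm_transpose hp) j) i, Matrix.transpose_apply]

theorem mixedWeyl_trace : (mixedWeyl N g p).trace = 0 := h.trace_electricWeyl hp

theorem mixedWeyl_eq_zero_iff : electricPart (N p) (weyl (lorentz N g) p) = 0
    ↔ mixedWeyl N g p = 0 := by
  constructor
  · intro h0; rw [mixedWeyl, h0, Matrix.mul_zero]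
  · intro h0
    have : g p * mixedWeyl N g p = electricPart (N p) (weyl (lorentz N g) p) := by
      rw [mixedWeyl, ← Matrix.mul_assoc, Matrix.mul_nonsing_inv _ (h.metric_det_ne hp).isUnit,
        Matrix.one_mul]
    rw [← this, h0, Matrix.mul_zero]

theorem mixedWeyl_sq : 0 ≤ (mixedWeyl N g p * mixedWeyl N g p).trace ∧
    ((mixedWeyl N g p * mixedWeyl N g p).trace = 0 → mixedWeyl N g p = 0) := by
  -- The trivial choice of `h` and `α` extracts the positive definiteness of `tr X²`.
  have h1 := expansion_bounds (h := 0) (α := 0) (h.metric_pos p hp) (by simp)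
    ((h.weyl_curvatureLike hp).electricPart_transpose (N p)) (h.trace_electricWeyl hp)
    (fun w => by simp)
  exact ⟨h1.2.2.2.2.2.1, fun h0 => (h.mixedWeyl_eq_zero_iff hp).1 (h1.2.2.2.2.2.2 h0)⟩

/-- The Weyl tensor is trace-free, so its spatial contraction equals its electric part; each of the
two contributes `4 tr X²`. -/
theorem tensorNorm_weyl : tensorNorm (riemannian N g p) (weyl (lorentz N g) p)
    = Real.sqrt (8 * (mixedWeyl N g p * mixedWeyl N g p).trace) := by
  rw [riemannian, (h.weyl_curvatureLike hp).tensorNorm_eq (h.electric p hp)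
    (h.lapse_pos p hp).ne' (h.metric_pos p hp), h.spatialRicci_weyl_eq hp]
  change Real.sqrt (4 * (mixedWeyl N g p * mixedWeyl N g p).trace
    + (4 * (mixedWeyl N g p * mixedWeyl N g p).trace - (mixedWeyl N g p).trace ^ 2)) = _
  rw [h.mixedWeyl_trace hp]
  congr 1; ring

theorem mixed_electricPart_riemann : (g p)⁻¹ * electricPart (N p) (riemann (lorentz N g) p)
    = mixedWeyl N g p + ((3 * k p - 2) / 6 * m p) • 1 := by
  rw [h.electricPart_riemann hp, Matrix.mul_add, Matrix.mul_smul,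
    Matrix.nonsing_inv_mul _ (h.metric_det_ne hp).isUnit, mixedWeyl]

/-- The multiples of the identity added to `X` contribute `(3k - 2)² m²/3` from the electric part
and `(16/3 - 4) m²` from the spatial part; hence `9k² - 12k + 8 = (3k - 2)² + 4`. -/
theorem tensorNorm_riemann : tensorNorm (riemannian N g p) (riemann (lorentz N g) p)
    = Real.sqrt (8 * (mixedWeyl N g p * mixedWeyl N g p).trace
      + (9 * k p ^ 2 - 12 * k p + 8) * m p ^ 2 / 3) := by
  have hX := h.mixedWeyl_trace hp
  rw [riemannian, (h.riemann_curvatureLike hp).tensorNorm_eq (h.riemann_electric hp)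
    (h.lapse_pos p hp).ne' (h.metric_pos p hp), h.mixedRicci_eq hp,
    h.mixed_electricPart_riemann hp]
  change Real.sqrt (4 * _ + (4 * ((mixedWeyl N g p + _) * (mixedWeyl N g p + _)).trace
    - (mixedWeyl N g p + _).trace ^ 2)) = _
  congr 1
  simp only [Matrix.add_mul, Matrix.mul_add, Matrix.smul_mul, Matrix.mul_smul, Matrix.one_mul,
    Matrix.mul_one, Matrix.trace_add, Matrix.trace_smul, Matrix.trace_one, smul_eq_mul,
    Fintype.card_fin, hX]
  push_cast; ring

theorem weyl_eq_zero_iff : weyl (lorentz N g) p = 0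
    ↔ (mixedWeyl N g p * mixedWeyl N g p).trace = 0 := by
  rw [(h.weyl_curvatureLike hp).eq_zero_iff (h.electric p hp) (h.lapse_pos p hp).ne'
    (h.metric_pos p hp), h.spatialRicci_weyl_eq hp, and_self, h.mixedWeyl_eq_zero_iff hp]
  exact ⟨fun h0 => by simp [h0], (h.mixedWeyl_sq hp).2⟩

theorem riemann_eq_zero_iff : riemann (lorentz N g) p = 0
    ↔ (mixedWeyl N g p * mixedWeyl N g p).trace = 0 ∧ m p = 0 := by
  rw [(h.riemann_curvatureLike hp).eq_zero_iff (h.riemann_electric hp) (h.lapse_pos p hp).ne'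
    (h.metric_pos p hp), h.spatialRicci_riemann hp, h.electricPart_riemann hp]
  constructor
  · rintro ⟨hA, hP⟩
    have hm : m p = 0 := by
      have h1 := h.density_eq hp
      rw [h.spatialRicci_riemann hp, hP] at h1
      simpa using h1
    rw [hm] at hA
    have h0 := (h.mixedWeyl_eq_zero_iff hp).1 (by simpa using hA)
    exact ⟨by simp [h0], hm⟩
  · rintro ⟨hv, hm⟩
    have h0 := (h.mixedWeyl_eq_zero_iff hp).2 ((h.mixedWeyl_sq hp).2 hv)
    simp [h0, hm]

/-- The conventions agree at `m = 0`: either the Riemann tensor vanishes and the density is `1` by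
definition, or `|W| = |R| ≠ 0`. -/
theorem entropyDensity_eq : entropyDensity N g p
    = weylRatio (k p) (m p) (mixedWeyl N g p * mixedWeyl N g p).trace := by
  rw [entropyDensity, h.tensorNorm_weyl hp, h.tensorNorm_riemann hp, weylRatio]
  by_cases hm : m p = 0
  · rw [if_pos hm]
    split_ifs with h0
    · rfl
    · rw [h.riemann_eq_zero_iff hp] at h0
      have h1 : 0 < (mixedWeyl N g p * mixedWeyl N g p).trace :=
        lt_of_le_of_ne (h.mixedWeyl_sq hp).1 fun h2 => h0 ⟨h2.symm, hm⟩
      rw [hm, zero_pow two_ne_zero, mul_zero, zero_div, add_zero]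
      exact div_self (Real.sqrt_pos.2 (by positivity)).ne'
  · rw [if_neg hm, if_neg fun h0 => hm ((h.riemann_eq_zero_iff hp).1 h0).2]

theorem mixedWeyl_deriv {t : ℝ} {y : E3} (hpt : p = (t, y)) (i j : Fin 3) :
    HasDerivAt (fun s => mixedWeyl N g (s, y) i j) ((N p •
      ((shape N g p * mixedWeyl N g p).trace • 1
        + (2 * (shape N g p).trace) • mixedWeyl N g p
        - (2 : ℝ) • (mixedWeyl N g p * shape N g p) - shape N g p * mixedWeyl N g p
        + (k p * m p / 2) • (shape N g p - ((shape N g p).trace / 3) • 1) :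
          Matrix (Fin 3) (Fin 3) ℝ)) i j) t := by
  have hs : MatSmooth Ω (mixedWeyl N g) := by
    have h1 : MatSmooth Ω fun q => (2 / 3 * m q) • (1 : Matrix (Fin 3) (Fin 3) ℝ) := fun i j =>
      (contDiffOn_const.mul h.density_smooth).mul contDiffOn_const
    refine (h.mixedRicci_smooth.sub h1).congr fun q hq => ?_
    simp only [h.mixedRicci_eq hq, mixedWeyl, add_sub_cancel_right]
  have h1 := congrFun (congrFun (h.pdM_electric hp) i) j
  subst hpt
  exact (hasDerivAt_time (hs.differentiableAt h.isOpen hp i j)).congr_deriv h1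

theorem density_deriv {t : ℝ} {y : E3} (hpt : p = (t, y)) :
    HasDerivAt (fun s => m (s, y)) (N p * (k p * m p * (shape N g p).trace)) t := by
  subst hpt
  exact (hasDerivAt_time (h.density_smooth.differentiableAt_of_isOpen h.isOpen hp)).congr_deriv
    (h.pd_density hp)

theorem sqrt_det_deriv {t : ℝ} {y : E3} (hpt : p = (t, y)) :
    HasDerivAt (fun s => Real.sqrt (g (s, y)).det)
      (-(N p * (shape N g p).trace) * Real.sqrt (g p).det) t := by
  subst hpt
  have hd := (h.metric_pos _ hp).det_pos
  have h1 : ∀ i j, HasDerivAt (fun s => g (s, y) i j)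
      ((-(2 * N (t, y)) • secondForm N g (t, y)) i j) t := fun i j =>
    (hasDerivAt_time (h.metric_smooth.differentiableAt h.isOpen hp i j)).congr_deriv
      (h.pd_time_metric hp i j)
  refine ((hasDerivAt_det h1).sqrt hd.ne').congr_deriv ?_
  have h2 : (g (t, y)).adjugate = (g (t, y)).det • (g (t, y))⁻¹ := by
    rw [Matrix.inv_def, smul_smul, Ring.mul_inverse_cancel _ hd.ne'.isUnit, one_smul]
  rw [h2, Matrix.mul_smul, Matrix.smul_mul, smul_smul, Matrix.trace_smul, smul_eq_mul]
  change _ * (shape N g (t, y)).trace / _ = _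
  have h3 := Real.sq_sqrt hd.le
  have h4 := Real.sqrt_pos.2 hd
  field_simp
  rw [h3]; ring

end FluidChart

end

section

variable {Ω : Set (ℝ × E3)} {N : ℝ × E3 → ℝ} {g : ℝ × E3 → Matrix (Fin 3) (Fin 3) ℝ}
  {m k : ℝ × E3 → ℝ}

theorem FluidChart.shape_smooth (h : FluidChart Ω N g m k) : MatSmooth Ω (shape N g) := by
  refine (h.metric_smooth.inv fun _ hq => h.metric_det_ne hq).mul fun i j => ?_
  simp only [secondForm, Matrix.of_apply]
  exact (contDiffOn_const.div (contDiffOn_const.mul h.lapse_smooth) fun q hq =>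
    mul_ne_zero two_ne_zero (h.lapse_pos q hq).ne').neg.mul
      (pd_contDiffOn h.isOpen (h.metric_smooth i j))

theorem sq_sqrt_le {a b : ℝ} (hab : a ≤ b) (hb : 0 ≤ b) : Real.sqrt a ^ 2 ≤ b := by
  rcases le_total 0 a with ha | ha
  · rwa [Real.sq_sqrt ha]
  · rw [Real.sqrt_eq_zero_of_nonpos ha]; simpa using hb

theorem FluidChart.entropyData (h : FluidChart Ω N g m k) {J : Set ℝ} {y : E3}
    (hJ : IsOpen J) (hΩ : ∀ t ∈ J, (t, y) ∈ Ω) {α κ β : ℝ → ℝ}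
    (hexp : ∀ t ∈ J, ∀ w : Fin 3 → ℝ,
      w ⬝ᵥ (secondForm N g (t, y) *ᵥ w)
        ≤ α t * (shape N g (t, y)).trace * (w ⬝ᵥ (g (t, y) *ᵥ w)) ∧
      α t * (shape N g (t, y)).trace * (w ⬝ᵥ (g (t, y) *ᵥ w)) ≤ 0)
    (hk_mem : ∀ t ∈ J, k (t, y) ∈ Set.Icc (0 : ℝ) (4 / 3))
    (hα_mem : ∀ t ∈ J, α t ∈ Set.Icc (0 : ℝ) (1 / 3)) (hα : ContDiffOn ℝ 2 α J)
    (hk_deriv : ∀ t ∈ J, HasDerivAt (fun s => k (s, y))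
      (N (t, y) * (κ t * (shape N g (t, y)).trace)) t)
    (hα_deriv : ∀ t ∈ J, HasDerivAt α (N (t, y) * (β t * (shape N g (t, y)).trace)) t)
    (hκ : ∀ t ∈ J, 0 ≤ κ t) (hβ : ∀ t ∈ J, 0 ≤ β t)
    (hκ_le : ∀ t ∈ J, 3 * (4 - 3 * k (t, y)) * κ t
      ≤ k (t, y) * (9 * k (t, y) ^ 2 - 12 * k (t, y) + 8))
    (hκ_le_rate : ∀ t ∈ J, α t ≠ 1 / 3 → 3 * (4 - 3 * k (t, y)) * κ t ≤
      k (t, y) * (9 * k (t, y) ^ 2 - 12 * k (t, y) + 8) * (9 * β t / (4 * (1 - 3 * α t)))) :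
    EntropyData J (fun t => N (t, y)) (fun t => m (t, y)) (fun t => k (t, y)) α κ β
      (fun t => (shape N g (t, y)).trace)
      (fun t => (mixedWeyl N g (t, y) * mixedWeyl N g (t, y)).trace)
      (fun t => (shape N g (t, y) * mixedWeyl N g (t, y)).trace)
      (fun t => (shape N g (t, y) * (mixedWeyl N g (t, y) * mixedWeyl N g (t, y))).trace)
      (fun t => Real.sqrt (g (t, y)).det) := by
  have hb := fun t (ht : t ∈ J) => expansion_bounds (h.metric_pos _ (hΩ t ht))
    (h.secondForm_transpose (hΩ t ht))
    ((h.weyl_curvatureLike (hΩ t ht)).electricPart_transpose (N (t, y)))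
    (h.trace_electricWeyl (hΩ t ht)) (hexp t ht)
  have hX := fun t (ht : t ∈ J) i j => h.mixedWeyl_deriv (hΩ t ht) rfl i j
  exact
  { isOpen := hJ
    n_pos := fun t ht => h.lapse_pos _ (hΩ t ht)
    D_pos := fun t ht => Real.sqrt_pos.2 (h.metric_pos _ (hΩ t ht)).det_pos
    D_deriv := fun t ht => h.sqrt_det_deriv (hΩ t ht) rfl
    m_deriv := fun t ht => h.density_deriv (hΩ t ht) rfl
    v_deriv := fun t ht => by
      refine (hasDerivAt_trace_sq (hX t ht)).congr_deriv ?_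
      have hX0 := h.mixedWeyl_trace (hΩ t ht)
      set X := mixedWeyl N g (t, y)
      set K := shape N g (t, y)
      have e1 : (X * (X * K)).trace = (K * (X * X)).trace := by
        rw [← Matrix.mul_assoc, Matrix.trace_mul_comm]
      have e2 : (X * (K * X)).trace = (K * (X * X)).trace := by
        rw [Matrix.trace_mul_comm, Matrix.mul_assoc]
      simp only [Matrix.mul_smul, Matrix.mul_add, Matrix.mul_sub, Matrix.mul_one,
        Matrix.trace_smul, Matrix.trace_add, Matrix.trace_sub, smul_eq_mul, e1, e2, hX0,
        Matrix.trace_mul_comm X K]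
      ring
    v_nonneg := fun t ht => (h.mixedWeyl_sq (hΩ t ht)).1
    -- At a zero of `X` only the source term `(km/2)(K - H/3)` remains in its derivative, and the
    -- trace-free part of `K` is controlled by the expansion condition.
    v_zero := fun t ht hv => by
      have hX0 := (h.mixedWeyl_sq (hΩ t ht)).2 hv
      obtain ⟨h1, h2⟩ := sqrt_trace_sq_one_sided (hX t ht) hX0
      refine ⟨_, Real.sqrt_nonneg _, sq_sqrt_le ?_ (by positivity), h1, h2⟩
      simp only [hX0, Matrix.mul_zero, Matrix.zero_mul, Matrix.trace_zero, zero_smul, smul_zero,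
        sub_zero, add_zero, zero_add]
      rw [smul_smul, Matrix.smul_mul, Matrix.mul_smul, smul_smul, Matrix.trace_smul, smul_eq_mul]
      refine le_trans (mul_le_mul_of_nonneg_left (hb t ht).2.2.2.1 (mul_self_nonneg _)) (le_of_eq ?_)
      change _ * (2 / 3 * ((1 - 3 * α t) * (shape N g (t, y)).trace) ^ 2) = _
      ring
    τ₂_le := fun t ht => (hb t ht).2.1
    τ₁_le := fun t ht => (hb t ht).2.2.1
    τ₂_zero := fun t ht hH => by
      have h0 := (hb t ht).2.2.2.2.1 hH
      simp only [shape, h0, Matrix.mul_zero, Matrix.zero_mul, Matrix.trace_zero]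
    H_nonpos := fun t ht => (hb t ht).1
    nH_cont := by
      have h1 : ContDiffOn ℝ ∞ (fun q => N q * (shape N g q).trace) Ω :=
        h.lapse_smooth.mul (ContDiffOn.sum fun i _ => h.shape_smooth i i)
      exact h1.continuousOn.comp (by fun_prop : ContinuousOn (fun t => (t, y)) J) hΩ
    k_mem := hk_mem
    α_mem := hα_mem
    α_contDiff := hα
    k_deriv := hk_deriv
    α_deriv := hα_deriv
    κ_nonneg := hκ
    β_nonneg := hβ
    κ_le := hκ_le
    κ_le_rate := hκ_le_rate }

end

/-! ### Monotonicity and the equality case along a time line -/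

namespace EntropyData

variable {J : Set ℝ} {n m k α κ β H v τ₁ τ₂ D S : ℝ → ℝ}

theorem hasDerivWithinAt_of_eq_entropy (h : EntropyData J n m k α κ β H v τ₁ τ₂ D)
    (hS : ∀ t ∈ J, S t = entropy k m α v D t) {t : ℝ} (ht : t ∈ J) {a : ℝ} {I : Set ℝ}
    (ha : HasDerivWithinAt (entropy k m α v D) a I t) : HasDerivWithinAt S a I t := by
  refine ha.congr_of_eventuallyEq (mem_nhdsWithin_of_mem_nhds ?_) (hS t ht)
  filter_upwards [h.isOpen.mem_nhds ht] with s hs using hS s hs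

theorem monotoneOn_of_eq_entropy (h : EntropyData J n m k α κ β H v τ₁ τ₂ D)
    (hS : ∀ t ∈ J, S t = entropy k m α v D t) {I : Set ℝ} (hI : I ⊆ J) (hI' : I.OrdConnected) :
    MonotoneOn S I := fun a ha b hb hab => by
  refine le_of_right_deriv_nonneg hab fun t ht => ?_
  have htJ := hI (hI'.out ha hb ht)
  obtain ⟨c, σ₁, σ₂, hc0, -, h1, h2, h3, -⟩ := h.entropy_deriv htJ
  exact ⟨_, _, h.hasDerivWithinAt_of_eq_entropy hS htJ h1,
    h.hasDerivWithinAt_of_eq_entropy hS htJ h2,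
    mul_nonneg (h.D_pos t htJ).le (add_nonneg hc0 h3)⟩

theorem deriv_of_eq_entropy (h : EntropyData J n m k α κ β H v τ₁ τ₂ D)
    (hS : ∀ t ∈ J, S t = entropy k m α v D t) {t : ℝ} (ht : t ∈ J) :
    (∃ a b : ℝ, HasDerivWithinAt S a (Set.Ici t) t ∧ HasDerivWithinAt S b (Set.Iic t) t ∧
      0 ≤ (n t)⁻¹ * a ∧ 0 ≤ (n t)⁻¹ * b) ∧
    (v t ≠ 0 ∨ v t = 0 ∧ m t = 0 → DifferentiableAt ℝ S t) ∧
    (DifferentiableAt ℝ S t → 0 ≤ (n t)⁻¹ * deriv S t) ∧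
    DifferentiableAt ℝ (fun s => sCrit (k s) (α s)) t ∧
    ((DifferentiableAt ℝ S t ∧ (n t)⁻¹ * deriv S t = 0) ↔
      ((n t)⁻¹ * deriv (fun s => sCrit (k s) (α s)) t = 0 ∧
        (H t = 0 ∨ (v t = 0 ∧ ¬ (v t = 0 ∧ m t = 0) ∧ α t = 1 / 3 ∧
          sCrit (k t) (α t) = 0)))) := by
  obtain ⟨c, σ₁, σ₂, hc0, hc, h1, h2, h3, h4, hreg, hkink, hstat, hcrit⟩ := h.entropy_deriv ht
  have hN := h.n_pos t ht
  have hDp := h.D_pos t ht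
  have hr := h.hasDerivWithinAt_of_eq_entropy hS ht h1
  have hl := h.hasDerivWithinAt_of_eq_entropy hS ht h2
  have hdiff : σ₁ = σ₂ → DifferentiableAt ℝ S t := fun hσ =>
    (hasDerivAt_of_one_sided hr (hσ ▸ hl)).differentiableAt
  refine ⟨⟨_, _, hr, hl, ?_, ?_⟩, fun h5 => ?_, fun h5 => ?_, hc.differentiableAt, ?_⟩
  · exact mul_nonneg (inv_nonneg.2 hN.le) (mul_nonneg hDp.le (add_nonneg hc0 h3))
  · exact mul_nonneg (inv_nonneg.2 hN.le) (mul_nonneg hDp.le (add_nonneg hc0 h4))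
  · exact hdiff (hreg (by tauto)).1
  · rw [← (one_sided_derivs_eq hr hl h5).1]
    exact mul_nonneg (inv_nonneg.2 hN.le) (mul_nonneg hDp.le (add_nonneg hc0 h3))
  rw [hc.deriv, mul_eq_zero_iff_left (inv_ne_zero hN.ne'),
    mul_eq_zero_iff_left (inv_ne_zero hN.ne')]
  constructor
  · rintro ⟨h5, h6⟩
    obtain ⟨e1, e2⟩ := one_sided_derivs_eq hr hl h5
    rw [h6, mul_eq_zero, or_iff_right hDp.ne'] at e1 e2
    have hc1 : c = 0 := by linarith
    refine ⟨hc1, ?_⟩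
    rcases (h.H_nonpos t ht).eq_or_lt with hH | hH
    · exact Or.inl hH
    · right
      by_cases h7 : m t = 0 ∨ v t ≠ 0
      · have := (hreg h7).2 hH
        linarith
      · have hm : m t ≠ 0 := fun h8 => h7 (Or.inl h8)
        have hv0 : v t = 0 := by tauto
        obtain ⟨h8, h9⟩ := hkink hm hv0
        rw [h9] at e1 e2
        -- Adding the two vanishing one-sided derivatives cancels the opposite slopes `σ₁` and
        -- `-σ₁`.
        have h10 : n t * H t * sCrit (k t) (α t) = 0 := by linarith
        have h11 := (mul_eq_zero.1 h10).resolve_left (mul_ne_zero hN.ne' hH.ne)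
        exact ⟨hv0, fun h12 => hm h12.2, h.sCrit_eq_zero ht h11, h11⟩
  · rintro ⟨hc1, h5⟩
    have hval : σ₁ = 0 ∧ σ₂ = 0 ∧
        n t * H t * (weylRatio (k t) (m t) (v t) + sCrit (k t) (α t)) = 0 := by
      rcases h5 with hH | ⟨hv0, h6, hα, hs⟩
      · exact ⟨(hstat hH).1, (hstat hH).2, by rw [hH]; ring⟩
      · have hm : m t ≠ 0 := fun h7 => h6 ⟨hv0, h7⟩
        exact ⟨(hcrit hm hv0 hα).1, (hcrit hm hv0 hα).2, by rw [(hkink hm hv0).2, hs]; ring⟩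
    have hd := hdiff (hval.1.trans hval.2.1.symm)
    refine ⟨hd, ?_⟩
    rw [← (one_sided_derivs_eq hr hl hd).1, hval.1, hc1, hval.2.2]
    ring

end EntropyData

/-! ### From charts to the manifold -/

section Manifold

variable {M : Type*} [TopologicalSpace M] [ChartedSpace E3 M]
  {N : ℝ → M → ℝ} {g : ℝ → (x : M) → TangentSpace (𝓡 3) x →L[ℝ] TangentSpace (𝓡 3) x →L[ℝ] ℝ}
  {m k α : ℝ → M → ℝ} {J : Set ℝ} {U : Set M} {φ : OpenPartialHomeomorph M E3}

/-- The region `J × U` in the chart `φ`. -/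
def chartRegion (J : Set ℝ) (U : Set M) (φ : OpenPartialHomeomorph M E3) : Set (ℝ × E3) :=
  J ×ˢ (φ.target ∩ φ.symm ⁻¹' U)

/-- The differential of the inverse chart is injective, so it pulls a positive definite form back to
a positive definite one. -/
theorem metricInChart_posDef [IsManifold (𝓡 3) ∞ M] (hg : IsFoliatedSpacetime N g J U) (hφ : IsChart φ) {q : ℝ × E3}
    (hq : q ∈ chartRegion J U φ) : (metricInChart φ g q).PosDef := by
  obtain ⟨ht, hy, hU⟩ := hq
  have hinj : Function.Injective (mfderiv (𝓡 3) (𝓡 3) φ.symm q.2) := by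
    have hd : φ.MDifferentiable (𝓡 3) (𝓡 3) :=
      ⟨(contMDiffOn_of_mem_maximalAtlas hφ).mdifferentiableOn (by simp),
        (contMDiffOn_symm_of_mem_maximalAtlas hφ).mdifferentiableOn (by simp)⟩
    exact hd.symm.mfderiv_injective hy
  set A := mfderiv (𝓡 3) (𝓡 3) φ.symm q.2
  refine Matrix.PosDef.of_dotProduct_mulVec_pos ?_ fun w hw => ?_
  · ext i j
    exact hg.metric_symm _ ht _ hU _ _
  · set w' : E3 := WithLp.toLp 2 w
    have hw' : w' ≠ 0 := fun h0 => hw (by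
      ext i; exact congrArg (fun u : E3 => u i) h0)
    have hA : A w' ≠ 0 := fun h0 => hw' (hinj (h0.trans (map_zero A).symm))
    have h1 := hg.metric_pos _ ht _ hU _ hA
    have h2 : w' = ∑ i, w i • (EuclideanSpace.single i (1 : ℝ) : E3) := by
      ext j; simp [w', Finset.sum_apply, Pi.single_apply]
    have h3 : g q.1 (φ.symm q.2) (A w') (A w') = w ⬝ᵥ (metricInChart φ g q *ᵥ w) := by
      have h4 : A w' = ∑ i, w i • A (EuclideanSpace.single i (1 : ℝ) : E3) := by
        rw [h2]
        exact (map_sum A _ _).trans (Finset.sum_congr rfl fun i _ => map_smul A _ _)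
      rw [h4]
      simp only [map_sum, map_smul, dotProduct, Matrix.mulVec, metricInChart, Matrix.of_apply,
        sum_apply, smul_apply, smul_eq_mul]
      refine Finset.sum_congr rfl fun i _ => congrArg (w i * ·) ?_
      exact Finset.sum_congr rfl fun j _ =>
        (congrArg (w j * ·) (hg.metric_symm _ ht _ hU _ _)).trans (mul_comm _ _)
    rw [star_trivial, ← h3]
    exact h1

theorem isOpen_chartRegion (hg : IsFoliatedSpacetime N g J U) : IsOpen (chartRegion J U φ) :=
  hg.isOpen_time.prod (φ.symm.isOpen_inter_preimage hg.isOpen_space)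

theorem IsPerfectFluidElectricRegion.fluidChart [IsManifold (𝓡 3) ∞ M]
    (h : IsPerfectFluidElectricRegion N g m k J U)
    (hφ : IsChart φ) : FluidChart (chartRegion J U φ) (inChart φ N) (metricInChart φ g)
      (inChart φ m) (inChart φ k) where
  isOpen := isOpen_chartRegion h.toIsFoliatedSpacetime
  lapse_smooth := h.lapse_smooth φ hφ
  metric_smooth := h.metric_smooth φ hφ
  lapse_pos q hq := h.lapse_pos _ hq.1 _ hq.2.2
  metric_pos q hq := metricInChart_posDef h.toIsFoliatedSpacetime hφ hq
  einstein_eq q hq a b := by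
    have h1 := h.einstein_eq φ hφ q.1 hq.1 (φ.symm q.2) ⟨φ.map_target hq.2.1, hq.2.2⟩ a b
    rw [einsteinAt, φ.right_inv hq.2.1] at h1
    exact h1
  electric q hq i j l := by
    have h1 := h.electric φ hφ q.1 hq.1 (φ.symm q.2) ⟨φ.map_target hq.2.1, hq.2.2⟩ i j l
    rw [weylAt, φ.right_inv hq.2.1] at h1
    exact h1

variable [IsManifold (𝓡 3) ∞ M]

theorem entropyData_of_hypotheses (h : IsPerfectFluidElectricRegion N g m k J U)
    (hexp : IsExpandingRegion N g α J U) (hpar : EvolutionInequalities N g k α J U)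
    (hφ : IsChart φ) {x : M} (hx : x ∈ φ.source ∩ U) :
    EntropyData J (fun t => N t x) (fun t => m t x) (fun t => k t x) (fun t => α t x)
      (fun t => rate N g k φ t x) (fun t => rate N g α φ t x)
      (fun t => (shape (inChart φ N) (metricInChart φ g) (t, φ x)).trace)
      (fun t => (mixedWeyl (inChart φ N) (metricInChart φ g) (t, φ x)
        * mixedWeyl (inChart φ N) (metricInChart φ g) (t, φ x)).trace)
      (fun t => (shape (inChart φ N) (metricInChart φ g) (t, φ x)
        * mixedWeyl (inChart φ N) (metricInChart φ g) (t, φ x)).trace)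
      (fun t => (shape (inChart φ N) (metricInChart φ g) (t, φ x)
        * (mixedWeyl (inChart φ N) (metricInChart φ g) (t, φ x)
          * mixedWeyl (inChart φ N) (metricInChart φ g) (t, φ x))).trace)
      (fun t => Real.sqrt (metricInChart φ g (t, φ x)).det) := by
  have hF := h.fluidChart hφ
  have hread : ∀ (f : ℝ → M → ℝ) t, inChart φ f (t, φ x) = f t x := fun f t => by
    simp only [inChart, φ.left_inv hx.1]
  have hΩ : ∀ t ∈ J, (t, φ x) ∈ chartRegion J U φ := fun t ht =>
    ⟨ht, φ.map_source hx.1, by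
      change φ.symm (φ x) ∈ U
      rw [φ.left_inv hx.1]; exact hx.2⟩
  have hH : ∀ t ∈ J, meanCurvAt N g φ t x
      = (shape (inChart φ N) (metricInChart φ g) (t, φ x)).trace := fun t ht =>
    hF.meanCurv_eq (hΩ t ht)
  -- Where `H = 0` the quotient `rate` is zero by convention, so `D_T u = u' H` needs the
  -- stationarity condition there.
  have hrate : ∀ (u : ℝ → M → ℝ) t, t ∈ J → DifferentiableAt ℝ (fun s => u s x) t →
      (meanCurvAt N g φ t x = 0 → DT N u t x = 0) →
      HasDerivAt (fun s => u s x) (inChart φ N (t, φ x) * (rate N g u φ t x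
        * (shape (inChart φ N) (metricInChart φ g) (t, φ x)).trace)) t := by
    intro u t ht hd h0
    refine hd.hasDerivAt.congr_deriv ?_
    have hN := (h.lapse_pos t ht x hx.2).ne'
    rw [← hH t ht, hread, rate]
    by_cases h1 : meanCurvAt N g φ t x = 0
    · have h2 := h0 h1
      rw [DT, mul_eq_zero, or_iff_right (inv_ne_zero hN)] at h2
      rw [h2, h1]; simp
    · rw [div_mul_cancel₀ _ h1, DT, mul_inv_cancel_left₀ hN]
  have hJn := fun t (ht : t ∈ J) => h.isOpen_time.mem_nhds ht
  have hdata := hF.entropyData (α := fun t => α t x) (κ := fun t => rate N g k φ t x)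
    (β := fun t => rate N g α φ t x) h.isOpen_time hΩ (fun t ht w => ?_) (fun t ht => ?_)
    (fun t ht => hexp.α_mem t ht x hx.2) (hpar.α_diff x hx.2) (fun t ht => ?_) (fun t ht => ?_)
    (fun t ht => hpar.k_rate φ hφ t ht x hx) (fun t ht => hpar.α_rate φ hφ t ht x hx)
    (fun t ht => ?_) (fun t ht hα => ?_)
  · simpa only [hread] using hdata
  · rw [← hH t ht]
    exact hexp.expanding φ hφ t ht x hx w
  · rw [hread]; exact h.k_mem t ht x hx.2
  · rw [show (fun s => inChart φ k (s, φ x)) = fun s => k s x from funext (hread k)]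
    exact hrate k t ht ((hpar.k_diff x hx.2).differentiableAt (hJn t ht))
      fun h0 => (hpar.stationary φ hφ t ht x hx h0).1
  · exact hrate α t ht (((hpar.α_diff x hx.2).contDiffAt (hJn t ht)).differentiableAt (by simp))
      fun h0 => (hpar.stationary φ hφ t ht x hx h0).2
  · rw [hread]
    refine (hpar.k_rate_le φ hφ t ht x hx).trans ?_
    have h1 := (h.k_mem t ht x hx.2).1
    have h2 := discr_pos (k t x)
    -- Both branches are at most one: at `α = 1/3` the infinite quotient leaves the entry `1` of the
    -- minimum.
    refine mul_le_of_le_one_right (by positivity) ?_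
    split_ifs
    · exact le_rfl
    · exact min_le_right _ _
  · rw [hread]
    refine (hpar.k_rate_le φ hφ t ht x hx).trans ?_
    have h1 := (h.k_mem t ht x hx.2).1
    have h2 := discr_pos (k t x)
    rw [if_neg hα]
    exact mul_le_mul_of_nonneg_left (min_le_left _ _) (by positivity)

end Manifold

end WeylEntropy

end

theorem theorem6p3
    {M : Type*} [TopologicalSpace M] [ChartedSpace WeylEntropy.E3 M] [IsManifold (𝓡 3) ∞ M]
    (N : ℝ → M → ℝ)
    (g : ℝ → (x : M) → TangentSpace (𝓡 3) x →L[ℝ] TangentSpace (𝓡 3) x →L[ℝ] ℝ)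
    (m k α : ℝ → M → ℝ) (J : Set ℝ) (U : Set M)
    (hfluid : WeylEntropy.IsPerfectFluidElectricRegion N g m k J U)
    (hexp : WeylEntropy.IsExpandingRegion N g α J U)
    (hpar : WeylEntropy.EvolutionInequalities N g k α J U)
    (φ : OpenPartialHomeomorph M WeylEntropy.E3) (hφ : WeylEntropy.IsChart φ)
    (x : M) (hx : x ∈ φ.source ∩ U) :
    -- monotonicity in time
    (∀ I : Set ℝ, I ⊆ J → I.OrdConnected →
      MonotoneOn (fun s => WeylEntropy.entropyPF N g k α φ s x) I) ∧
    ∀ t ∈ J,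
      -- the one-sided derivatives `D_T S^pf` exist and are nonnegative
      (∃ a b : ℝ,
        HasDerivWithinAt (fun s => WeylEntropy.entropyPF N g k α φ s x) a (Set.Ici t) t ∧
        HasDerivWithinAt (fun s => WeylEntropy.entropyPF N g k α φ s x) b (Set.Iic t) t ∧
        0 ≤ (N t x)⁻¹ * a ∧ 0 ≤ (N t x)⁻¹ * b) ∧
      -- the derivative `D_T S^pf` exists except possibly where the Weyl tensor vanishes and the
      -- Riemann tensor does not, and it is nonnegative wherever it exists
      (WeylEntropy.weylAt N g φ t x ≠ 0 ∨ WeylEntropy.riemannAt N g φ t x = 0 →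
        DifferentiableAt ℝ (fun s => WeylEntropy.entropyPF N g k α φ s x) t) ∧
      (DifferentiableAt ℝ (fun s => WeylEntropy.entropyPF N g k α φ s x) t →
        0 ≤ WeylEntropy.DT N (WeylEntropy.entropyPF N g k α φ) t x) ∧
      -- the equality case
      DifferentiableAt ℝ (fun s => WeylEntropy.sCrit (k s x) (α s x)) t ∧
      ((DifferentiableAt ℝ (fun s => WeylEntropy.entropyPF N g k α φ s x) t ∧
          WeylEntropy.DT N (WeylEntropy.entropyPF N g k α φ) t x = 0) ↔
        (WeylEntropy.DT N (fun s y => WeylEntropy.sCrit (k s y) (α s y)) t x = 0 ∧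
          (WeylEntropy.secondFormAt N g φ t x = 0 ∨
            (WeylEntropy.weylAt N g φ t x = 0 ∧ WeylEntropy.riemannAt N g φ t x ≠ 0 ∧
              α t x = 1 / 3 ∧ WeylEntropy.sCrit (k t x) (α t x) = 0)))) := by
  open WeylEntropy in
  have hF := hfluid.fluidChart hφ
  have hΩ : ∀ t ∈ J, (t, φ x) ∈ chartRegion J U φ := fun t ht =>
    ⟨ht, φ.map_source hx.1, by
      change φ.symm (φ x) ∈ U
      rw [φ.left_inv hx.1]; exact hx.2⟩
  have hE := entropyData_of_hypotheses hfluid hexp hpar hφ hx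
  set H : ℝ → ℝ := fun t => (shape (inChart φ N) (metricInChart φ g) (t, φ x)).trace with hHdef
  set v : ℝ → ℝ := fun t => (mixedWeyl (inChart φ N) (metricInChart φ g) (t, φ x)
    * mixedWeyl (inChart φ N) (metricInChart φ g) (t, φ x)).trace with hv
  set D : ℝ → ℝ := fun t => Real.sqrt (metricInChart φ g (t, φ x)).det with hD
  have hread : ∀ (f : ℝ → M → ℝ) t, inChart φ f (t, φ x) = f t x := fun f t => by
    simp only [inChart, φ.left_inv hx.1]
  have hS : ∀ t ∈ J, entropyPF N g k α φ t x = EntropyData.entropy (fun t => k t x)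
      (fun t => m t x) (fun t => α t x) v D t := fun t ht => by
    rw [entropyPF, hF.entropyDensity_eq (hΩ t ht), hread, hread]
  have hweyl : ∀ t ∈ J, weylAt N g φ t x = 0 ↔ v t = 0 := fun t ht =>
    hF.weyl_eq_zero_iff (hΩ t ht)
  have hriem : ∀ t ∈ J, riemannAt N g φ t x = 0 ↔ v t = 0 ∧ m t x = 0 := fun t ht => by
    rw [← hread m]; exact hF.riemann_eq_zero_iff (hΩ t ht)
  -- The converse direction uses the expansion condition: `αH - K` is positive semidefinite with
  -- trace `-(1 - 3α)H = 0`, hence zero.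
  have hform : ∀ t ∈ J, secondFormAt N g φ t x = 0 ↔ H t = 0 := fun t ht => by
    refine ⟨fun h0 => ?_, fun h0 => ?_⟩
    · have h1 : secondForm (inChart φ N) (metricInChart φ g) (t, φ x) = 0 := h0
      simp only [hHdef, shape, h1, Matrix.mul_zero, Matrix.trace_zero]
    · refine (expansion_bounds (hF.metric_pos _ (hΩ t ht)) (hF.secondForm_transpose (hΩ t ht))
        ((hF.weyl_curvatureLike (hΩ t ht)).electricPart_transpose _)
        (hF.trace_electricWeyl (hΩ t ht)) (α := α t x) fun w => ?_).2.2.2.2.1 h0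
      have h1 := hexp.expanding φ hφ t ht x hx w
      rw [show meanCurvAt N g φ t x = H t from hF.meanCurv_eq (hΩ t ht)] at h1
      exact h1
  refine ⟨fun I hI hI' => hE.monotoneOn_of_eq_entropy hS hI hI', fun t ht => ?_⟩
  rw [Ne, hweyl t ht, Ne, hriem t ht, hform t ht]
  exact hE.deriv_of_eq_entropy hS ht
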